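/- Let $M$ be a compact Hausdorff $n$-dimensional manifold with corners of class $C^{2}$, $n\ge 1$ (locally modelled on $[0,\infty)^n$), with a finite system of closed faces $\{F_i\}$, where near each point $p\in M$ the faces through $p$ correspond one to one to the coordinate hyperplanes $\{x_j=0\}$ through $p$; that is, $M$ is a polyhedron, its boundary being made of hypersurfaces that intersect transversely. Let $g$ be a Riemannian metric on $M$ that is of class $C^1$ in these charts (this includes polyhedra with $C^{2,\alpha}$ faces and $C^{2,\alpha}$ metrics). Let $F_T$ and $F_B$ be two disjoint faces (top and bottom), call all other faces lateral, and assume that $F_T$ and $F_B$ meet every adjacent lateral face at dihedral angle $\pi/2$ along the whole intersection. (This covers every Riemannian polyhedron over a prism $P_0\times[0,1]^{n-2}$ with the dihedral angles of the prism, $F_T$ and $F_B$ being the faces that lie over $\{x_n=1\}$ and $\{x_n=0\}$.) Call a $C^1$ vector field $X$ on $M$ *admissible* if it is tangential to $\partial M$ along all lateral faces and points (weakly) into $M$ along $F_T$ and along $F_B$. Admissible fields are the infinitesimal deformations allowed when the area of $\partial\Omega\cap\mathring M$ is minimized among sets $\Omega\subset M$ with $F_T\subset\Omega$ and $\Omega\cap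 F_B=\emptyset$. Let $\Sigma$ be an $(n-1)$-dimensional varifold on $M$, i.e. a finite Borel measure on the Grassmann bundle of $(n-1)$-dimensional subspaces of the tangent spaces of $M$, which is stationary for this problem with barriers: $$\delta\Sigma(X)=\int \mathrm{div}_S X(x)\,d\Sigma(x,S)\ \ge\ 0\qquad\text{for every admissible } X .$$ Assume that $F_T$ and $F_B$ are strictly mean convex: at every point of the closed faces $F_T$ and $F_B$ the mean curvature with respect to the outward unit normal is positive (with the sign for which the unit sphere in $\mathbb R^n$, as boundary of the unit ball, has mean curvature $n-1$). Then $$\operatorname{spt}\Sigma\cap F_T=\emptyset\qquad\text{and}\qquad \operatorname{spt}\Sigma\cap F_B=\emptyset .$$ -/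

import Mathlib

open Set Filter Topology Bundle Manifold MeasureTheory

noncomputable section

namespace RiemPoly

/-- The model vector space `ℝⁿ`. -/
abbrev Eucl (n : ℕ) : Type := EuclideanSpace ℝ (Fin n)

/-- The model `[0,∞)ⁿ ⊆ ℝⁿ` for `n`-dimensional manifolds with corners. -/
abbrev cornerModel (n : ℕ) : ModelWithCorners ℝ (Eucl n) (EuclideanQuadrant n) :=
  modelWithCornersEuclideanQuadrant n

/-- The `k`-th standard coordinate of a vector of `ℝⁿ`. -/
def component {n : ℕ} (v : Eucl n) (k : Fin n) : ℝ := v k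

/-- The `k`-th standard basis vector of `ℝⁿ`. -/
def basisVec {n : ℕ} (k : Fin n) : Eucl n := EuclideanSpace.single k (1 : ℝ)

/-- A Riemannian metric of class `C¹` on the `C²` manifold with corners `M`. -/
abbrev Metric (n : ℕ) (M : Type*) [TopologicalSpace M] [ChartedSpace (EuclideanQuadrant n) M]
    [IsManifold (cornerModel n) 2 M] :=
  ContMDiffRiemannianMetric (cornerModel n) 1 (Eucl n)
    (fun x : M => TangentSpace (cornerModel n) x)

section Coordinates

variable {n : ℕ} {M : Type*} [TopologicalSpace M] [ChartedSpace (EuclideanQuadrant n) M]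

/-- The point `z` of the coordinate domain of the preferred chart at `p`, as a point of `M`. -/
def pointAt (p : M) (z : Eucl n) : M := (extChartAt (cornerModel n) p).symm z

/-- The coordinates of `q` in the preferred chart at `p`. -/
def coords (p q : M) : Eucl n := extChartAt (cornerModel n) p q

/-- The coordinate vector field `∂ᵢ` of the preferred chart at `p`, at the point with
coordinates `z`. At `z = coords p p` this is the `i`-th standard basis vector, since the tangent
space at `p` is identified with `ℝⁿ` by means of the preferred chart at `p`. -/
def coordVec (p : M) (z : Eucl n) (i : Fin n) : TangentSpace (cornerModel n) (pointAt p z) :=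
  mfderivWithin 𝓘(ℝ, Eucl n) (cornerModel n) (extChartAt (cornerModel n) p).symm
    (range (cornerModel n)) z (basisVec i)

/-- The `k`-th component `Xᵏ = dzₖ(X)` of the vector field `X` in the preferred chart at `p`,
at the point with coordinates `z`. -/
def fieldCoord (X : ∀ x : M, TangentSpace (cornerModel n) x) (p : M) (k : Fin n) (z : Eucl n) : ℝ :=
  component (mfderiv (cornerModel n) 𝓘(ℝ, Eucl n) (extChartAt (cornerModel n) p) (pointAt p z)
    (X (pointAt p z))) k

/-- The partial derivative `∂ᵢ f` on the coordinate domain (one-sided at its boundary). -/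
def partialDeriv (f : Eucl n → ℝ) (i : Fin n) (z : Eucl n) : ℝ :=
  fderivWithin ℝ f (range (cornerModel n)) z (basisVec i)

variable [IsManifold (cornerModel n) 2 M] (g : Metric n M)

/-- The matrix `(gᵢⱼ)` of the metric in the preferred chart at `p`. -/
def gram (p : M) (z : Eucl n) : Matrix (Fin n) (Fin n) ℝ :=
  Matrix.of fun i j => g.inner (pointAt p z) (coordVec p z i) (coordVec p z j)

/-- The inverse matrix `(gⁱʲ)`. -/
def cogram (p : M) (z : Eucl n) : Matrix (Fin n) (Fin n) ℝ := (gram g p z)⁻¹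

/-- The Christoffel symbols `Γᵏᵢⱼ` of the Levi-Civita connection at `p`, in the preferred
chart at `p`. -/
def christoffel (p : M) (k i j : Fin n) : ℝ :=
  (1 / 2 : ℝ) * ∑ l : Fin n, cogram g p (coords p p) k l *
    (partialDeriv (fun z => gram g p z j l) i (coords p p)
      + partialDeriv (fun z => gram g p z i l) j (coords p p)
      - partialDeriv (fun z => gram g p z i j) l (coords p p))

/-- `(∇ᵢ X)ᵏ = ∂ᵢ Xᵏ + Γᵏᵢⱼ Xʲ` at `p`, in the preferred chart at `p`. -/
def covDeriv (X : ∀ x : M, TangentSpace (cornerModel n) x) (p : M) (i k : Fin n) : ℝ :=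
  partialDeriv (fieldCoord X p k) i (coords p p)
    + ∑ j : Fin n, christoffel g p k i j * fieldCoord X p j (coords p p)

/-- `div_S X = tr (Π ∘ ∇X)` at `p`, where `Π` is the orthogonal projection of `T_p M` onto the
subspace `S`. -/
def divAlong (X : ∀ x : M, TangentSpace (cornerModel n) x) (p : M)
    (Pr : TangentSpace (cornerModel n) p →L[ℝ] TangentSpace (cornerModel n) p) : ℝ :=
  ∑ i : Fin n, ∑ k : Fin n, component (Pr (basisVec k)) i * covDeriv g X p i k

/-- The mean curvature at `p`, with respect to the outward unit normal, of the coordinate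
hyperplane `{z_c = 0}` of the preferred chart at `p` (the region `{z_c ≥ 0}` being inside).
The inward unit normal is `νᵏ = gᵏᶜ / √gᶜᶜ`, the second fundamental form is
`A(u, v) = g(ν, ∇ᵤ v)` for `u, v` tangent to the hyperplane, so `Aᵢⱼ = Γᶜᵢⱼ / √gᶜᶜ`, and its trace
is taken with `gⁱʲ - νⁱ νʲ`. The unit sphere, as the boundary of the unit ball of `ℝⁿ`, has mean
curvature `n - 1`. -/
def meanCurvature (p : M) (c : Fin n) : ℝ :=
  ∑ i : Fin n, ∑ j : Fin n,
    (cogram g p (coords p p) i j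
      - cogram g p (coords p p) i c * cogram g p (coords p p) j c
          / cogram g p (coords p p) c c)
      * (christoffel g p c i j / √(cogram g p (coords p p) c c))

/-- The interior dihedral angle at `p` of the coordinate hyperplanes `{z_c = 0}`, `{z_d = 0}` of
the preferred chart at `p`: `cos γ = - g(ν_c, ν_d)` for the unit normals. -/
def dihedralAngle (p : M) (c d : Fin n) : ℝ :=
  Real.arccos (-(cogram g p (coords p p) c d
    / (√(cogram g p (coords p p) c c) * √(cogram g p (coords p p) d d))))

end Coordinates

section Faces

variable {n : ℕ} {M : Type*} [TopologicalSpace M] [ChartedSpace (EuclideanQuadrant n) M]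

/-- Near its point `p`, the set `F` is the coordinate hyperplane `{z_c = 0}` of the preferred
chart at `p`. -/
def IsFaceCoord (F : Set M) (p : M) (c : Fin n) : Prop :=
  p ∈ F ∧ ∀ᶠ q in 𝓝 p, q ∈ F ↔ coords p q c = 0

variable (n M) in
/-- The system of (closed) faces of a polyhedron: near each point `p`, the faces through `p`
correspond one to one to the coordinate hyperplanes `{z_c = 0}` through `p`. -/
structure FaceSystem (ι : Type*) where
  face : ι → Set M
  isClosed_face : ∀ i, IsClosed (face i)
  exists_coord : ∀ i, ∀ p ∈ face i, ∃ c : Fin n, IsFaceCoord (face i) p c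
  existsUnique_face : ∀ (p : M) (c : Fin n), coords p p c = 0 →
    ∃! i, IsFaceCoord (face i) p c

variable [IsManifold (cornerModel n) 2 M] (g : Metric n M)

/-- The set `F` (a face) has positive mean curvature with respect to the outward unit normal at
each of its points. -/
def StrictlyMeanConvex (F : Set M) : Prop :=
  ∀ (p : M) (c : Fin n), IsFaceCoord F p c → 0 < meanCurvature g p c

/-- The dihedral angle between `F` and `F'` equals `γ` at every point of `F ∩ F'`. -/
def MeetAtAngle (F F' : Set M) (γ : ℝ) : Prop :=
  ∀ (p : M) (c d : Fin n), IsFaceCoord F p c → IsFaceCoord F' p d → dihedralAngle g p c d = γ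

end Faces

section Varifolds

variable {n : ℕ} {M : Type*} [TopologicalSpace M] [ChartedSpace (EuclideanQuadrant n) M]
  [IsManifold (cornerModel n) 2 M] (g : Metric n M)

/-- `Pr` is the `g`-orthogonal projection of `T_p M` onto an `m`-dimensional subspace. -/
def IsOrthProj (m : ℕ) (p : M)
    (Pr : TangentSpace (cornerModel n) p →L[ℝ] TangentSpace (cornerModel n) p) : Prop :=
  (∀ u, Pr (Pr u) = Pr u) ∧ (∀ u v, g.inner p (Pr u) v = g.inner p u (Pr v)) ∧
    Module.finrank ℝ (LinearMap.range Pr.toLinearMap) = m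

variable (n M) in
/-- The total space of the bundle `End(TM)`. -/
abbrev EndBundle : Type _ :=
  TotalSpace (Eucl n →L[ℝ] Eucl n)
    (fun x : M => TangentSpace (cornerModel n) x →L[ℝ] TangentSpace (cornerModel n) x)

/-- An `m`-varifold on `M`: a finite Borel measure on the Grassmann bundle of `m`-dimensional
subspaces of the tangent spaces of `M`. As usual, a subspace is identified with the orthogonal
projection onto it, so that the Grassmann bundle is a closed subset of `End(TM)`. -/
structure Varifold (m : ℕ) where
  measure : @Measure (EndBundle n M) (borel _)
  finite : measure univ < ⊤
  isOrthProj : ∀ᵐ z ∂measure, IsOrthProj g m z.proj z.snd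

variable {g} {m : ℕ}

/-- The support of (the weight measure of) a varifold. -/
def Varifold.support (V : Varifold g m) : Set M :=
  {p | ∀ U ∈ 𝓝 p, 0 < V.measure (TotalSpace.proj ⁻¹' U)}

/-- The first variation `δV(X) = ∫ div_S X dV(x, S)`. -/
def Varifold.firstVariation (V : Varifold g m)
    (X : ∀ x : M, TangentSpace (cornerModel n) x) : ℝ :=
  @integral (EndBundle n M) ℝ _ _ (borel _) V.measure (fun z => divAlong g X z.proj z.snd)

/-- The infinitesimal deformations that are admissible for minimizing area among the hypersurfaces
`∂Ω ∩ int M` of sets `Ω` that contain the face `T` and are disjoint from the face `B`: vector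
fields of class `C¹` on `M` that are tangential to `∂M` along all other (lateral) faces, and point
into `M` (weakly) along `T` and `B`, where `M` acts as a barrier. -/
structure Admissible {ι : Type*} (F : FaceSystem n M ι) (T B : ι)
    (X : ∀ x : M, TangentSpace (cornerModel n) x) : Prop where
  contMDiff : ContMDiff (cornerModel n) (cornerModel n).tangent 1
    (fun x => (⟨x, X x⟩ : TangentBundle (cornerModel n) M))
  tangential : ∀ i, i ≠ T → i ≠ B → ∀ p c, IsFaceCoord (F.face i) p c →
    fieldCoord X p c (coords p p) = 0
  inward_top : ∀ p c, IsFaceCoord (F.face T) p c → 0 ≤ fieldCoord X p c (coords p p)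
  inward_bottom : ∀ p c, IsFaceCoord (F.face B) p c → 0 ≤ fieldCoord X p c (coords p p)

/-- `V` is stationary for the variational problem with barriers: to first order, no admissible
deformation decreases area. -/
def Varifold.IsStationary (V : Varifold g m) {ι : Type*} (F : FaceSystem n M ι) (T B : ι) : Prop :=
  ∀ X : ∀ x : M, TangentSpace (cornerModel n) x, Admissible F T B X → 0 ≤ V.firstVariation X

end Varifolds

end RiemPoly

end

/-!
The two claims are symmetric (`Admissible.swap`), so consider a point `p` of the face `F_T`. It is
enough to find an admissible `C¹` field, supported in the chart at `p`, whose divergence is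
nonpositive on all hyperplanes and negative near `p`: stationarity then says that a nonpositive
function has nonnegative integral, so the varifold has no mass near `p`
(`Varifold.measure_eq_zero`, `Varifold.support_inter_face_eq_empty`).

Such a field is built in the coordinates `z` of the chart at `p`, with `F_T = {z_c = 0}`
(`IsBarrierMetric.exists_barrier`). Let `f z = z_c + ε G₀(z - w, z - w)`, where `G₀` is the metric
at `p` and `ε` is small, and let `Z` be the gradient of `f`. Strict mean convexity says that the
divergence of the gradient of `z_c` on the tangent space of `F_T` at `p` is negative
(`traceKer_eq_meanCurvature`), and this persists for `Z` on the level sets of `f` near `p`. Put `r = (δ - f)₊`. On a hyperplane `S` the field `r⁴ Z` has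
divergence `r⁴ div_S Z - 4 r³ s²`, where `s` is the length of the projection of `Z` to `S`. For
hyperplanes that are not tangent to the level sets of `f`, the trace `div_S Z` may be positive, but
only by a multiple of `s`, and this is absorbed by the term `-4 r³ s²` (`total_le`).

The field `r⁴ Z` is not tangential to the lateral faces `{z_k = 0}` through `p`. Its component `Zᵏ`
is therefore multiplied by `r⁴ - r² m²` with `m = (r - 4 z_k)₊`, which vanishes for `z_k = 0`
(`cutoffField`). The main new term in the divergence is a positive multiple of `r² m Zᵏ`, so `Zᵏ`
has to be negative near the lateral face. This is where the angle enters: as it is `π / 2`, the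
gradient of `z_c` has no `k`-th component on `F_T ∩ {z_k = 0}`, and hence a negligible one nearby; the
quadratic term, centered at a point with `w_k = t > 0`, contributes about `-2 ε t`
(`barrierGrad_component`). All other terms are small compared with this one or absorbed by
`4 r³ s²` (`lateral_term_le`, `BarrierScale.divergence_le`).

It remains to pass from the chart at `p` to those at nearby points `q`, in which divergence, angles
and admissibility are expressed. On a hyperplane the divergence depends only on the symmetric part
of the covariant derivative (`IsInnerProd.traceL_proj_congr`), which is half the Lie derivative of
the metric and hence compatible with coordinate changes (`lieDer_pullback`, `divAlong_eq_symGrad`).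
The differentials of two coordinates that vanish on the same face are positive multiples of each
other (`IsFaceCoord.exists_pos_smul`), so that orthogonality of faces and signs of normal components can
be read off in the chart at `p` (`isBarrierMetric_metricIn`, `admissible_fieldOf`).
-/

noncomputable section

namespace RiemPoly

/-! ### Inner products, orthogonal projections and traces -/

section LinearAlgebra

variable {E : Type*} [NormedAddCommGroup E] [NormedSpace ℝ E]

/-- `G` is an inner product on `E` (not related to the norm of `E`). -/
structure IsInnerProd (G : E →L[ℝ] E →L[ℝ] ℝ) : Prop where
  symm : ∀ u v, G u v = G v u
  pos : ∀ u, u ≠ 0 → 0 < G u u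

/-- `P` is the `G`-orthogonal projection onto an `m`-dimensional subspace of `E`. -/
def IsProj (G : E →L[ℝ] E →L[ℝ] ℝ) (m : ℕ) (P : E →L[ℝ] E) : Prop :=
  (∀ u, P (P u) = P u) ∧ (∀ u v, G (P u) v = G u (P v)) ∧
    Module.finrank ℝ (LinearMap.range P.toLinearMap) = m

variable (E) in
/-- The trace, as a continuous linear functional on the continuous endomorphisms of a
finite-dimensional space. -/
def traceL [FiniteDimensional ℝ E] : (E →L[ℝ] E) →L[ℝ] ℝ :=
  LinearMap.toContinuousLinearMap ((LinearMap.trace ℝ E) ∘ₗ (ContinuousLinearMap.coeLM ℝ))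

namespace IsInnerProd

variable {G : E →L[ℝ] E →L[ℝ] ℝ} (hG : IsInnerProd G)

include hG

lemma nonneg (u : E) : 0 ≤ G u u := by
  by_cases h : u = 0
  · simp [h]
  · exact (hG.pos u h).le

lemma ext_left {u v : E} (h : ∀ w, G u w = G v w) : u = v := by
  by_contra hne
  have := hG.pos (u - v) (sub_ne_zero.2 hne)
  simp [h] at this

lemma cauchy_schwarz (u v : E) : G u v ^ 2 ≤ G u u * G v v := by
  by_cases hv : v = 0
  · simp [hv]
  have hpos := hG.pos v hv
  have h := hG.nonneg (G v v • u - G u v • v)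
  simp only [map_sub, map_smul, _root_.sub_apply, _root_.smul_apply,
    smul_eq_mul, hG.symm v u] at h
  have h2 : 0 ≤ G v v * (G u u * G v v - G u v ^ 2) := by nlinarith
  have := nonneg_of_mul_nonneg_right h2 hpos
  linarith

end IsInnerProd

variable [FiniteDimensional ℝ E]

lemma traceL_apply (A : E →L[ℝ] E) : traceL E A = LinearMap.trace ℝ E A := rfl

lemma traceL_smulRight (φ : E →L[ℝ] ℝ) (e : E) : traceL E (φ.smulRight e) = φ e := by
  rw [traceL_apply]
  exact LinearMap.trace_smulRight (φ : E →ₗ[ℝ] ℝ) e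

lemma traceL_comp_comm (A B : E →L[ℝ] E) : traceL E (A ∘L B) = traceL E (B ∘L A) :=
  LinearMap.trace_mul_comm ℝ (A : E →ₗ[ℝ] E) (B : E →ₗ[ℝ] E)

namespace IsInnerProd

variable {G : E →L[ℝ] E →L[ℝ] ℝ} (hG : IsInnerProd G)

include hG

lemma isInvertible : G.IsInvertible := by
  have hinj : Function.Injective G := fun u v h => hG.ext_left fun w => by rw [h]
  have hfr : Module.finrank ℝ E = Module.finrank ℝ (E →L[ℝ] ℝ) := by
    rw [← (LinearMap.toContinuousLinearMap (𝕜 := ℝ) (E := E) (F' := ℝ)).finrank_eq]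
    exact (Subspace.dual_finrank_eq).symm
  exact ⟨(LinearEquiv.ofInjectiveOfFinrankEq (G : E →ₗ[ℝ] (E →L[ℝ] ℝ)) hinj
    hfr).toContinuousLinearEquiv, by ext; rfl⟩

lemma apply_inverse (φ : E →L[ℝ] ℝ) : G (G.inverse φ) = φ := hG.isInvertible.self_apply_inverse φ

lemma inverse_apply (u : E) : G.inverse (G u) = u := hG.isInvertible.inverse_apply_self u

lemma inverse_symm (φ ψ : E →L[ℝ] ℝ) : φ (G.inverse ψ) = ψ (G.inverse φ) := by
  conv_lhs => rw [← hG.apply_inverse φ]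
  conv_rhs => rw [← hG.apply_inverse ψ]
  exact hG.symm _ _

set_option synthInstance.maxHeartbeats 200000 in
/-- An inner product whose inverse is bounded dominates the norm. -/
lemma norm_sq_le {K : ℝ} (h1 : ‖G‖ ≤ K) (h2 : ‖G.inverse‖ ≤ K) (u : E) :
    ‖u‖ ^ 2 ≤ K ^ 3 * G u u := by
  have hK : 0 ≤ K := (norm_nonneg G).trans h1
  have hGu : ‖G u‖ ^ 2 ≤ K * G u u := by
    have : ‖G u‖ ≤ √(K * G u u) := by
      refine ContinuousLinearMap.opNorm_le_bound _ (Real.sqrt_nonneg _) fun v => ?_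
      rw [Real.norm_eq_abs, ← Real.sqrt_sq_eq_abs]
      have hv : G v v ≤ K * ‖v‖ ^ 2 := by
        calc G v v ≤ ‖G v v‖ := Real.le_norm_self _
          _ ≤ ‖G‖ * ‖v‖ * ‖v‖ := G.le_opNorm₂ v v
          _ ≤ K * ‖v‖ * ‖v‖ := by gcongr
          _ = K * ‖v‖ ^ 2 := by ring
      calc √(G u v ^ 2) ≤ √(K * G u u * ‖v‖ ^ 2) := by
            apply Real.sqrt_le_sqrt
            refine (hG.cauchy_schwarz u v).trans ?_
            calc G u u * G v v ≤ G u u * (K * ‖v‖ ^ 2) :=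
                  mul_le_mul_of_nonneg_left hv (hG.nonneg u)
              _ = _ := by ring
        _ = √(K * G u u) * ‖v‖ := by
            rw [Real.sqrt_mul (mul_nonneg hK (hG.nonneg u)), Real.sqrt_sq (norm_nonneg _)]
    calc ‖G u‖ ^ 2 ≤ √(K * G u u) ^ 2 := by gcongr
      _ = _ := Real.sq_sqrt (mul_nonneg hK (hG.nonneg u))
  have hu : ‖u‖ ≤ K * ‖G u‖ := by
    conv_lhs => rw [← hG.inverse_apply u]
    exact (G.inverse.le_opNorm _).trans (by gcongr)
  calc ‖u‖ ^ 2 ≤ (K * ‖G u‖) ^ 2 := by gcongr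
    _ = K ^ 2 * ‖G u‖ ^ 2 := by ring
    _ ≤ K ^ 2 * (K * G u u) := by gcongr
    _ = _ := by ring

/-- A `G`-skew endomorphism has trace zero. -/
lemma traceL_eq_zero_of_skew {D : E →L[ℝ] E} (hD : ∀ u v, G (D u) v + G u (D v) = 0) :
    traceL E D = 0 := by
  -- `G` conjugates `D` to minus the transpose of `D`
  let e : E ≃ₗ[ℝ] Module.Dual ℝ E :=
    (LinearEquiv.ofBijective (G : E →ₗ[ℝ] (E →L[ℝ] ℝ)) hG.isInvertible.bijective).trans
      (LinearMap.toContinuousLinearMap (𝕜 := ℝ) (E := E) (F' := ℝ)).symm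
  have he : ∀ u v, e u v = G u v := fun u v => rfl
  have h : e.conj (D : E →ₗ[ℝ] E) = Module.Dual.transpose (R := ℝ) (-D : E →ₗ[ℝ] E) := by
    ext φ v
    obtain ⟨u, rfl⟩ := e.surjective φ
    simp only [LinearEquiv.conj_apply, LinearMap.comp_apply, LinearEquiv.coe_coe,
      LinearEquiv.symm_apply_apply, LinearMap.neg_apply, Module.Dual.transpose_apply, he]
    have := hD u v
    simp only [ContinuousLinearMap.coe_coe, map_neg] at *
    linarith
  have h2 := LinearMap.trace_conj' (D : E →ₗ[ℝ] E) e
  rw [h, LinearMap.trace_transpose', map_neg] at h2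
  rw [traceL_apply]
  linarith

/-- A `G`-orthogonal projection onto a hyperplane is determined by a unit normal `ν`. -/
lemma exists_normal {m : ℕ} (hm : m + 1 = Module.finrank ℝ E) {P : E →L[ℝ] E}
    (hP : IsProj G m P) : ∃ ν, G ν ν = 1 ∧ ∀ u, P u = u - G ν u • ν := by
  obtain ⟨h1, h2, h3⟩ := hP
  have hker : Module.finrank ℝ (LinearMap.ker P.toLinearMap) = 1 := by
    have := LinearMap.finrank_range_add_finrank_ker P.toLinearMap
    omega
  obtain ⟨w, hw0, hw⟩ := finrank_eq_one_iff'.1 hker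
  have hw0' : (w : E) ≠ 0 := by simpa using hw0
  have hPw : P (w : E) = 0 := w.2
  have hpos := hG.pos _ hw0'
  set c := (√(G (w : E) (w : E)))⁻¹ with hc
  have hc2 : c * c * G (w : E) (w : E) = 1 := by
    rw [hc, ← mul_inv, Real.mul_self_sqrt hpos.le, inv_mul_cancel₀ hpos.ne']
  have hc0 : c ≠ 0 := by rintro h; rw [h] at hc2; simp at hc2
  refine ⟨c • (w : E), by simp only [map_smul, _root_.smul_apply, smul_eq_mul]; linarith, fun u => ?_⟩
  have hmem : u - P u ∈ LinearMap.ker P.toLinearMap := by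
    simp [LinearMap.mem_ker, h1]
  obtain ⟨a, ha⟩ := hw ⟨_, hmem⟩
  have ha' : a • (w : E) = u - P u := by simpa using congrArg Subtype.val ha
  have h4 : G (w : E) u = a * G (w : E) (w : E) := by
    have : G (w : E) (u - P u) = G (w : E) u := by
      rw [map_sub, ← h2, hPw]; simp
    rw [← this, ← ha', map_smul, smul_eq_mul]
  have : P u = u - a • (w : E) := by rw [ha']; abel
  rw [this]
  congr 1
  simp only [map_smul, _root_.smul_apply, smul_eq_mul, smul_smul]
  rw [h4]
  congr 1
  linear_combination (-a) * hc2

/-- On a hyperplane, the trace of an endomorphism depends only on its `G`-symmetric part. -/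
lemma traceL_proj_congr {m : ℕ} (hm : m + 1 = Module.finrank ℝ E) {P A B : E →L[ℝ] E}
    (hP : IsProj G m P)
    (h : ∀ u v, G (A u) v + G u (A v) = G (B u) v + G u (B v)) :
    traceL E (P ∘L A) = traceL E (P ∘L B) := by
  obtain ⟨ν, hν, hPν⟩ := hG.exists_normal hm hP
  have hD : ∀ u v, G ((A - B) u) v + G u ((A - B) v) = 0 := fun u v => by
    simp only [_root_.sub_apply, map_sub]
    linarith [h u v]
  have hdec : P ∘L (A - B) = (A - B) - ((G ν) ∘L (A - B)).smulRight ν := by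
    ext u; simp [hPν, sub_smul]; abel
  have : traceL E (P ∘L (A - B)) = 0 := by
    rw [hdec, map_sub, hG.traceL_eq_zero_of_skew hD, traceL_smulRight]
    have := hD ν ν
    rw [hG.symm ((A - B) ν) ν] at this
    simp only [ContinuousLinearMap.comp_apply]
    linarith
  rw [ContinuousLinearMap.comp_sub, map_sub, sub_eq_zero] at this
  exact this

end IsInnerProd

end LinearAlgebra

/-! ### Estimates for hyperplane projections -/

section HyperplaneEstimates

variable {E : Type*} [NormedAddCommGroup E] [NormedSpace ℝ E]

lemma abs_bilin_le {G : E →L[ℝ] E →L[ℝ] ℝ} {K a b : ℝ} (hG : ‖G‖ ≤ K) {u v : E} (hu : ‖u‖ ≤ a)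
    (hv : ‖v‖ ≤ b) : |G u v| ≤ K * a * b := by
  have hK : 0 ≤ K := (norm_nonneg G).trans hG
  have ha : 0 ≤ a := (norm_nonneg _).trans hu
  calc |G u v| = ‖G u v‖ := (Real.norm_eq_abs _).symm
    _ ≤ ‖G‖ * ‖u‖ * ‖v‖ := G.le_opNorm₂ u v
    _ ≤ K * a * b := by gcongr

lemma norm_apply_le {F : Type*} [NormedAddCommGroup F] [NormedSpace ℝ F] {A : E →L[ℝ] F} {K a : ℝ}
    (hA : ‖A‖ ≤ K) {u : E} (hu : ‖u‖ ≤ a) : ‖A u‖ ≤ K * a := by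
  have hK : 0 ≤ K := (norm_nonneg A).trans hA
  exact (A.le_opNorm u).trans (by gcongr)

/-- A unit normal `ν`, the corresponding projection `P` and a vector `Z`, with bounds on the inner
product `G` and on `Z`; `s` is the `G`-length of the projection of `Z`. -/
structure HyperplaneData (G : E →L[ℝ] E →L[ℝ] ℝ) (P : E →L[ℝ] E) (ν Z : E) (K s : ℝ) : Prop where
  inner : IsInnerProd G
  unit : G ν ν = 1
  proj : ∀ u, P u = u - G ν u • ν
  one_le : 1 ≤ K
  norm_le : ‖G‖ ≤ K
  coercive : ∀ u, ‖u‖ ^ 2 ≤ K * G u u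
  norm_vec : ‖Z‖ ≤ K
  s_nonneg : 0 ≤ s
  s_sq : s ^ 2 = G Z (P Z)

namespace HyperplaneData

variable {G : E →L[ℝ] E →L[ℝ] ℝ} {P : E →L[ℝ] E} {ν Z : E} {K s : ℝ}
  (h : HyperplaneData G P ν Z K s)

include h

lemma energy : s ^ 2 = G Z Z - G ν Z ^ 2 := by
  rw [h.s_sq, h.proj, map_sub, map_smul, smul_eq_mul, h.inner.symm Z ν]; ring

lemma inner_proj (u : E) : G Z (P u) = G (P Z) u := by
  rw [h.proj, h.proj, map_sub, map_smul, map_sub, map_smul, sub_apply, smul_apply, smul_eq_mul,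
    smul_eq_mul, h.inner.symm Z ν]
  ring

lemma proj_sq : s ^ 2 = G (P Z) (P Z) := by
  rw [h.s_sq, ← h.inner_proj]
  congr 1
  rw [h.proj (P Z), h.proj Z]
  simp [h.unit]

lemma norm_normal : ‖ν‖ ≤ K := by
  have h1 := h.coercive ν
  rw [h.unit, mul_one] at h1
  have := h.one_le
  nlinarith [norm_nonneg ν]

lemma norm_proj : ‖P Z‖ ≤ K * s := by
  have h1 := h.coercive (P Z)
  rw [← h.proj_sq] at h1
  have h2 := h.one_le
  have h3 := h.s_nonneg
  refine abs_le_of_sq_le_sq' ?_ (by positivity) |>.2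
  calc ‖P Z‖ ^ 2 ≤ K * s ^ 2 := h1
    _ ≤ K ^ 2 * s ^ 2 := by gcongr; nlinarith
    _ = _ := by ring

lemma s_le : s ≤ K ^ 2 := by
  have h2 := h.one_le
  refine abs_le_of_sq_le_sq' ?_ (by positivity) |>.2
  have h3 : G Z Z ≤ K * K * K := (le_abs_self _).trans (abs_bilin_le h.norm_le h.norm_vec h.norm_vec)
  have h4 := h.energy
  calc s ^ 2 ≤ K * K * K := by nlinarith [sq_nonneg (G ν Z)]
    _ = K ^ 3 * 1 := by ring
    _ ≤ K ^ 3 * K := by gcongr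
    _ = _ := by ring

lemma norm_proj_apply (u : E) : ‖P u‖ ≤ 2 * K ^ 3 * ‖u‖ := by
  have h2 := h.one_le
  have h3 : |G ν u| ≤ K * K * ‖u‖ := abs_bilin_le h.norm_le h.norm_normal le_rfl
  rw [h.proj]
  calc ‖u - G ν u • ν‖ ≤ ‖u‖ + |G ν u| * ‖ν‖ := by
        refine (norm_sub_le _ _).trans ?_
        rw [norm_smul, Real.norm_eq_abs]
    _ ≤ 1 * ‖u‖ + K * K * ‖u‖ * K := by rw [one_mul]; gcongr; exact h.norm_normal
    _ ≤ K ^ 3 * ‖u‖ + K * K * ‖u‖ * K := by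
        gcongr; exact one_le_pow₀ h2
    _ = _ := by ring

lemma abs_inner_proj_le {e : E} (he : ‖e‖ ≤ 1) : |G Z (P e)| ≤ K ^ 2 * s := by
  rw [h.inner_proj]
  refine (abs_bilin_le h.norm_le h.norm_proj he).trans_eq ?_
  ring

/-- If `Z` is nearly normal to the hyperplane and `φ Z` is small, then the hyperplane nearly
contains the vectors that are dual to `φ`. -/
lemma diagonal_estimate {φ : E →L[ℝ] ℝ} {e : E} (hφ : ‖φ‖ ≤ 1) (he : ‖e‖ ≤ 1) (hφe : φ e = 1) :
    G Z Z * (1 - φ (P e)) ≤ 2 * K ^ 6 * (s + |φ Z|) := by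
  have hK := h.one_le
  have hs := h.s_nonneg
  have h1 : |G ν e| ≤ K * K * 1 := abs_bilin_le h.norm_le h.norm_normal he
  have h2 : |G ν Z| ≤ K * K * K := abs_bilin_le h.norm_le h.norm_normal h.norm_vec
  have h3 : |φ ν| ≤ 1 * K := norm_apply_le hφ h.norm_normal
  have h4 : |φ (P Z)| ≤ 1 * (K * s) := norm_apply_le hφ h.norm_proj
  have h5 : φ (P Z) = φ Z - G ν Z * φ ν := by rw [h.proj]; simp
  have h6 : φ (P e) = 1 - G ν e * φ ν := by rw [h.proj]; simp [hφe]
  have h7 : G Z Z * (1 - φ (P e)) = G ν e * (s ^ 2 * φ ν + G ν Z * (φ Z - φ (P Z))) := by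
    rw [h6, h5, h.energy]; ring
  rw [h7]
  have h8 : |s ^ 2 * φ ν + G ν Z * (φ Z - φ (P Z))| ≤ K ^ 2 * s * (1 * K) +
      K * K * K * (|φ Z| + 1 * (K * s)) := by
    refine (abs_add_le _ _).trans ?_
    rw [abs_mul, abs_mul, abs_of_nonneg (sq_nonneg s), sq s]
    gcongr
    · exact h.s_le
    · exact (abs_sub _ _).trans (by gcongr)
  calc _ ≤ |G ν e * (s ^ 2 * φ ν + G ν Z * (φ Z - φ (P Z)))| := le_abs_self _
    _ ≤ (K * K * 1) * (K ^ 2 * s * (1 * K) + K * K * K * (|φ Z| + 1 * (K * s))) := by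
        rw [abs_mul]; gcongr
    _ = K ^ 5 * s + K ^ 6 * s + K ^ 5 * |φ Z| := by ring
    _ ≤ K ^ 6 * s + K ^ 6 * s + 2 * K ^ 6 * |φ Z| := by
        have h9 : K ^ 5 ≤ K ^ 6 := pow_le_pow_right₀ hK (by norm_num)
        have h10 : 0 ≤ K ^ 6 := by positivity
        gcongr
        linarith
    _ = _ := by ring

/-- The trace of `B` on a hyperplane that is nearly `G`-orthogonal to `Z` is close to its trace on
the hyperplane orthogonal to `Z`. -/
lemma trace_estimate [FiniteDimensional ℝ E] {B : E →L[ℝ] E} (hB : ‖B‖ ≤ K) :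
    G Z Z * traceL E (P ∘L B) ≤ G Z Z * traceL E B - G Z (B Z) + 3 * K ^ 7 * s := by
  have hK := h.one_le
  have hs := h.s_nonneg
  have hdec : P ∘L B = B - ((G ν) ∘L B).smulRight ν := by
    ext u; simp [h.proj]
  have htr : traceL E (P ∘L B) = traceL E B - G ν (B ν) := by
    rw [hdec, map_sub, traceL_smulRight]; rfl
  have hZ : Z = P Z + G ν Z • ν := by rw [h.proj]; abel
  have hBZ : G Z (B Z) = G (P Z) (B Z) + G ν Z * G ν (B (P Z)) + G ν Z ^ 2 * G ν (B ν) := by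
    have e1 : G Z (B Z) = G (P Z) (B Z) + G ν Z * G ν (B Z) := by
      have : G Z (B Z) = G (P Z + G ν Z • ν) (B Z) := by rw [← hZ]
      rw [this]
      simp only [map_add, map_smul, add_apply, smul_apply, smul_eq_mul]
    have e2 : G ν (B Z) = G ν (B (P Z)) + G ν Z * G ν (B ν) := by
      conv_lhs => rw [hZ]
      simp only [map_add, map_smul, smul_eq_mul]
    rw [e1, e2]; ring
  have b1 : |G (P Z) (B Z)| ≤ K * (K * s) * (K * K) :=
    abs_bilin_le h.norm_le h.norm_proj (norm_apply_le hB h.norm_vec)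
  have b2 : |G ν (B (P Z))| ≤ K * K * (K * (K * s)) :=
    abs_bilin_le h.norm_le h.norm_normal (norm_apply_le hB h.norm_proj)
  have b3 : |G ν (B ν)| ≤ K * K * (K * K) :=
    abs_bilin_le h.norm_le h.norm_normal (norm_apply_le hB h.norm_normal)
  have b4 : |G ν Z| ≤ K * K * K := abs_bilin_le h.norm_le h.norm_normal h.norm_vec
  have key : G Z Z * traceL E (P ∘L B) = G Z Z * traceL E B - G Z (B Z) +
      (G (P Z) (B Z) + G ν Z * G ν (B (P Z)) - s ^ 2 * G ν (B ν)) := by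
    rw [htr, h.energy, hBZ]; ring
  rw [key]
  gcongr
  have c2 : |G ν Z * G ν (B (P Z))| ≤ (K * K * K) * (K * K * (K * (K * s))) := by
    rw [abs_mul]; gcongr
  have c3 : |s ^ 2 * G ν (B ν)| ≤ (K ^ 2 * s) * (K * K * (K * K)) := by
    rw [abs_mul, abs_of_nonneg (sq_nonneg s), sq s]
    gcongr
    exact h.s_le
  have p4 : K ^ 4 * s ≤ K ^ 7 * s := by gcongr; norm_num
  have p6 : K ^ 6 * s ≤ K ^ 7 * s := by gcongr; norm_num
  calc _ ≤ |G (P Z) (B Z)| + |G ν Z * G ν (B (P Z))| + |s ^ 2 * G ν (B ν)| := by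
        have := le_abs_self (G (P Z) (B Z))
        have := le_abs_self (G ν Z * G ν (B (P Z)))
        have := neg_abs_le (s ^ 2 * G ν (B ν))
        linarith
    _ ≤ K * (K * s) * (K * K) + (K * K * K) * (K * K * (K * (K * s))) +
        (K ^ 2 * s) * (K * K * (K * K)) := by gcongr
    _ = K ^ 4 * s + K ^ 7 * s + K ^ 6 * s := by ring
    _ ≤ _ := by linarith

end HyperplaneData

/-- The contribution of one lateral face to the divergence of the barrier field. Here `r` is the
value of the cut-off, `m ≤ r` is the second cut-off, which is positive only near the lateral face,
and `Z` is the component of the gradient normal to the face, which has a definite sign (`Z ≤ -b`).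
The number `x` is a diagonal entry of the projection to the hyperplane: it is nearly `1` if the
hyperplane is nearly orthogonal to the gradient. -/
lemma lateral_term_le {r m s b C N Z w x d : ℝ} (hr : 0 < r) (hm0 : 0 ≤ m) (hmr : m ≤ r)
    (hs : 0 ≤ s) (hC : 1 ≤ C) (hb : 0 < b) (hN : 0 < N) (hd : |d| ≤ C) (hrC : r * C ≤ b)
    (hbN : 432 * C ^ 2 * b * N ≤ 1)
    (hZ : 0 < m → -(3 * b) ≤ Z ∧ Z ≤ -b) (hw : |w| ≤ C * s) (hx : 0 < m → 1 / 2 - C * s ≤ x) :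
    -(r ^ 2 * m ^ 2 * d + Z * (-(2 * r * m ^ 2) * w - 2 * r ^ 2 * m * w - 8 * r ^ 2 * m * x))
      ≤ r ^ 3 * (s ^ 2 / N) := by
  rcases hm0.eq_or_lt with rfl | hm
  · simp; positivity
  obtain ⟨hZ1, hZ2⟩ := hZ hm
  replace hx := hx hm
  obtain ⟨hd1, hd2⟩ := abs_le.1 hd
  obtain ⟨hw1, hw2⟩ := abs_le.1 hw
  -- scale out `r`: the claim becomes `t4`, up to a factor `r ^ 3`
  obtain ⟨μ, rfl⟩ : ∃ μ, m = μ * r := ⟨m / r, by field_simp⟩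
  have hμ : 0 < μ := by
    by_contra h
    exact absurd hm (not_lt.2 (mul_nonpos_of_nonpos_of_nonneg (not_lt.1 h) hr.le))
  have hμ1 : μ ≤ 1 := by
    by_contra h
    nlinarith
  have hCs : 0 ≤ C * s := by positivity
  have t1 : -(r * μ * d) ≤ b := by
    calc -(r * μ * d) = (r * μ) * (-d) := by ring
      _ ≤ (r * μ) * C := by gcongr; linarith
      _ ≤ (r * 1) * C := by gcongr
      _ ≤ b := by linarith
  have t2 : Z * ((2 * μ + 2) * w) ≤ 3 * b * (4 * (C * s)) := by
    calc Z * ((2 * μ + 2) * w) ≤ |Z * ((2 * μ + 2) * w)| := le_abs_self _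
      _ = |Z| * ((2 * μ + 2) * |w|) := by
          rw [abs_mul, abs_mul, abs_of_pos (by positivity : 0 < 2 * μ + 2)]
      _ ≤ (3 * b) * ((2 * 1 + 2) * (C * s)) := by
          gcongr
          exact abs_le.2 ⟨hZ1, by linarith⟩
      _ = _ := by ring
  have t3 : 8 * (Z * x) ≤ 8 * (-(b / 2) + 3 * b * (C * s)) := by
    have : Z * x ≤ Z * (1 / 2 - C * s) := mul_le_mul_of_nonpos_left hx (by linarith)
    nlinarith
  have t4 : μ * (-(3 * b) + 36 * b * C * s) ≤ s ^ 2 / N := by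
    -- the left-hand side is positive only if `s` is bounded below, and `b` is small
    rcases le_or_gt (12 * C * s) 1 with h | h
    · have : μ * (-(3 * b) + 36 * b * C * s) ≤ 0 := by
        apply mul_nonpos_of_nonneg_of_nonpos hμ.le
        nlinarith
      exact this.trans (by positivity)
    · rw [le_div_iff₀ hN]
      calc μ * (-(3 * b) + 36 * b * C * s) * N ≤ μ * (36 * b * C * s) * N := by
            gcongr; linarith
        _ ≤ 1 * (36 * b * C * s) * N := by gcongr
        _ = 36 * b * C * s * N * 1 := by ring
        _ ≤ 36 * b * C * s * N * (12 * C * s) := by gcongr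
        _ = 432 * C ^ 2 * b * N * s ^ 2 := by ring
        _ ≤ 1 * s ^ 2 := by gcongr
        _ = _ := one_mul _
  calc _ = r ^ 3 * (μ * (-(r * μ * d) + Z * ((2 * μ + 2) * w) + 8 * (Z * x))) := by ring
    _ ≤ r ^ 3 * (μ * (-(3 * b) + 36 * b * C * s)) := by
        refine mul_le_mul_of_nonneg_left (mul_le_mul_of_nonneg_left ?_ hμ.le) (by positivity)
        linarith
    _ ≤ _ := by gcongr

/-- The divergence of the barrier field is negative, once the contributions of the lateral faces
have been estimated. -/
lemma total_le {ι : Type*} (L : Finset ι) {r s C c T : ℝ} (y : ι → ℝ) (hr : 0 < r)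
    (hT : T ≤ -(2 * c) + C * s) (hrC : r * C ^ 2 ≤ 12 * c)
    (hy : ∀ k ∈ L, -y k ≤ r ^ 3 * (s ^ 2 / (L.card + 1))) :
    r ^ 4 * T - 4 * r ^ 3 * s ^ 2 - ∑ k ∈ L, y k ≤ -c * r ^ 4 := by
  have h1 : -∑ k ∈ L, y k ≤ r ^ 3 * s ^ 2 := by
    rw [← Finset.sum_neg_distrib]
    refine (Finset.sum_le_card_nsmul _ _ _ hy).trans ?_
    rw [nsmul_eq_mul]
    have h2 : (L.card : ℝ) / (L.card + 1) ≤ 1 := by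
      rw [div_le_one (by positivity)]; linarith
    calc (L.card : ℝ) * (r ^ 3 * (s ^ 2 / (L.card + 1)))
        = (L.card : ℝ) / (L.card + 1) * (r ^ 3 * s ^ 2) := by ring
      _ ≤ 1 * (r ^ 3 * s ^ 2) := by gcongr
      _ = _ := one_mul _
  have h3 : r * (C * s) ≤ 3 * s ^ 2 + r * c := by
    nlinarith [sq_nonneg (6 * s - r * C)]
  have h4 : r ^ 4 * T ≤ r ^ 3 * (-(2 * c) * r + (3 * s ^ 2 + r * c)) := by
    calc r ^ 4 * T ≤ r ^ 4 * (-(2 * c) + C * s) := by gcongr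
      _ = r ^ 3 * (-(2 * c) * r + r * (C * s)) := by ring
      _ ≤ _ := by gcongr
  nlinarith

end HyperplaneEstimates

/-! ### The divergence on hyperplanes in a coordinate domain -/

section CoordinateDivergence

variable {E : Type*} [NormedAddCommGroup E] [NormedSpace ℝ E]

/-- For a metric `G` and a vector field `X` on a subset `Q` of `E`, the endomorphism
`DX + ½ G⁻¹ (D_X G)`. Its `G`-symmetric part is that of the covariant derivative `∇X` (both are
half of the Lie derivative of `G` along `X`), so it has the same trace on each hyperplane. -/
def symGrad (G : E → E →L[ℝ] E →L[ℝ] ℝ) (X : E → E) (Q : Set E) (z : E) : E →L[ℝ] E :=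
  fderivWithin ℝ X Q z + (1 / 2 : ℝ) • ((G z).inverse ∘L fderivWithin ℝ G Q z (X z))

/-- The zeroth order part `u ↦ tr (P ∘ ½ G⁻¹ (D_u G))` of the divergence. -/
def christoffelTrace [FiniteDimensional ℝ E] (G : E → E →L[ℝ] E →L[ℝ] ℝ) (P : E →L[ℝ] E)
    (Q : Set E) (z : E) : E →L[ℝ] ℝ :=
  (1 / 2 : ℝ) • (traceL E ∘L ContinuousLinearMap.compL ℝ E E E P ∘L
    ContinuousLinearMap.compL ℝ E (E →L[ℝ] ℝ) E (G z).inverse ∘L fderivWithin ℝ G Q z)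

lemma christoffelTrace_apply [FiniteDimensional ℝ E] (G : E → E →L[ℝ] E →L[ℝ] ℝ) (P : E →L[ℝ] E)
    (Q : Set E) (z u : E) : christoffelTrace G P Q z u =
      1 / 2 * traceL E (P ∘L ((G z).inverse ∘L fderivWithin ℝ G Q z u)) := rfl

lemma traceL_symGrad [FiniteDimensional ℝ E] {G : E → E →L[ℝ] E →L[ℝ] ℝ} {X : E → E} {Q : Set E}
    {z : E} {X' : E →L[ℝ] E} (hQ : UniqueDiffWithinAt ℝ Q z) (hX : HasFDerivWithinAt X X' Q z)
    (P : E →L[ℝ] E) :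
    traceL E (P ∘L symGrad G X Q z) = traceL E (P ∘L X') + christoffelTrace G P Q z (X z) := by
  rw [symGrad, hX.fderivWithin hQ, ContinuousLinearMap.comp_add, map_add,
    ContinuousLinearMap.comp_smul, map_smul, smul_eq_mul,
    christoffelTrace_apply]

lemma traceL_comp_smulRight [FiniteDimensional ℝ E] (P : E →L[ℝ] E) (φ : E →L[ℝ] ℝ) (e : E) :
    traceL E (P ∘L φ.smulRight e) = φ (P e) := by
  have : P ∘L φ.smulRight e = φ.smulRight (P e) := by ext; simp
  rw [this, traceL_smulRight]

lemma hasDerivAt_max_zero_sq (x : ℝ) :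
    HasDerivAt (fun x : ℝ => max x 0 ^ 2) (2 * max x 0) x := by
  rcases lt_trichotomy x 0 with h | rfl | h
  · have : (fun x : ℝ => max x 0 ^ 2) =ᶠ[𝓝 x] fun _ => 0 := by
      filter_upwards [Iio_mem_nhds h] with y hy
      simp [max_eq_right (le_of_lt (show y < 0 from hy))]
    rw [max_eq_right h.le, mul_zero]
    exact (hasDerivAt_const x (0 : ℝ)).congr_of_eventuallyEq this
  · rw [max_self, mul_zero, hasDerivAt_iff_isLittleO_nhds_zero]
    simp only [zero_add, max_self, smul_zero, sub_zero, ne_eq, OfNat.ofNat_ne_zero,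
      not_false_eq_true, zero_pow]
    have h1 : (fun h : ℝ => max h 0 ^ 2) =O[𝓝 0] fun h : ℝ => h ^ 2 := by
      refine Asymptotics.isBigO_of_le _ fun h => ?_
      rw [norm_pow, norm_pow]
      gcongr
      rw [Real.norm_eq_abs, Real.norm_eq_abs, abs_of_nonneg (le_max_right _ _)]
      exact max_le (le_abs_self _) (abs_nonneg _)
    refine h1.trans_isLittleO ?_
    simpa using (Asymptotics.isLittleO_pow_id (𝕜 := ℝ) (n := 2) (by norm_num))
  · have : (fun x : ℝ => max x 0 ^ 2) =ᶠ[𝓝 x] fun x => x ^ 2 := by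
      filter_upwards [Ioi_mem_nhds h] with y hy
      rw [max_eq_left (le_of_lt (show 0 < y from hy))]
    rw [max_eq_left h.le]
    simpa using (hasDerivAt_pow 2 x).congr_of_eventuallyEq this

lemma contDiff_max_zero_sq : ContDiff ℝ 1 (fun x : ℝ => max x 0 ^ 2) := by
  rw [contDiff_one_iff_deriv]
  refine ⟨fun x => (hasDerivAt_max_zero_sq x).differentiableAt, ?_⟩
  have : deriv (fun x : ℝ => max x 0 ^ 2) = fun x => 2 * max x 0 :=
    funext fun x => (hasDerivAt_max_zero_sq x).deriv
  rw [this]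
  fun_prop

end CoordinateDivergence

section CutoffField

variable {n : ℕ}

/-- The `k`-th coordinate functional on `ℝⁿ`. -/
abbrev coordL (k : Fin n) : Eucl n →L[ℝ] ℝ := EuclideanSpace.proj k

/-- The field with components `(r⁴ - r² mₖ²) Zᵏ` for `k ∈ L` and `r⁴ Zᵏ` for `k ∉ L`, where
`r = (δ - f)₊` and `mₖ = (δ - f - 4 zₖ)₊`. It vanishes where `f ≥ δ`, is of class `C¹` if `f` and
`Z` are, and its `k`-th component vanishes on `{zₖ = 0}` for `k ∈ L`. -/
def cutoffField (f : Eucl n → ℝ) (δ : ℝ) (Z : Eucl n → Eucl n) (L : Finset (Fin n)) (z : Eucl n) :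
    Eucl n :=
  max (δ - f z) 0 ^ 4 • Z z -
    ∑ k ∈ L, (max (δ - f z) 0 ^ 2 * max (δ - f z - 4 * z k) 0 ^ 2 * Z z k) • basisVec k

lemma basisVec_apply (k i : Fin n) : basisVec k i = if i = k then 1 else 0 := by
  simp [basisVec]

lemma sum_smul_basisVec_apply (L : Finset (Fin n)) (a : Fin n → ℝ) (i : Fin n) :
    (∑ k ∈ L, a k • basisVec k) i = if i ∈ L then a i else 0 := by
  simp [basisVec_apply]

lemma cutoffField_eq_zero {f : Eucl n → ℝ} {δ : ℝ} {Z : Eucl n → Eucl n} {L : Finset (Fin n)}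
    {z : Eucl n} (h : δ ≤ f z) : cutoffField f δ Z L z = 0 := by
  have : max (δ - f z) 0 = 0 := max_eq_right (by linarith)
  simp [cutoffField, this]

lemma cutoffField_apply_of_mem {f : Eucl n → ℝ} {δ : ℝ} {Z : Eucl n → Eucl n} {L : Finset (Fin n)}
    {z : Eucl n} {k : Fin n} (hk : k ∈ L) (hz : z k = 0) : cutoffField f δ Z L z k = 0 := by
  rw [cutoffField, PiLp.sub_apply, sum_smul_basisVec_apply, if_pos hk, PiLp.smul_apply, hz,
    smul_eq_mul, mul_zero, sub_zero]
  ring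

lemma cutoffField_apply_of_notMem {f : Eucl n → ℝ} {δ : ℝ} {Z : Eucl n → Eucl n}
    {L : Finset (Fin n)} {z : Eucl n} {k : Fin n} (hk : k ∉ L) :
    cutoffField f δ Z L z k = max (δ - f z) 0 ^ 4 * Z z k := by
  rw [cutoffField, PiLp.sub_apply, sum_smul_basisVec_apply, if_neg hk, PiLp.smul_apply,
    smul_eq_mul, sub_zero]

lemma contDiffWithinAt_cutoffField {f : Eucl n → ℝ} {δ : ℝ} {Z : Eucl n → Eucl n}
    {L : Finset (Fin n)} {Q : Set (Eucl n)} {z : Eucl n} (hf : ContDiff ℝ 1 f)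
    (hZ : ContDiffWithinAt ℝ 1 Z Q z) : ContDiffWithinAt ℝ 1 (cutoffField f δ Z L) Q z := by
  have h2 : ContDiff ℝ 1 fun z => max (δ - f z) 0 ^ 2 :=
    contDiff_max_zero_sq.comp (contDiff_const.sub hf)
  have h4 : ContDiff ℝ 1 fun z => max (δ - f z) 0 ^ 4 := by
    have : (fun z => max (δ - f z) 0 ^ 4) = fun z => (max (δ - f z) 0 ^ 2) ^ 2 := by
      ext z; ring
    rw [this]; exact h2.pow 2
  have hm : ∀ k : Fin n, ContDiff ℝ 1 fun z : Eucl n => max (δ - f z - 4 * z k) 0 ^ 2 := fun k =>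
    contDiff_max_zero_sq.comp ((contDiff_const.sub hf).sub
      (contDiff_const.mul (coordL k).contDiff))
  have hZk : ∀ k : Fin n, ContDiffWithinAt ℝ 1 (fun z => Z z k) Q z := fun k =>
    (coordL k).contDiff.contDiffAt.comp_contDiffWithinAt z hZ
  refine (h4.contDiffWithinAt.smul hZ).sub (ContDiffWithinAt.sum fun k _ => ?_)
  exact (((h2.mul (hm k)).contDiffWithinAt).mul (hZk k)).smul contDiffWithinAt_const

/-- The divergence of the cut-off field on hyperplanes. -/
lemma traceL_symGrad_cutoffField {G : Eucl n → Eucl n →L[ℝ] Eucl n →L[ℝ] ℝ} {f : Eucl n → ℝ}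
    {δ : ℝ} {Z : Eucl n → Eucl n} {L : Finset (Fin n)} {Q : Set (Eucl n)} {z : Eucl n}
    {ω : Eucl n →L[ℝ] ℝ} (hQ : UniqueDiffWithinAt ℝ Q z) (hf : HasFDerivAt f ω z)
    (hZ : DifferentiableWithinAt ℝ Z Q z) (P : Eucl n →L[ℝ] Eucl n) {r : ℝ} {m : Fin n → ℝ}
    (hr : r = max (δ - f z) 0) (hm : ∀ k, m k = max (δ - f z - 4 * z k) 0) :
    traceL _ (P ∘L symGrad G (cutoffField f δ Z L) Q z) =
      r ^ 4 * traceL _ (P ∘L symGrad G Z Q z) - 4 * r ^ 3 * ω (P (Z z)) -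
        ∑ k ∈ L, (r ^ 2 * m k ^ 2 * (fderivWithin ℝ Z Q z (P (basisVec k)) k +
            Z z k * christoffelTrace G P Q z (basisVec k)) +
          Z z k * (-(2 * r * m k ^ 2) * ω (P (basisVec k)) - 2 * r ^ 2 * m k * ω (P (basisVec k)) -
            8 * r ^ 2 * m k * P (basisVec k) k)) := by
  set Z' := fderivWithin ℝ Z Q z with hZ'
  have hZd : HasFDerivWithinAt Z Z' Q z := hZ.hasFDerivWithinAt
  have h2 : HasFDerivWithinAt (fun z => max (δ - f z) 0 ^ 2) ((2 * r) • (-ω)) Q z := by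
    rw [hr]
    exact ((hasDerivAt_max_zero_sq _).comp_hasFDerivAt z (hf.const_sub δ)).hasFDerivWithinAt
  have h4 : HasFDerivWithinAt (fun z => max (δ - f z) 0 ^ 4) ((4 * r ^ 3) • (-ω)) Q z := by
    have e : (fun z => max (δ - f z) 0 ^ 4) = fun z => max (δ - f z) 0 ^ 2 * max (δ - f z) 0 ^ 2 := by
      ext z; ring
    rw [e]
    refine (h2.mul h2).congr_fderiv ?_
    rw [← hr, ← add_smul, smul_smul]
    · congr 1; ring
  have hmk : ∀ k, HasFDerivWithinAt (fun z : Eucl n => max (δ - f z - 4 * z k) 0 ^ 2)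
      ((2 * m k) • (-ω - (4 : ℝ) • coordL k)) Q z := fun k => by
    rw [hm]
    refine ((hasDerivAt_max_zero_sq _).comp_hasFDerivAt z ((hf.const_sub δ).sub ?_)).hasFDerivWithinAt
    exact ((coordL k).hasFDerivAt).const_mul 4
  have hZk : ∀ k, HasFDerivWithinAt (fun z => Z z k) ((coordL k) ∘L Z') Q z := fun k =>
    (coordL k).hasFDerivAt.comp_hasFDerivWithinAt z hZd
  have hX : HasFDerivWithinAt (cutoffField f δ Z L) (r ^ 4 • Z' + ((4 * r ^ 3) • (-ω)).smulRight (Z z)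
      - ∑ k ∈ L, ((r ^ 2 * m k ^ 2) • ((coordL k) ∘L Z') +
          Z z k • (r ^ 2 • ((2 * m k) • (-ω - (4 : ℝ) • coordL k)) +
            m k ^ 2 • ((2 * r) • (-ω)))).smulRight (basisVec k)) Q z := by
    have e4 := h4.smul hZd
    rw [← hr] at e4
    refine e4.sub (HasFDerivWithinAt.fun_sum fun k _ => ?_)
    have := ((h2.mul (hmk k)).mul (hZk k)).smul_const (basisVec k)
    simp only [Pi.mul_apply, ← hr, ← hm] at this
    exact this
  have hXz : cutoffField f δ Z L z = r ^ 4 • Z z - ∑ k ∈ L, (r ^ 2 * m k ^ 2 * Z z k) • basisVec k := by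
    rw [cutoffField, ← hr]; simp only [← hm]
  have hct : ∀ (a : Eucl n) (b : Fin n → ℝ), christoffelTrace G P Q z
      (a - ∑ k ∈ L, b k • basisVec k) = christoffelTrace G P Q z a -
        ∑ k ∈ L, b k * christoffelTrace G P Q z (basisVec k) := fun a b => by
    simp only [map_sub, map_sum, map_smul, smul_eq_mul]
  have hct4 : christoffelTrace G P Q z (r ^ 4 • Z z) = r ^ 4 * christoffelTrace G P Q z (Z z) := by
    rw [map_smul, smul_eq_mul]
  have hcs : ∀ F : Fin n → (Eucl n →L[ℝ] Eucl n), P ∘L (∑ k ∈ L, F k) = ∑ k ∈ L, P ∘L F k := fun F => by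
    ext1 u; simp
  have hco : ∀ (k : Fin n) (u : Eucl n), coordL k u = u k := fun _ _ => rfl
  rw [traceL_symGrad hQ hX, traceL_symGrad hQ hZd, hXz, hct, hct4, ContinuousLinearMap.comp_sub,
    ContinuousLinearMap.comp_add, map_sub, map_add, hcs, map_sum, ContinuousLinearMap.comp_smul,
    map_smul]
  simp only [traceL_comp_smulRight]
  simp only [add_apply, smul_apply, neg_apply, sub_apply, ContinuousLinearMap.comp_apply,
    smul_eq_mul, hco]
  rw [← sub_eq_zero]
  have : ∀ A B C D S1 S2 S3 : ℝ, S1 + S2 = S3 →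
      (r ^ 4 * A + 4 * r ^ 3 * -B - S1 + (r ^ 4 * C - S2)) - (r ^ 4 * (A + C) - 4 * r ^ 3 * B - S3)
        = 0 := by
    intro A B C D S1 S2 S3 h; rw [← h]; ring
  refine this _ _ _ 0 _ _ _ ?_
  rw [← Finset.sum_add_distrib]
  refine Finset.sum_congr rfl fun k _ => ?_
  ring

end CutoffField

set_option synthInstance.maxHeartbeats 400000

/-! ### Normed spaces of linear maps -/

-- Instance search on iterated spaces of continuous linear maps is slow, hence these shortcuts.
section Instances

variable {n : ℕ}

instance : NormedAddCommGroup (Eucl n →L[ℝ] ℝ) := inferInstance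

instance : NormedSpace ℝ (Eucl n →L[ℝ] ℝ) := inferInstance

instance : NormedAddCommGroup (Eucl n →L[ℝ] Eucl n →L[ℝ] ℝ) := inferInstance

instance : NormedSpace ℝ (Eucl n →L[ℝ] Eucl n →L[ℝ] ℝ) := inferInstance

instance : NormedAddCommGroup ((Eucl n →L[ℝ] ℝ) →L[ℝ] Eucl n) := inferInstance

instance : NormedSpace ℝ ((Eucl n →L[ℝ] ℝ) →L[ℝ] Eucl n) := inferInstance

end Instances

/-! ### Metrics on the quadrant -/

section Quadrant

variable {n : ℕ}

/-- The quadrant `[0,∞)ⁿ`, as a subset of `ℝⁿ`. -/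
abbrev quad (n : ℕ) : Set (Eucl n) := range (cornerModel n)

lemma mem_quad {z : Eucl n} : z ∈ quad n ↔ ∀ i, 0 ≤ z i := by
  have : quad n = {y : Eucl n | ∀ i : Fin n, 0 ≤ y i} := range_euclideanQuadrant n
  rw [this]; rfl

lemma uniqueDiffOn_quad : UniqueDiffOn ℝ (quad n) := (cornerModel n).uniqueDiffOn

lemma convex_quad : Convex ℝ (quad n) := by
  have : quad n = {y : Eucl n | ∀ i : Fin n, 0 ≤ y i} := range_euclideanQuadrant n
  rw [this]
  exact EuclideanQuadrant.convex

lemma norm_basisVec (k : Fin n) : ‖(basisVec k : Eucl n)‖ = 1 := by simp [basisVec]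

lemma norm_coordL_le (k : Fin n) : ‖coordL k‖ ≤ 1 := by
  refine ContinuousLinearMap.opNorm_le_bound _ zero_le_one fun u => ?_
  rw [one_mul]
  exact PiLp.norm_apply_le u k

lemma coordL_apply (k : Fin n) (u : Eucl n) : coordL k u = u k := rfl

/-- The coordinates other than `c` whose hyperplanes pass through `z₀`. -/
def lateral (z₀ : Eucl n) (c : Fin n) : Finset (Fin n) :=
  Finset.univ.filter fun k => k ≠ c ∧ z₀ k = 0

lemma mem_lateral {z₀ : Eucl n} {c k : Fin n} : k ∈ lateral z₀ c ↔ k ≠ c ∧ z₀ k = 0 := by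
  simp [lateral]

/-- The endomorphism `symGrad` of the field that is metrically dual to the constant covector field
`φ`. -/
def frozenGrad (G : Eucl n → Eucl n →L[ℝ] Eucl n →L[ℝ] ℝ) (z : Eucl n) (φ : Eucl n →L[ℝ] ℝ) :
    Eucl n →L[ℝ] Eucl n :=
  (fderivWithin ℝ (fun z => (G z).inverse) (quad n) z).flip φ + (1 / 2 : ℝ) •
    ((G z).inverse ∘L fderivWithin ℝ G (quad n) z ((G z).inverse φ))

/-- The trace of `B` on the hyperplane `ker φ`, with respect to the metric with inverse `S`. -/
def traceKer (S : (Eucl n →L[ℝ] ℝ) →L[ℝ] Eucl n) (φ : Eucl n →L[ℝ] ℝ)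
    (B : Eucl n →L[ℝ] Eucl n) : ℝ :=
  traceL _ B - φ (B (S φ)) / φ (S φ)

/-- A `C¹` metric `G` on the quadrant near its point `z₀`, for which the face `{z_c = 0}` is
orthogonal to the other faces through `z₀`, and strictly mean convex at `z₀`: the divergence of the
gradient of the coordinate `z_c` is negative on this face. -/
structure IsBarrierMetric (G : Eucl n → Eucl n →L[ℝ] Eucl n →L[ℝ] ℝ) (z₀ : Eucl n) (c : Fin n)
    (R : ℝ) : Prop where
  mem : z₀ ∈ quad n
  face : z₀ c = 0
  pos : 0 < R
  inner : ∀ z ∈ quad n ∩ Metric.ball z₀ R, IsInnerProd (G z)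
  smooth : ∀ z ∈ quad n ∩ Metric.ball z₀ R, ContDiffWithinAt ℝ 1 G (quad n) z
  angle : ∀ k ∈ lateral z₀ c, ∀ z ∈ quad n ∩ Metric.ball z₀ R, z c = 0 → z k = 0 →
    (G z).inverse (coordL c) k = 0
  convex : traceKer (G z₀).inverse (coordL c) (frozenGrad G z₀ (coordL c)) < 0

/-- Bounds for a metric and its inverse in the first order, near a point of the quadrant. -/
structure LocalBounds (G : Eucl n → Eucl n →L[ℝ] Eucl n →L[ℝ] ℝ) (z₀ : Eucl n) (K ρ : ℝ) :
    Prop where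
  one_le : 1 ≤ K
  pos : 0 < ρ
  norm_le : ∀ z ∈ quad n ∩ Metric.ball z₀ ρ, ‖G z‖ ≤ K
  norm_inv : ∀ z ∈ quad n ∩ Metric.ball z₀ ρ, ‖(G z).inverse‖ ≤ K
  norm_deriv : ∀ z ∈ quad n ∩ Metric.ball z₀ ρ, ‖fderivWithin ℝ G (quad n) z‖ ≤ K
  norm_deriv_inv : ∀ z ∈ quad n ∩ Metric.ball z₀ ρ,
    ‖fderivWithin ℝ (fun z => (G z).inverse) (quad n) z‖ ≤ K
  lipschitz : ∀ z ∈ quad n ∩ Metric.ball z₀ ρ, ∀ z' ∈ quad n ∩ Metric.ball z₀ ρ,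
    ‖(G z).inverse - (G z').inverse‖ ≤ K * ‖z - z'‖
  coercive : ∀ z ∈ quad n ∩ Metric.ball z₀ ρ, ∀ u, ‖u‖ ^ 2 ≤ K * G z u u

lemma contDiffWithinAt_inverse {G : Eucl n → Eucl n →L[ℝ] Eucl n →L[ℝ] ℝ} {Q : Set (Eucl n)}
    {z : Eucl n} (h : ContDiffWithinAt ℝ 1 G Q z) (hG : IsInnerProd (G z)) :
    ContDiffWithinAt ℝ 1 (fun z => (G z).inverse) Q z :=
  (hG.isInvertible.contDiffAt_map_inverse).comp_contDiffWithinAt z h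

lemma inter_ball_mem_nhdsWithin {z₀ z : Eucl n} {R : ℝ} (hz : z ∈ quad n ∩ Metric.ball z₀ R) :
    quad n ∩ Metric.ball z₀ R ∈ 𝓝[quad n] z :=
  inter_mem_nhdsWithin _ (Metric.isOpen_ball.mem_nhds hz.2)

lemma continuousWithinAt_fderivWithin_quad {F : Type*} [NormedAddCommGroup F] [NormedSpace ℝ F]
    {f : Eucl n → F} {z₀ z : Eucl n} {R : ℝ}
    (h : ∀ z ∈ quad n ∩ Metric.ball z₀ R, ContDiffWithinAt ℝ 1 f (quad n) z)
    (hz : z ∈ quad n ∩ Metric.ball z₀ R) :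
    ContinuousWithinAt (fderivWithin ℝ f (quad n)) (quad n) z := by
  exact ((h z hz).fderivWithin_right (m := 0) uniqueDiffOn_quad (by norm_num) hz.1).continuousWithinAt

namespace IsBarrierMetric

variable {G : Eucl n → Eucl n →L[ℝ] Eucl n →L[ℝ] ℝ} {z₀ : Eucl n} {c : Fin n} {R : ℝ}
  (hG : IsBarrierMetric G z₀ c R)

include hG

lemma mem_ball : z₀ ∈ quad n ∩ Metric.ball z₀ R := ⟨hG.mem, Metric.mem_ball_self hG.pos⟩

lemma smooth_inv : ∀ z ∈ quad n ∩ Metric.ball z₀ R,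
    ContDiffWithinAt ℝ 1 (fun z => (G z).inverse) (quad n) z := fun z hz =>
  contDiffWithinAt_inverse (hG.smooth z hz) (hG.inner z hz)

/-- A `C¹` metric has bounded first derivatives near `z₀`; the quadrant being convex, this gives
the Lipschitz bound. -/
lemma exists_localBounds : ∃ K ρ, ρ ≤ R ∧ LocalBounds G z₀ K ρ := by
  have h0 := hG.mem_ball
  have hlt : ∀ x : ℝ, x < x + 1 := fun x => lt_add_one x
  have e1 := (hG.smooth z₀ h0).continuousWithinAt.norm.eventually_le_const (hlt _)
  have e2 := (hG.smooth_inv z₀ h0).continuousWithinAt.norm.eventually_le_const (hlt _)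
  have e3 := (continuousWithinAt_fderivWithin_quad hG.smooth h0).norm.eventually_le_const (hlt _)
  have e4 := (continuousWithinAt_fderivWithin_quad hG.smooth_inv h0).norm.eventually_le_const
    (hlt _)
  obtain ⟨K5, s, hs, hK5⟩ := (hG.smooth_inv z₀ h0).exists_lipschitzOnWith convex_quad
  have e5 : ∀ᶠ z in 𝓝[quad n] z₀, z ∈ s := hs
  have e6 : ∀ᶠ z in 𝓝[quad n] z₀, z ∈ quad n ∩ Metric.ball z₀ R := inter_ball_mem_nhdsWithin h0
  set k1 := ‖G z₀‖
  set k2 := ‖(G z₀).inverse‖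
  set k3 := ‖fderivWithin ℝ G (quad n) z₀‖
  set k4 := ‖fderivWithin ℝ (fun z => (G z).inverse) (quad n) z₀‖
  have p1 : 0 ≤ k1 := norm_nonneg (G z₀)
  have p2 : 0 ≤ k2 := norm_nonneg (G z₀).inverse
  have p3 : 0 ≤ k3 := norm_nonneg (fderivWithin ℝ G (quad n) z₀)
  have p4 : 0 ≤ k4 := norm_nonneg (fderivWithin ℝ (fun z => (G z).inverse) (quad n) z₀)
  have p5 : (0 : ℝ) ≤ K5 := K5.2
  set K0 := k1 + k2 + k3 + k4 + K5 + 1 with hK0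
  have hK01 : 1 ≤ K0 := by rw [hK0]; linarith
  have hK03 : K0 ≤ K0 ^ 3 := le_self_pow₀ hK01 (by norm_num)
  obtain ⟨ρ, hρ, hsub⟩ := Metric.mem_nhdsWithin_iff.1
    ((((((e1.and e2).and e3).and e4).and e5).and e6))
  have hsub' : ∀ z ∈ quad n ∩ Metric.ball z₀ (min ρ R), _ := fun z hz =>
    hsub ⟨Metric.ball_subset_ball (min_le_left _ _) hz.2, hz.1⟩
  refine ⟨K0 ^ 3, min ρ R, min_le_right _ _, one_le_pow₀ hK01, lt_min hρ hG.pos, ?_, ?_, ?_, ?_, ?_, ?_⟩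
  · exact fun z hz => (hsub' z hz).1.1.1.1.1.trans (le_trans (by rw [hK0]; linarith) hK03)
  · exact fun z hz => (hsub' z hz).1.1.1.1.2.trans (le_trans (by rw [hK0]; linarith) hK03)
  · exact fun z hz => (hsub' z hz).1.1.1.2.trans (le_trans (by rw [hK0]; linarith) hK03)
  · exact fun z hz => (hsub' z hz).1.1.2.trans (le_trans (by rw [hK0]; linarith) hK03)
  · intro z hz z' hz'
    have := hK5.dist_le_mul z (hsub' z hz).1.2 z' (hsub' z' hz').1.2
    rw [dist_eq_norm, dist_eq_norm] at this
    refine this.trans ?_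
    gcongr
    exact le_trans (by rw [hK0]; linarith) hK03
  · intro z hz u
    refine (hG.inner z (hsub' z hz).2).norm_sq_le ?_ ?_ u
    · exact (hsub' z hz).1.1.1.1.1.trans (by rw [hK0]; linarith)
    · exact (hsub' z hz).1.1.1.1.2.trans (by rw [hK0]; linarith)

end IsBarrierMetric

end Quadrant

/-! ### The barrier function and its gradient -/

section BarrierFunction

variable {n : ℕ}

/-- The function `z_c + ε G₀(z - w, z - w)`. -/
def barrierFun (G₀ : Eucl n →L[ℝ] Eucl n →L[ℝ] ℝ) (c : Fin n) (ε : ℝ) (w z : Eucl n) : ℝ :=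
  z c + ε * G₀ (z - w) (z - w)

/-- The differential of `barrierFun`. -/
def barrierCov (G₀ : Eucl n →L[ℝ] Eucl n →L[ℝ] ℝ) (c : Fin n) (ε : ℝ) (w z : Eucl n) :
    Eucl n →L[ℝ] ℝ :=
  coordL c + (2 * ε) • G₀ (z - w)

/-- The `G`-gradient of `barrierFun`. -/
def barrierGrad (G : Eucl n → Eucl n →L[ℝ] Eucl n →L[ℝ] ℝ) (G₀ : Eucl n →L[ℝ] Eucl n →L[ℝ] ℝ)
    (c : Fin n) (ε : ℝ) (w z : Eucl n) : Eucl n :=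
  (G z).inverse (barrierCov G₀ c ε w z)

/-- The value of `symGrad` on `barrierGrad`, see `symGrad_barrierGrad`. -/
def barrierEndo (G : Eucl n → Eucl n →L[ℝ] Eucl n →L[ℝ] ℝ) (G₀ : Eucl n →L[ℝ] Eucl n →L[ℝ] ℝ)
    (ε : ℝ) (z : Eucl n) (φ : Eucl n →L[ℝ] ℝ) : Eucl n →L[ℝ] Eucl n :=
  frozenGrad G z φ + (2 * ε) • ((G z).inverse ∘L G₀)

variable {G : Eucl n → Eucl n →L[ℝ] Eucl n →L[ℝ] ℝ} {G₀ : Eucl n →L[ℝ] Eucl n →L[ℝ] ℝ}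
  {c : Fin n} {ε : ℝ} {w z : Eucl n}

lemma hasFDerivAt_barrierFun (h : ∀ u v, G₀ u v = G₀ v u) :
    HasFDerivAt (barrierFun G₀ c ε w) (barrierCov G₀ c ε w z) z := by
  have h1 : HasFDerivAt (fun z : Eucl n => z c) (coordL c) z := (coordL c).hasFDerivAt
  have h2 : HasFDerivAt (fun z : Eucl n => z - w) (ContinuousLinearMap.id ℝ (Eucl n)) z :=
    (hasFDerivAt_id z).sub_const w
  have h3 := (G₀.hasFDerivAt (x := z - w)).comp z h2
  have h4 := (h3.clm_apply h2).const_mul ε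
  refine (h1.add h4).congr_fderiv ?_
  ext u
  simp only [barrierCov, add_apply, smul_apply, ContinuousLinearMap.comp_apply,
    ContinuousLinearMap.flip_apply, ContinuousLinearMap.id_apply, smul_eq_mul, Function.comp]
  rw [h u (z - w)]
  ring

lemma contDiff_barrierFun : ContDiff ℝ 1 (barrierFun G₀ c ε w) := by
  have h2 : ContDiff ℝ 1 fun z : Eucl n => z - w := contDiff_id.sub contDiff_const
  exact (coordL c).contDiff.add
    (contDiff_const.mul ((G₀.contDiff.comp h2).clm_apply h2))

lemma contDiff_barrierCov : ContDiff ℝ 1 (barrierCov G₀ c ε w) := by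
  have h2 : ContDiff ℝ 1 fun z : Eucl n => z - w := contDiff_id.sub contDiff_const
  exact contDiff_const.add ((G₀.contDiff.comp h2).const_smul (2 * ε))

lemma contDiffWithinAt_barrierGrad {Q : Set (Eucl n)}
    (h : ContDiffWithinAt ℝ 1 (fun z => (G z).inverse) Q z) :
    ContDiffWithinAt ℝ 1 (barrierGrad G G₀ c ε w) Q z :=
  h.clm_apply contDiff_barrierCov.contDiffWithinAt

lemma hasFDerivWithinAt_barrierGrad
    (h : DifferentiableWithinAt ℝ (fun z => (G z).inverse) (quad n) z) :
    HasFDerivWithinAt (barrierGrad G G₀ c ε w)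
      ((fderivWithin ℝ (fun z => (G z).inverse) (quad n) z).flip (barrierCov G₀ c ε w z) +
        (2 * ε) • ((G z).inverse ∘L G₀)) (quad n) z := by
  have h2 : HasFDerivAt (fun z : Eucl n => z - w) (ContinuousLinearMap.id ℝ (Eucl n)) z :=
    (hasFDerivAt_id z).sub_const w
  have h3 := ((G₀.hasFDerivAt (x := z - w)).comp z h2).const_smul (2 * ε)
  have h4 : HasFDerivAt (barrierCov G₀ c ε w) ((2 * ε) • G₀) z := (h3.const_add (coordL c))
  refine (h.hasFDerivWithinAt.clm_apply h4.hasFDerivWithinAt).congr_fderiv ?_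
  ext1 u
  simp only [add_apply, smul_apply, ContinuousLinearMap.comp_apply,
    ContinuousLinearMap.flip_apply, map_smul]
  abel

lemma symGrad_barrierGrad (hz : z ∈ quad n)
    (h : DifferentiableWithinAt ℝ (fun z => (G z).inverse) (quad n) z) :
    symGrad G (barrierGrad G G₀ c ε w) (quad n) z =
      barrierEndo G G₀ ε z (barrierCov G₀ c ε w z) := by
  rw [symGrad, (hasFDerivWithinAt_barrierGrad h).fderivWithin (uniqueDiffOn_quad z hz),
    barrierEndo, frozenGrad]
  rw [add_right_comm]
  rfl

/-- Near the face, the region where the barrier function is small is small. -/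
lemma region_of_barrierFun_lt {K a D t : ℝ} (hG₀ : IsInnerProd G₀)
    (hcoer : ∀ u, ‖u‖ ^ 2 ≤ K * G₀ u u)
    (hK : 0 ≤ K) (hε : 0 < ε) (ht : 0 < t) (hD : 1 ≤ D) (haD : K * a ≤ D) (hz : z ∈ quad n)
    (h : barrierFun G₀ c ε w z < ε * a * t ^ 2) :
    z c ≤ ε * a * t ^ 2 ∧ ‖z - w‖ ≤ D * t := by
  have h1 : 0 ≤ z c := mem_quad.1 hz c
  have h2 := hG₀.nonneg (z - w)
  have h3 : 0 ≤ ε * G₀ (z - w) (z - w) := by positivity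
  rw [barrierFun] at h
  refine ⟨by linarith, abs_le_of_sq_le_sq' ?_ (by positivity) |>.2⟩
  have h4 : G₀ (z - w) (z - w) ≤ a * t ^ 2 := by
    refine le_of_mul_le_mul_left ?_ hε
    linarith
  calc ‖z - w‖ ^ 2 ≤ K * G₀ (z - w) (z - w) := hcoer _
    _ ≤ K * (a * t ^ 2) := by gcongr
    _ = (K * a) * t ^ 2 := by ring
    _ ≤ D * t ^ 2 := by gcongr
    _ ≤ D ^ 2 * t ^ 2 := by gcongr; exact le_self_pow₀ hD (by norm_num)
    _ = _ := by ring

end BarrierFunction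

section PointwiseEstimates

variable {n : ℕ} {G : Eucl n → Eucl n →L[ℝ] Eucl n →L[ℝ] ℝ} {z₀ : Eucl n} {c : Fin n} {R : ℝ}

/-- Near the lateral face `{z_k = 0}`, the gradient of the barrier function points out of it: the
dihedral angle makes the contribution of `z_c` negligible, and the quadratic form has been centered
at a point `w` with `k`-th coordinate `t`. -/
lemma barrierGrad_component (hG : IsBarrierMetric G z₀ c R) {K ρ : ℝ} (hρ : ρ ≤ R)
    (hB : LocalBounds G z₀ K ρ) {ε t a d : ℝ} (hε : 0 < ε) {w z : Eucl n} {k : Fin n}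
    (hk : k ∈ lateral z₀ c) (hw : w k = t) (hz : z ∈ quad n ∩ Metric.ball z₀ ρ)
    (hzc : z c ≤ a) (hzk : z k ≤ a) (hd : ‖z - z₀‖ ≤ d) (hdw : ‖z - w‖ ≤ d) :
    |barrierGrad G (G z₀) c ε w z k - 2 * ε * (z k - t)| ≤ 2 * K * a + 2 * ε * K ^ 2 * d ^ 2 := by
  obtain ⟨hkc, hk0⟩ := mem_lateral.1 hk
  have hK := hB.one_le
  have h0 : z₀ ∈ quad n ∩ Metric.ball z₀ ρ := ⟨hG.mem, Metric.mem_ball_self hB.pos⟩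
  have hzq := mem_quad.1 hz.1
  -- the nearest point on the intersection of the two faces
  set z' : Eucl n := z - z c • basisVec c - z k • basisVec k with hz'
  have hz'i : ∀ i, z' i = if i = c ∨ i = k then 0 else z i := fun i => by
    simp only [hz', PiLp.sub_apply, PiLp.smul_apply, basisVec_apply, smul_eq_mul]
    by_cases h1 : i = c
    · subst h1; simp [Ne.symm hkc]
    · by_cases h2 : i = k
      · subst h2; simp [h1]
      · simp [h1, h2]
  have hz'q : z' ∈ quad n := mem_quad.2 fun i => by
    rw [hz'i]; split_ifs
    exacts [le_rfl, hzq i]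
  have hz'b : z' ∈ Metric.ball z₀ ρ := by
    refine Metric.mem_ball.2 (lt_of_le_of_lt ?_ (Metric.mem_ball.1 hz.2))
    rw [EuclideanSpace.dist_eq, EuclideanSpace.dist_eq]
    apply Real.sqrt_le_sqrt
    refine Finset.sum_le_sum fun i _ => ?_
    rw [hz'i]
    split_ifs with h
    · rcases h with rfl | rfl
      · rw [hG.face]; simp; positivity
      · rw [hk0]; simp; positivity
    · exact le_rfl
  have e1 : (G z').inverse (coordL c) k = 0 :=
    hG.angle k hk z' ⟨hz'q, Metric.ball_subset_ball hρ hz'b⟩ (by rw [hz'i]; simp)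
      (by rw [hz'i]; simp)
  have e2 : ‖z - z'‖ ≤ 2 * a := by
    have : z - z' = z c • basisVec c + z k • basisVec k := by rw [hz']; abel
    rw [this]
    refine (norm_add_le _ _).trans ?_
    rw [norm_smul, norm_smul, norm_basisVec, norm_basisVec, Real.norm_eq_abs, Real.norm_eq_abs,
      abs_of_nonneg (hzq c), abs_of_nonneg (hzq k)]
    linarith
  have e3 : |(G z).inverse (coordL c) k| ≤ 2 * K * a := by
    have h1 : (G z).inverse (coordL c) k =
        coordL k (((G z).inverse - (G z').inverse) (coordL c)) := by
      rw [sub_apply, map_sub, coordL_apply, coordL_apply, e1, sub_zero]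
    have h2 : ‖((G z).inverse - (G z').inverse) (coordL c)‖ ≤ K * (2 * a) * 1 :=
      norm_apply_le ((hB.lipschitz z hz z' ⟨hz'q, hz'b⟩).trans (by gcongr)) (norm_coordL_le c)
    rw [h1, ← Real.norm_eq_abs]
    calc _ ≤ 1 * (K * (2 * a) * 1) := norm_apply_le (norm_coordL_le k) h2
      _ = _ := by ring
  have hd0 : 0 ≤ d := (norm_nonneg _).trans hd
  have e4 : |coordL k (((G z).inverse - (G z₀).inverse) (G z₀ (z - w)))| ≤ K ^ 2 * d ^ 2 := by
    have h1 : ‖G z₀ (z - w)‖ ≤ K * d := norm_apply_le (hB.norm_le z₀ h0) hdw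
    have h2 : ‖((G z).inverse - (G z₀).inverse) (G z₀ (z - w))‖ ≤ K * d * (K * d) :=
      norm_apply_le ((hB.lipschitz z hz z₀ h0).trans (by gcongr)) h1
    rw [← Real.norm_eq_abs]
    calc _ ≤ 1 * (K * d * (K * d)) := norm_apply_le (norm_coordL_le k) h2
      _ = _ := by ring
  have e5 : barrierGrad G (G z₀) c ε w z k - 2 * ε * (z k - t) = (G z).inverse (coordL c) k +
      2 * ε * coordL k (((G z).inverse - (G z₀).inverse) (G z₀ (z - w))) := by
    rw [sub_apply, (hG.inner z₀ hG.mem_ball).inverse_apply, map_sub, barrierGrad, barrierCov,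
      map_add, map_smul, PiLp.add_apply, PiLp.smul_apply, coordL_apply, coordL_apply,
      PiLp.sub_apply, hw, smul_eq_mul]
    ring
  rw [e5]
  refine (abs_add_le _ _).trans ?_
  rw [abs_mul, abs_of_pos (by positivity : 0 < 2 * ε)]
  calc _ ≤ 2 * K * a + 2 * ε * (K ^ 2 * d ^ 2) := by gcongr
    _ = _ := by ring

set_option maxHeartbeats 800000 in
/-- Uniform estimates for the terms in the divergence, on all hyperplanes. The covector `ω` stands
for the differential of the barrier function, which varies with the scale, while `C` does not. Here
`s` is the length of the projection of the gradient to the hyperplane. -/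
lemma exists_hyperplane_estimates (hG : IsBarrierMetric G z₀ c R) {K ρ : ℝ} (hρ : ρ ≤ R)
    (hB : LocalBounds G z₀ K ρ) {ε : ℝ} (hε : 0 < ε) {m : ℕ} (hm : m + 1 = n) :
    ∃ C, 1 ≤ C ∧ ∀ z ∈ quad n ∩ Metric.ball z₀ ρ, ∀ ω : Eucl n →L[ℝ] ℝ, ‖ω - coordL c‖ ≤ 1 / 2 →
      ∀ P, IsProj (G z) m P → ∃ s, 0 ≤ s ∧ ω (P ((G z).inverse ω)) = s ^ 2 ∧
        traceL _ (P ∘L barrierEndo G (G z₀) ε z ω) ≤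
          traceKer (G z).inverse ω (barrierEndo G (G z₀) ε z ω) + C * s ∧
        ∀ k, |ω (P (basisVec k))| ≤ C * s ∧
          1 - C * (s + |(G z).inverse ω k|) ≤ P (basisVec k) k ∧
          |((fderivWithin ℝ (fun z => (G z).inverse) (quad n) z).flip ω +
              (2 * ε) • ((G z).inverse ∘L G z₀)) (P (basisVec k)) k +
            (G z).inverse ω k * christoffelTrace G P (quad n) z (basisVec k)| ≤ C := by
  have hK := hB.one_le
  set K2 := (4 + 2 * ε) * K ^ 3 with hK2
  have hKK3 : K ≤ K ^ 3 := le_self_pow₀ hK (by norm_num)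
  have hKK23 : K ^ 2 ≤ K ^ 3 := pow_le_pow_right₀ hK (by norm_num)
  have hK3 : 1 ≤ K ^ 3 := one_le_pow₀ hK
  have hεK : 0 ≤ 2 * ε * K ^ 3 := by positivity
  have hK2K : 4 * K ^ 3 + 2 * ε * K ^ 3 = K2 := by rw [hK2]; ring
  have hK21 : 1 ≤ K2 := by linarith
  have hKK2 : K ≤ K2 := by linarith
  set T := ‖traceL (Eucl n)‖ with hT
  have hT0 : 0 ≤ T := norm_nonneg (traceL (Eucl n))
  have h0 : z₀ ∈ quad n ∩ Metric.ball z₀ ρ := ⟨hG.mem, Metric.mem_ball_self hB.pos⟩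
  set C1 := 3 * K2 ^ 7 * (4 * K ^ 3) with hC1
  set C2 := 2 * K2 ^ 6 * (4 * K ^ 3) with hC2
  set C3 := K2 * (2 * K2 ^ 3) + K2 * (1 / 2 * (T * (2 * K2 ^ 3 * (K * K)))) with hC3
  have p1 : 0 ≤ C1 := by positivity
  have p2 : 0 ≤ C2 := by positivity
  have p3 : 0 ≤ C3 := by positivity
  have p4 : 0 ≤ K2 ^ 2 := by positivity
  refine ⟨1 + C1 + C2 + C3 + K2 ^ 2, by linarith, fun z hz ω hω P hP => ?_⟩
  set C := 1 + C1 + C2 + C3 + K2 ^ 2 with hC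
  have hGz := hG.inner z ⟨hz.1, Metric.ball_subset_ball hρ hz.2⟩
  set S := (G z).inverse with hS
  set Z := S ω with hZ
  have hωn : ‖ω‖ ≤ 2 := by
    have : ω = (ω - coordL c) + coordL c := by abel
    rw [this]
    refine (norm_add_le _ _).trans ?_
    linarith [norm_coordL_le c]
  -- `ω` is the covector dual to `Z`; as it is close to `dz_c`, the length of `Z` is bounded below
  have hωZ : ∀ u, ω u = G z Z u := fun u => by rw [hZ, hS, hGz.apply_inverse]
  have hZn : ‖Z‖ ≤ K * 2 := norm_apply_le (hB.norm_inv z hz) hωn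
  have hGZZ : 1 ≤ 4 * K ^ 3 * G z Z Z := by
    have h1 : 1 / 2 ≤ |ω (basisVec c)| := by
      have h2 : ω (basisVec c) = 1 + (ω - coordL c) (basisVec c) := by
        rw [sub_apply, coordL_apply, basisVec_apply]; simp
      have h3 : ‖(ω - coordL c) (basisVec c)‖ ≤ 1 / 2 * 1 :=
        norm_apply_le hω (norm_basisVec c).le
      rw [Real.norm_eq_abs] at h3
      rw [h2]
      have := (abs_le.1 h3).1
      exact le_trans (by linarith) (le_abs_self _)
    have h4 : |ω (basisVec c)| ≤ K * ‖Z‖ * 1 := by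
      rw [hωZ]; exact abs_bilin_le (hB.norm_le z hz) le_rfl (norm_basisVec c).le
    have h5 := hB.coercive z hz Z
    have h6 : (1 / 2 : ℝ) ^ 2 ≤ (K * ‖Z‖) ^ 2 := by
      gcongr; linarith
    calc (1 : ℝ) ≤ 4 * (K * ‖Z‖) ^ 2 := by linarith
      _ = 4 * K ^ 2 * ‖Z‖ ^ 2 := by ring
      _ ≤ 4 * K ^ 2 * (K * G z Z Z) := by gcongr
      _ = _ := by ring
  have hGZZ0 : 0 < G z Z Z := by
    by_contra h
    have := mul_nonpos_of_nonneg_of_nonpos (by positivity : 0 ≤ 4 * K ^ 3) (not_lt.1 h)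
    linarith
  have hSG : ‖S ∘L G z₀‖ ≤ K ^ 2 := by
    refine ContinuousLinearMap.opNorm_le_bound _ (by positivity) fun u => ?_
    have := norm_apply_le (hB.norm_inv z hz) (norm_apply_le (hB.norm_le z₀ h0) (le_refl ‖u‖))
    rw [sq, mul_assoc]
    exact this
  have hDS : ‖(fderivWithin ℝ (fun z => (G z).inverse) (quad n) z).flip ω‖ ≤ K * 2 := by
    refine ContinuousLinearMap.opNorm_le_bound _ (by positivity) fun u => ?_
    rw [ContinuousLinearMap.flip_apply]
    refine (norm_apply_le (norm_apply_le (hB.norm_deriv_inv z hz) (le_refl ‖u‖)) hωn).trans_eq ?_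
    ring
  have hDS' : ‖(fderivWithin ℝ (fun z => (G z).inverse) (quad n) z).flip ω +
      (2 * ε) • (S ∘L G z₀)‖ ≤ K2 := by
    refine (norm_add_le _ _).trans ?_
    rw [norm_smul, Real.norm_eq_abs, abs_of_pos (by positivity : 0 < 2 * ε)]
    have : 2 * ε * ‖S ∘L G z₀‖ ≤ 2 * ε * K ^ 3 := by gcongr; exact hSG.trans hKK23
    linarith
  have hSDG : ∀ u, ‖S ∘L fderivWithin ℝ G (quad n) z u‖ ≤ K * K * ‖u‖ := fun u => by
    refine ContinuousLinearMap.opNorm_le_bound _ (by positivity) fun v => ?_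
    have := norm_apply_le (hB.norm_inv z hz) (norm_apply_le (norm_apply_le (hB.norm_deriv z hz)
      (le_refl ‖u‖)) (le_refl ‖v‖))
    refine le_trans this (le_of_eq ?_)
    ring
  have hEndo : ‖barrierEndo G (G z₀) ε z ω‖ ≤ K2 := by
    rw [barrierEndo, frozenGrad, add_right_comm]
    refine (norm_add_le _ _).trans ?_
    have h1 : ‖(1 / 2 : ℝ) • (S ∘L fderivWithin ℝ G (quad n) z (S ω))‖ ≤ K ^ 3 := by
      rw [norm_smul]
      have := (hSDG (S ω)).trans (mul_le_mul_of_nonneg_left hZn (by positivity))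
      rw [Real.norm_eq_abs, abs_of_pos (by norm_num : (0 : ℝ) < 1 / 2)]
      nlinarith
    have h2 : ‖(fderivWithin ℝ (fun z => (G z).inverse) (quad n) z).flip ω +
      (2 * ε) • (S ∘L G z₀)‖ ≤ 2 * K ^ 3 + 2 * ε * K ^ 3 := by
      refine (norm_add_le _ _).trans ?_
      rw [norm_smul, Real.norm_eq_abs, abs_of_pos (by positivity : 0 < 2 * ε)]
      have : 2 * ε * ‖S ∘L G z₀‖ ≤ 2 * ε * K ^ 3 := by gcongr; exact hSG.trans hKK23
      linarith
    linarith
  -- `s` is the length of the projection of `Z`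
  obtain ⟨ν, hν, hPν⟩ := hGz.exists_normal (by simpa using hm) hP
  have hGP : 0 ≤ G z Z (P Z) := by
    obtain ⟨h1, h2, -⟩ := hP
    rw [← h1, ← h2]
    exact hGz.nonneg _
  set s := √(G z Z (P Z)) with hs
  have hdata : HyperplaneData (G z) P ν Z K2 s :=
    { inner := hGz
      unit := hν
      proj := hPν
      one_le := hK21
      norm_le := (hB.norm_le z hz).trans hKK2
      coercive := fun u => (hB.coercive z hz u).trans
        (mul_le_mul_of_nonneg_right hKK2 (hGz.nonneg u))
      norm_vec := by linarith
      s_nonneg := Real.sqrt_nonneg _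
      s_sq := Real.sq_sqrt hGP }
  have hs0 : 0 ≤ s := Real.sqrt_nonneg _
  refine ⟨s, hs0, by rw [hωZ, Real.sq_sqrt hGP], ?_, fun k => ⟨?_, ?_, ?_⟩⟩
  · have h1 := hdata.trace_estimate hEndo
    have h2 : traceKer S ω (barrierEndo G (G z₀) ε z ω) * G z Z Z =
        G z Z Z * traceL _ (barrierEndo G (G z₀) ε z ω) -
          G z Z (barrierEndo G (G z₀) ε z ω Z) := by
      rw [traceKer, hωZ, hωZ, ← hZ]
      field_simp
    refine le_of_mul_le_mul_left ?_ hGZZ0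
    have h3 : 3 * K2 ^ 7 * s ≤ G z Z Z * (C1 * s) := by
      calc 3 * K2 ^ 7 * s = 3 * K2 ^ 7 * s * 1 := by ring
        _ ≤ 3 * K2 ^ 7 * s * (4 * K ^ 3 * G z Z Z) := by gcongr
        _ = _ := by rw [hC1]; ring
    have h4 : G z Z Z * (C1 * s) ≤ G z Z Z * (C * s) := by
      gcongr; rw [hC]; linarith
    linarith
  · rw [hωZ]
    refine (hdata.abs_inner_proj_le (norm_basisVec k).le).trans ?_
    gcongr; rw [hC]; linarith
  · have h1 := hdata.diagonal_estimate (norm_coordL_le k) (norm_basisVec k).le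
      (by rw [coordL_apply, basisVec_apply]; simp)
    rw [coordL_apply, coordL_apply] at h1
    have h2 : 1 - P (basisVec k) k ≤ C2 * (s + |Z k|) := by
      refine le_of_mul_le_mul_left (h1.trans ?_) hGZZ0
      calc 2 * K2 ^ 6 * (s + |Z k|) = 2 * K2 ^ 6 * (s + |Z k|) * 1 := by ring
        _ ≤ 2 * K2 ^ 6 * (s + |Z k|) * (4 * K ^ 3 * G z Z Z) := by gcongr
        _ = _ := by rw [hC2]; ring
    have h3 : C2 * (s + |Z k|) ≤ C * (s + |Z k|) := by
      gcongr; rw [hC]; linarith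
    linarith
  · have hPk : ‖P (basisVec k)‖ ≤ 2 * K2 ^ 3 := by
      have := hdata.norm_proj_apply (basisVec k)
      rwa [norm_basisVec, mul_one] at this
    have hPn : ‖P‖ ≤ 2 * K2 ^ 3 :=
      ContinuousLinearMap.opNorm_le_bound _ (by positivity) hdata.norm_proj_apply
    have h1 : |((fderivWithin ℝ (fun z => (G z).inverse) (quad n) z).flip ω +
        (2 * ε) • (S ∘L G z₀)) (P (basisVec k)) k| ≤ K2 * (2 * K2 ^ 3) := by
      rw [← Real.norm_eq_abs]
      exact (PiLp.norm_apply_le _ k).trans (norm_apply_le hDS' hPk)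
    have h2 : |christoffelTrace G P (quad n) z (basisVec k)| ≤
        1 / 2 * (T * (2 * K2 ^ 3 * (K * K))) := by
      rw [christoffelTrace_apply, abs_mul, abs_of_pos (by norm_num : (0 : ℝ) < 1 / 2)]
      gcongr
      rw [← Real.norm_eq_abs]
      refine norm_apply_le le_rfl ((ContinuousLinearMap.opNorm_comp_le _ _).trans ?_)
      have := hSDG (basisVec k)
      rw [norm_basisVec, mul_one] at this
      gcongr
    have h3 : |Z k| ≤ K2 := by
      rw [← Real.norm_eq_abs]
      exact (PiLp.norm_apply_le _ k).trans hdata.norm_vec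
    refine (abs_add_le _ _).trans ?_
    rw [abs_mul]
    refine (add_le_add h1 (mul_le_mul h3 h2 (abs_nonneg _) (by linarith))).trans ?_
    rw [← hC3, hC]
    linarith

end PointwiseEstimates

/-! ### The barrier field -/

section BarrierField

variable {n : ℕ} {G : Eucl n → Eucl n →L[ℝ] Eucl n →L[ℝ] ℝ} {z₀ : Eucl n} {c : Fin n} {R : ℝ}

lemma eventually_mul_lt (a : ℝ) {b : ℝ} (hb : 0 < b) : ∀ᶠ t in 𝓝[>] (0 : ℝ), a * t < b := by
  have : Tendsto (fun t : ℝ => a * t) (𝓝 0) (𝓝 (a * 0)) := tendsto_id.const_mul a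
  rw [mul_zero] at this
  exact (this.eventually_lt_const hb).filter_mono nhdsWithin_le_nhds

/-- The trace of `barrierEndo` on the kernel of a covector, and the component normal to the face of
the dual vector, depend continuously on the point and on the covector. -/
lemma IsBarrierMetric.continuousWithinAt_traceKer (hG : IsBarrierMetric G z₀ c R) (ε : ℝ) :
    ContinuousWithinAt (fun q : Eucl n × (Eucl n →L[ℝ] ℝ) =>
      traceKer (G q.1).inverse q.2 (barrierEndo G (G z₀) ε q.1 q.2)) (quad n ×ˢ univ)
        (z₀, coordL c) ∧
    ContinuousWithinAt (fun q : Eucl n × (Eucl n →L[ℝ] ℝ) => coordL c ((G q.1).inverse q.2))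
      (quad n ×ˢ univ) (z₀, coordL c) ∧ 0 < coordL c ((G z₀).inverse (coordL c)) := by
  have hpos : 0 < coordL c ((G z₀).inverse (coordL c)) := by
    have hI := hG.inner z₀ hG.mem_ball
    have h1 : coordL c ((G z₀).inverse (coordL c)) =
        G z₀ ((G z₀).inverse (coordL c)) ((G z₀).inverse (coordL c)) := by
      rw [hI.apply_inverse]
    rw [h1]
    refine hI.pos _ fun h => ?_
    have h2 : coordL c (basisVec c) = 0 := by
      rw [← hI.apply_inverse (coordL c), h]; simp
    rw [coordL_apply, basisVec_apply] at h2
    simp at h2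
  have hfst : ContinuousWithinAt (Prod.fst : Eucl n × (Eucl n →L[ℝ] ℝ) → Eucl n)
      (quad n ×ˢ univ) (z₀, coordL c) := continuous_fst.continuousWithinAt
  have hmaps : MapsTo (Prod.fst : Eucl n × (Eucl n →L[ℝ] ℝ) → Eucl n) (quad n ×ˢ univ) (quad n) :=
    fun q hq => hq.1
  have hsnd : ContinuousWithinAt (Prod.snd : Eucl n × (Eucl n →L[ℝ] ℝ) → (Eucl n →L[ℝ] ℝ))
      (quad n ×ˢ univ) (z₀, coordL c) := continuous_snd.continuousWithinAt
  have hS := (hG.smooth_inv z₀ hG.mem_ball).continuousWithinAt.comp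
    (t := quad n) (s := quad n ×ˢ univ) (x := (z₀, coordL c)) (f := Prod.fst) hfst hmaps
  have hDG := (continuousWithinAt_fderivWithin_quad hG.smooth hG.mem_ball).comp
    (t := quad n) (s := quad n ×ˢ univ) (x := (z₀, coordL c)) (f := Prod.fst) hfst hmaps
  have hDS := (continuousWithinAt_fderivWithin_quad hG.smooth_inv hG.mem_ball).comp
    (t := quad n) (s := quad n ×ˢ univ) (x := (z₀, coordL c)) (f := Prod.fst) hfst hmaps
  have hSφ := hS.clm_apply hsnd
  have hflip : ContinuousWithinAt (fun q : Eucl n × (Eucl n →L[ℝ] ℝ) =>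
      (fderivWithin ℝ (fun z => (G z).inverse) (quad n) q.1).flip q.2) (quad n ×ˢ univ)
      (z₀, coordL c) :=
    ((ContinuousLinearMap.flipₗᵢ ℝ (Eucl n) (Eucl n →L[ℝ] ℝ)
      (Eucl n)).continuous.continuousAt.comp_continuousWithinAt hDS).clm_apply hsnd
  have hB : ContinuousWithinAt (fun q : Eucl n × (Eucl n →L[ℝ] ℝ) =>
      barrierEndo G (G z₀) ε q.1 q.2) (quad n ×ˢ univ) (z₀, coordL c) :=
    (hflip.add ((hS.clm_comp (hDG.clm_apply hSφ)).const_smul (1 / 2 : ℝ))).add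
      ((hS.clm_comp continuousWithinAt_const).const_smul (2 * ε))
  refine ⟨?_, (coordL c).continuous.continuousAt.comp_continuousWithinAt hSφ, hpos⟩
  refine ((traceL (Eucl n)).continuous.continuousAt.comp_continuousWithinAt hB).sub
    ((hsnd.clm_apply (hB.clm_apply hSφ)).div (hsnd.clm_apply hSφ) ?_)
  exact hpos.ne'

/-- The choice of the scale `t` of the barrier at `z₀`, and of the other constants: `ε` is the
size of the quadratic term, `w` its center, `δ` the cut-off level, `-c₀` a bound for the trace on
the face, and `C` the constant in the estimates on hyperplanes. -/
structure BarrierScale (G : Eucl n → Eucl n →L[ℝ] Eucl n →L[ℝ] ℝ) (z₀ : Eucl n) (c : Fin n)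
    (K ρ ε c₀ C t δ d : ℝ) (w : Eucl n) : Prop where
  eps_pos : 0 < ε
  c₀_pos : 0 < c₀
  one_le : 1 ≤ C
  pos : 0 < t
  center : ∀ k ∈ lateral z₀ c, w k = t
  small : ∀ z ∈ quad n, barrierFun (G z₀) c ε w z < δ →
    z c ≤ δ ∧ ‖z - w‖ ≤ d ∧ ‖z - z₀‖ ≤ d ∧ z ∈ Metric.ball z₀ ρ ∧
      ‖barrierCov (G z₀) c ε w z - coordL c‖ ≤ 1 / 2 ∧
      traceKer (G z).inverse (barrierCov (G z₀) c ε w z)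
        (barrierEndo G (G z₀) ε z (barrierCov (G z₀) c ε w z)) ≤ -(2 * c₀)
  component : 2 * K * δ + 2 * ε * K ^ 2 * d ^ 2 + 2 * ε * δ ≤ ε * t
  cutoff : δ * C ≤ ε * t
  cutoff_sq : δ * C ^ 2 ≤ 12 * c₀
  lateral_small : 432 * C ^ 2 * (ε * t) * ((lateral z₀ c).card + 1) ≤ 1
  diagonal : C * (3 * (ε * t)) ≤ 1 / 2

lemma barrierFun_nonneg (hI : IsInnerProd (G z₀)) {ε : ℝ} (hε : 0 < ε) {w z : Eucl n}
    (hz : z ∈ quad n) : 0 ≤ barrierFun (G z₀) c ε w z := by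
  have := hI.nonneg (z - w)
  have := mem_quad.1 hz c
  rw [barrierFun]; positivity

/-- The divergence of the barrier field is negative inside of its support. -/
lemma BarrierScale.divergence_le {K ρ ε c₀ C t δ d : ℝ} {w : Eucl n}
    (h : BarrierScale G z₀ c K ρ ε c₀ C t δ d w) (hG : IsBarrierMetric G z₀ c R) (hρR : ρ ≤ R)
    (hB : LocalBounds G z₀ K ρ) {z : Eucl n} (hz : z ∈ quad n ∩ Metric.ball z₀ R)
    (hfz : barrierFun (G z₀) c ε w z < δ) {P : Eucl n →L[ℝ] Eucl n} {s : ℝ} (hs0 : 0 ≤ s)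
    (hs : barrierCov (G z₀) c ε w z (P ((G z).inverse (barrierCov (G z₀) c ε w z))) = s ^ 2)
    (hT : traceL _ (P ∘L barrierEndo G (G z₀) ε z (barrierCov (G z₀) c ε w z)) ≤
      traceKer (G z).inverse (barrierCov (G z₀) c ε w z)
        (barrierEndo G (G z₀) ε z (barrierCov (G z₀) c ε w z)) + C * s)
    (hk : ∀ k, |barrierCov (G z₀) c ε w z (P (basisVec k))| ≤ C * s ∧
      1 - C * (s + |(G z).inverse (barrierCov (G z₀) c ε w z) k|) ≤ P (basisVec k) k ∧
      |((fderivWithin ℝ (fun z => (G z).inverse) (quad n) z).flip (barrierCov (G z₀) c ε w z) +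
          (2 * ε) • ((G z).inverse ∘L G z₀)) (P (basisVec k)) k +
        (G z).inverse (barrierCov (G z₀) c ε w z) k *
          christoffelTrace G P (quad n) z (basisVec k)| ≤ C) :
    traceL _ (P ∘L symGrad G (cutoffField (barrierFun (G z₀) c ε w) δ
      (barrierGrad G (G z₀) c ε w) (lateral z₀ c)) (quad n) z) ≤
      -c₀ * (δ - barrierFun (G z₀) c ε w z) ^ 4 := by
  have hI := hG.inner z₀ hG.mem_ball
  have hε := h.eps_pos
  have ht := h.pos
  obtain ⟨hzc, hzw, hzz, hzρ, -, htr⟩ := h.small z hz.1 hfz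
  have hdS := (hG.smooth_inv z hz).differentiableWithinAt one_ne_zero
  have hr' : max (δ - barrierFun (G z₀) c ε w z) 0 = δ - barrierFun (G z₀) c ε w z :=
    max_eq_left (by linarith)
  have hfnn : 0 ≤ barrierFun (G z₀) c ε w z := barrierFun_nonneg hI hε hz.1
  rw [traceL_symGrad_cutoffField (r := δ - barrierFun (G z₀) c ε w z)
    (m := fun k => max (δ - barrierFun (G z₀) c ε w z - 4 * z k) 0) (uniqueDiffOn_quad z hz.1)
    (hasFDerivAt_barrierFun hI.symm) (hasFDerivWithinAt_barrierGrad hdS).differentiableWithinAt P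
    hr'.symm (fun k => rfl)]
  generalize hr : δ - barrierFun (G z₀) c ε w z = r at *
  have hr0 : 0 < r := by linarith
  have hrδ : r ≤ δ := by linarith
  have hC := h.one_le
  have hrC : r * C ≤ ε * t := le_trans (by gcongr) h.cutoff
  have hrC2 : r * C ^ 2 ≤ 12 * c₀ := le_trans (by gcongr) h.cutoff_sq
  have hZz : barrierGrad G (G z₀) c ε w z = (G z).inverse (barrierCov (G z₀) c ε w z) := rfl
  rw [hZz, hs, symGrad_barrierGrad hz.1 hdS, (hasFDerivWithinAt_barrierGrad hdS).fderivWithin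
    (uniqueDiffOn_quad z hz.1)]
  refine total_le _ _ hr0 (hT.trans (by linarith)) hrC2 fun k hkL => ?_
  obtain ⟨hk1, hk2, hk3⟩ := hk k
  have hzk0 := mem_quad.1 hz.1 k
  have hmr : max (r - 4 * z k) 0 ≤ r := max_le (by linarith) hr0.le
  have hZk : 0 < max (r - 4 * z k) 0 →
      -(3 * (ε * t)) ≤ (G z).inverse (barrierCov (G z₀) c ε w z) k ∧
        (G z).inverse (barrierCov (G z₀) c ε w z) k ≤ -(ε * t) := fun hpos => by
    have h1 : 0 < r - 4 * z k := by
      rcases lt_max_iff.1 hpos with h | h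
      · exact h
      · exact absurd h (lt_irrefl _)
    have hzk : z k ≤ δ := by linarith
    have h2 := barrierGrad_component hG hρR hB hε hkL (h.center k hkL) ⟨hz.1, hzρ⟩ hzc hzk hzz hzw
    rw [hZz] at h2
    have h3 := h.component
    have h4 : 2 * ε * z k ≤ 2 * ε * δ := by gcongr
    have h5 : 0 ≤ 2 * ε * z k := by positivity
    have h6 := abs_le.1 h2
    constructor <;> nlinarith [h6.1, h6.2]
  refine lateral_term_le (C := C) (b := ε * t) hr0 (le_max_right _ _) hmr hs0 hC (by positivity)
    (by positivity) hk3 hrC h.lateral_small hZk hk1 fun hpos => ?_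
  obtain ⟨h1, h2⟩ := hZk hpos
  have h3 : |(G z).inverse (barrierCov (G z₀) c ε w z) k| ≤ 3 * (ε * t) :=
    abs_le.2 ⟨h1, h2.trans (by nlinarith [mul_pos hε ht])⟩
  have h4 : C * |(G z).inverse (barrierCov (G z₀) c ε w z) k| ≤ C * (3 * (ε * t)) := by gcongr
  have h5 := h.diagonal
  linarith

/-- The quadratic term can be chosen so small that it does not change the sign of the trace on the
face. -/
lemma IsBarrierMetric.exists_eps (hG : IsBarrierMetric G z₀ c R) :
    ∃ ε c₀ : ℝ, 0 < ε ∧ 0 < c₀ ∧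
      traceKer (G z₀).inverse (coordL c) (barrierEndo G (G z₀) ε z₀ (coordL c)) < -(2 * c₀) := by
  have hI := hG.inner z₀ hG.mem_ball
  obtain ⟨-, -, hposc⟩ := hG.continuousWithinAt_traceKer 0
  have hΨ0 := hG.convex
  have hn : (0 : ℝ) < n := by exact_mod_cast c.pos
  have key : ∀ ε, traceKer (G z₀).inverse (coordL c) (barrierEndo G (G z₀) ε z₀ (coordL c)) =
        traceKer (G z₀).inverse (coordL c) (frozenGrad G z₀ (coordL c)) +
          (2 * ε * n - 2 * ε) := fun ε => by
    have h1 : barrierEndo G (G z₀) ε z₀ (coordL c) = frozenGrad G z₀ (coordL c) +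
        (2 * ε) • ContinuousLinearMap.id ℝ (Eucl n) := by
      rw [barrierEndo, hI.isInvertible.inverse_comp_self]
    have h2 : traceL (Eucl n) (ContinuousLinearMap.id ℝ (Eucl n)) = n := by
      rw [traceL_apply]
      exact (LinearMap.trace_id ℝ (Eucl n)).trans (by simp)
    rw [h1, traceKer, traceKer, map_add, map_smul, h2, add_apply, smul_apply,
      ContinuousLinearMap.id_apply, map_add, map_smul, smul_eq_mul, smul_eq_mul]
    field_simp
    ring
  generalize traceKer (G z₀).inverse (coordL c) (frozenGrad G z₀ (coordL c)) = Ψ at *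
  refine ⟨-Ψ / (4 * n), -Ψ / 8, by apply div_pos <;> linarith, by linarith, ?_⟩
  rw [key]
  have hεn : 2 * (-Ψ / (4 * n)) * n = -Ψ / 2 := by field_simp; ring
  have : 0 < -Ψ / (4 * n) := by apply div_pos <;> linarith
  linarith

lemma exists_ball_forall_lt {E F : Type*} [NormedAddCommGroup E] [NormedAddCommGroup F] {s : Set E}
    {f g : E × F → ℝ} {x : E} {y : F} (hf : ContinuousWithinAt f (s ×ˢ univ) (x, y))
    (hg : ContinuousWithinAt g (s ×ˢ univ) (x, y)) {a : ℝ} (h : f (x, y) < a)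
    (h' : 0 < g (x, y)) :
    ∃ ρ > 0, ∀ z φ, ‖z - x‖ < ρ → ‖φ - y‖ < ρ → z ∈ s → f (z, φ) < a ∧ 0 < g (z, φ) := by
  obtain ⟨ρ, hρ, hsub⟩ := Metric.mem_nhdsWithin_iff.1
    ((hf.eventually_lt_const h).and (hg.eventually (lt_mem_nhds h')))
  refine ⟨ρ, hρ, fun z φ h1 h2 h3 => hsub ⟨?_, h3, mem_univ _⟩⟩
  rw [Metric.mem_ball, Prod.dist_eq, dist_eq_norm, dist_eq_norm]
  exact max_lt h1 h2

/-- The inequalities for `traceKer` and for the dual vector on the face persist nearby. -/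
lemma IsBarrierMetric.exists_traceKer_lt (hG : IsBarrierMetric G z₀ c R) {ε c₀ : ℝ}
    (htr : traceKer (G z₀).inverse (coordL c) (barrierEndo G (G z₀) ε z₀ (coordL c)) < -(2 * c₀)) :
    ∃ ρ₂ > 0, ∀ (z : Eucl n) (φ : Eucl n →L[ℝ] ℝ), ‖z - z₀‖ < ρ₂ → ‖φ - coordL c‖ < ρ₂ →
      z ∈ quad n → traceKer (G z).inverse φ (barrierEndo G (G z₀) ε z φ) < -(2 * c₀) ∧
        0 < coordL c ((G z).inverse φ) :=
  exists_ball_forall_lt (hG.continuousWithinAt_traceKer ε).1 (hG.continuousWithinAt_traceKer ε).2.1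
    htr (hG.continuousWithinAt_traceKer ε).2.2

/-- The choice of the scale, once all other constants are known. -/
lemma exists_small_scale {K ε a D v C N c₀ r₁ ρ₂ : ℝ} (hε : 0 < ε) (hc₀ : 0 < c₀) (hr₁ : 0 < r₁)
    (hρ₂ : 0 < ρ₂) :
    ∃ t : ℝ, 0 < t ∧ (D + v) * t < r₁ ∧
      (2 * K * (ε * a) + 2 * ε * K ^ 2 * (D + v) ^ 2 + 2 * ε * (ε * a)) * t < ε ∧
      2 * ε * K * D * t < min (1 / 2) ρ₂ ∧ ε * a * C * t < ε ∧
      432 * C ^ 2 * ε * (N + 1) * t < 1 ∧ ε * a * C ^ 2 * t < 12 * c₀ ∧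
      C * (3 * ε) * t < 1 / 2 ∧ t < 1 := by
  have hevt := (eventually_mul_lt (D + v) hr₁).and
    ((eventually_mul_lt (2 * K * (ε * a) + 2 * ε * K ^ 2 * (D + v) ^ 2 + 2 * ε * (ε * a)) hε).and
    ((eventually_mul_lt (2 * ε * K * D) (lt_min (by norm_num : (0 : ℝ) < 1 / 2) hρ₂)).and
    ((eventually_mul_lt (ε * a * C) hε).and
    ((eventually_mul_lt (432 * C ^ 2 * ε * (N + 1)) one_pos).and
    ((eventually_mul_lt (ε * a * C ^ 2) (by positivity : 0 < 12 * c₀)).and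
    ((eventually_mul_lt (C * (3 * ε)) (by norm_num : (0 : ℝ) < 1 / 2)).and
    (eventually_mul_lt 1 one_pos)))))))
  obtain ⟨t, ⟨t1, t2, t3, t4, t5, t6, t7, t8⟩, ht⟩ := (hevt.and self_mem_nhdsWithin).exists
  rw [one_mul] at t8
  exact ⟨t, ht, t1, t2, t3, t4, t5, t6, t7, t8⟩

/-- The sublevel set of `barrierFun` shrinks to `z₀`. -/
lemma barrierFun_lt_region (hI : IsInnerProd (G z₀)) {K ε a D t : ℝ} {v w z : Eucl n}
    (hnorm : ‖G z₀‖ ≤ K) (hcoer : ∀ u, ‖u‖ ^ 2 ≤ K * G z₀ u u) (hK : 1 ≤ K) (ha : 1 ≤ a)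
    (hD : D = 1 + K * a) (hε : 0 < ε) (ht : 0 < t) (hw : w = z₀ + t • v) (hz : z ∈ quad n)
    (hfz : barrierFun (G z₀) c ε w z < ε * a * t ^ 2) :
    z c ≤ ε * a * t ^ 2 ∧ ‖z - w‖ ≤ D * t ∧ ‖z - z₀‖ ≤ (D + ‖v‖) * t ∧
      ‖barrierCov (G z₀) c ε w z - coordL c‖ ≤ 2 * ε * K * D * t := by
  have hD1 : 1 ≤ D := by rw [hD]; nlinarith
  obtain ⟨h1, h2⟩ := region_of_barrierFun_lt hI hcoer (by linarith) hε ht hD1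
      (by rw [hD]; linarith) hz hfz
  refine ⟨h1, h2, ?_, ?_⟩
  · have hwz : ‖w - z₀‖ = t * ‖v‖ := by
      rw [hw, add_sub_cancel_left, norm_smul, Real.norm_eq_abs, abs_of_pos ht]
    rw [← sub_add_sub_cancel z w z₀]
    refine (norm_add_le _ _).trans ?_
    rw [hwz]; linarith
  · rw [barrierCov, add_sub_cancel_left, norm_smul, Real.norm_eq_abs,
      abs_of_pos (by positivity : 0 < 2 * ε)]
    have : ‖G z₀ (z - w)‖ ≤ K * (D * t) := norm_apply_le hnorm h2
    calc 2 * ε * ‖G z₀ (z - w)‖ ≤ 2 * ε * (K * (D * t)) := by gcongr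
      _ = _ := by ring

/-- The scale can be chosen arbitrarily small. -/
lemma IsBarrierMetric.exists_scale (hG : IsBarrierMetric G z₀ c R) {K ρ : ℝ}
    (hB : LocalBounds G z₀ K ρ) {ε c₀ C : ℝ} (hε : 0 < ε) (hc₀ : 0 < c₀) (hC : 1 ≤ C)
    (htr : traceKer (G z₀).inverse (coordL c) (barrierEndo G (G z₀) ε z₀ (coordL c)) < -(2 * c₀))
    {r₀ : ℝ} (hr₀ : 0 < r₀) :
    ∃ t δ d w, BarrierScale G z₀ c K ρ ε c₀ C t δ d w ∧
      barrierFun (G z₀) c ε w z₀ < δ ∧ ∀ z ∈ quad n, barrierFun (G z₀) c ε w z < δ →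
        dist z z₀ < r₀ ∧ 0 < barrierGrad G (G z₀) c ε w z c := by
  have hI := hG.inner z₀ hG.mem_ball
  have hK := hB.one_le
  have h0 : z₀ ∈ quad n ∩ Metric.ball z₀ ρ := ⟨hG.mem, Metric.mem_ball_self hB.pos⟩
  obtain ⟨ρ₂, hρ₂, hsub⟩ := hG.exists_traceKer_lt htr
  -- a direction into the interior of all lateral faces; the center of the barrier is `z₀ + t • v`
  obtain ⟨v, hvk⟩ : ∃ v : Eucl n, ∀ k ∈ lateral z₀ c, v k = 1 :=
    ⟨∑ k ∈ lateral z₀ c, basisVec k, fun k hk => by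
      have := sum_smul_basisVec_apply (lateral z₀ c) (fun _ => 1) k
      simp only [one_smul] at this
      rw [this, if_pos hk]⟩
  -- the cut-off level is `δ = ε a t²`, just above the value `ε G₀(v, v) t²` of the barrier at `z₀`
  obtain ⟨a, ha⟩ : ∃ a, a = G z₀ v v + 1 := ⟨_, rfl⟩
  have ha1 : 1 ≤ a := by rw [ha]; linarith [hI.nonneg v]
  obtain ⟨D, hD⟩ : ∃ D, D = 1 + K * a := ⟨_, rfl⟩
  obtain ⟨r₁, hr₁0, hr₁₀, hr₁ρ, hr₁ρ₂⟩ : ∃ r₁, 0 < r₁ ∧ r₁ ≤ r₀ ∧ r₁ ≤ ρ ∧ r₁ ≤ ρ₂ :=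
    ⟨min r₀ (min ρ ρ₂), lt_min hr₀ (lt_min hB.pos hρ₂), min_le_left _ _,
      (min_le_right _ _).trans (min_le_left _ _), (min_le_right _ _).trans (min_le_right _ _)⟩
  obtain ⟨t, ht, t1, t2, t3, t4, t5, t6, t7, t8⟩ := exists_small_scale (K := K) (a := a) (D := D)
    (v := ‖v‖) (C := C) (N := (lateral z₀ c).card) hε hc₀ hr₁0 hρ₂
  have hv0 := norm_nonneg v
  have hK0 : 0 ≤ K := by linarith
  have hD0 : 0 ≤ D := by rw [hD]; positivity
  obtain ⟨w, hw⟩ : ∃ w, w = z₀ + t • v := ⟨_, rfl⟩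
  have hregion : ∀ z ∈ quad n, barrierFun (G z₀) c ε w z < ε * a * t ^ 2 → _ := fun z hz hfz =>
    barrierFun_lt_region hI (hB.norm_le z₀ h0) (hB.coercive z₀ h0) hK ha1 hD hε ht hw hz hfz
  have hgood : ∀ z ∈ quad n, barrierFun (G z₀) c ε w z < ε * a * t ^ 2 → _ := fun z hz hfz =>
    hsub z (barrierCov (G z₀) c ε w z) (((hregion z hz hfz).2.2.1.trans_lt t1).trans_le hr₁ρ₂)
      (((hregion z hz hfz).2.2.2.trans_lt t3).trans_le (min_le_right _ _)) hz
  have ht2 : t ^ 2 ≤ t := by nlinarith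
  refine ⟨t, ε * a * t ^ 2, (D + ‖v‖) * t, w, ⟨hε, hc₀, hC, ht, fun k hk => ?_,
    fun z hz hfz => ?_, ?_, ?_, ?_, ?_, ?_⟩, ?_, fun z hz hfz => ⟨?_, (hgood z hz hfz).2⟩⟩
  · rw [hw, PiLp.add_apply, PiLp.smul_apply, hvk k hk, (mem_lateral.1 hk).2]; simp
  · obtain ⟨h1, h2, h3, h4⟩ := hregion z hz hfz
    refine ⟨h1, h2.trans (by gcongr; linarith), h3, ?_, (h4.trans t3.le).trans (min_le_left _ _),
      (hgood z hz hfz).1.le⟩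
    rw [Metric.mem_ball, dist_eq_norm]
    exact (h3.trans_lt t1).trans_le hr₁ρ
  · calc _ = (2 * K * (ε * a) + 2 * ε * K ^ 2 * (D + ‖v‖) ^ 2 + 2 * ε * (ε * a)) * t * t := by
          ring
      _ ≤ ε * t := by gcongr
  · calc ε * a * t ^ 2 * C = (ε * a * C * t) * t := by ring
      _ ≤ ε * t := by gcongr
  · calc ε * a * t ^ 2 * C ^ 2 = ε * a * C ^ 2 * t ^ 2 := by ring
      _ ≤ ε * a * C ^ 2 * t := by gcongr
      _ ≤ _ := t6.le
  · calc _ = 432 * C ^ 2 * ε * ((lateral z₀ c).card + 1) * t := by ring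
      _ ≤ 1 := t5.le
  · linarith
  · have h1 : barrierFun (G z₀) c ε w z₀ = ε * (G z₀ v v) * t ^ 2 := by
      rw [barrierFun, hG.face, hw]
      simp only [sub_add_cancel_left, map_neg, map_smul, neg_apply, smul_apply, smul_eq_mul]
      ring
    rw [h1]
    have : G z₀ v v < a := by rw [ha]; linarith
    gcongr
  · rw [dist_eq_norm]
    exact ((hregion z hz hfz).2.2.1.trans_lt t1).trans_le hr₁₀

/-- **Existence of local barriers.** Near a point `z₀` of a strictly mean convex face of a
Riemannian quadrant that is orthogonal to the other faces through `z₀`, there is a `C¹` field with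
arbitrarily small support that is tangential to these other faces, points into the quadrant along
the given face, and has nonpositive divergence on all hyperplanes, negative near `z₀`. -/
theorem IsBarrierMetric.exists_barrier (hG : IsBarrierMetric G z₀ c R) {m : ℕ} (hm : m + 1 = n)
    {r₀ : ℝ} (hr₀ : 0 < r₀) : ∃ X : Eucl n → Eucl n,
      (∀ z ∈ quad n ∩ Metric.ball z₀ R, ContDiffWithinAt ℝ 1 X (quad n) z) ∧
      (∀ z ∈ quad n, r₀ ≤ dist z z₀ → X z = 0) ∧
      (∀ k ∈ lateral z₀ c, ∀ z, z k = 0 → X z k = 0) ∧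
      (∀ z ∈ quad n, 0 ≤ X z c) ∧
      ∃ U ∈ 𝓝 z₀, ∀ z ∈ quad n ∩ Metric.ball z₀ R, ∀ P, IsProj (G z) m P →
        traceL _ (P ∘L symGrad G X (quad n) z) ≤ 0 ∧
        (z ∈ U → traceL _ (P ∘L symGrad G X (quad n) z) < 0) := by
  obtain ⟨K, ρ, hρR, hB⟩ := hG.exists_localBounds
  obtain ⟨ε, c₀, hε, hc₀, htr⟩ := hG.exists_eps
  obtain ⟨C, hC, hest⟩ := exists_hyperplane_estimates hG hρR hB hε hm
  obtain ⟨t, δ, d, w, hscale, hz₀, hsupp⟩ := hG.exists_scale hB hε hc₀ hC htr hr₀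
  have hI := hG.inner z₀ hG.mem_ball
  have hcL : c ∉ lateral z₀ c := fun h => (mem_lateral.1 h).1 rfl
  refine ⟨cutoffField (barrierFun (G z₀) c ε w) δ (barrierGrad G (G z₀) c ε w) (lateral z₀ c),
    fun z hz => contDiffWithinAt_cutoffField contDiff_barrierFun
      (contDiffWithinAt_barrierGrad (hG.smooth_inv z hz)),
    fun z hz hd => cutoffField_eq_zero ?_, fun k hk z hzk =>
    cutoffField_apply_of_mem hk hzk, fun z hz => ?_,
    {z | barrierFun (G z₀) c ε w z < δ}, ?_, fun z hz P hP => ?_⟩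
  · by_contra h
    exact absurd (hsupp z hz (not_le.1 h)).1 (not_lt.2 hd)
  · rw [cutoffField_apply_of_notMem hcL]
    rcases le_or_gt δ (barrierFun (G z₀) c ε w z) with h | h
    · rw [max_eq_right (by linarith)]; simp
    · exact mul_nonneg (by positivity) (hsupp z hz h).2.le
  · exact (isOpen_lt contDiff_barrierFun.continuous continuous_const).mem_nhds hz₀
  rcases le_or_gt δ (barrierFun (G z₀) c ε w z) with h | h
  · have hdS := (hG.smooth_inv z hz).differentiableWithinAt one_ne_zero
    have hmk : ∀ k, 0 = max (δ - barrierFun (G z₀) c ε w z - 4 * z k) 0 := fun k =>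
      (max_eq_right (by linarith [mem_quad.1 hz.1 k])).symm
    have hnot : ¬ z ∈ {z | barrierFun (G z₀) c ε w z < δ} := not_lt.2 h
    rw [traceL_symGrad_cutoffField (r := 0) (m := fun _ => 0) (uniqueDiffOn_quad z hz.1)
      (hasFDerivAt_barrierFun hI.symm) (hasFDerivWithinAt_barrierGrad hdS).differentiableWithinAt P
      (max_eq_right (by linarith)).symm hmk]
    simp [hnot]
  · obtain ⟨-, -, -, hzρ, hcov, -⟩ := hscale.small z hz.1 h
    obtain ⟨s, hs0, hs, hT, hk⟩ := hest z ⟨hz.1, hzρ⟩ _ hcov P hP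
    have := hscale.divergence_le hG hρR hB hz h hs0 hs hT hk
    have hr : 0 < δ - barrierFun (G z₀) c ε w z := by linarith
    have : 0 < c₀ * (δ - barrierFun (G z₀) c ε w z) ^ 4 := by positivity
    exact ⟨by linarith, fun _ => by linarith⟩

end BarrierField

/-! ### Behaviour of the divergence under coordinate changes -/

section LieDerivative

variable {n : ℕ}

/-- The Lie derivative `(L_X G)(u, v)` of a metric `G` on the quadrant along the field `X`. -/
def lieDer (G : Eucl n → Eucl n →L[ℝ] Eucl n →L[ℝ] ℝ) (X : Eucl n → Eucl n) (z u v : Eucl n) : ℝ :=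
  fderivWithin ℝ G (quad n) z (X z) u v + G z (fderivWithin ℝ X (quad n) z u) v +
    G z u (fderivWithin ℝ X (quad n) z v)

lemma fderivWithin_clm_apply_apply {G : Eucl n → Eucl n →L[ℝ] Eucl n →L[ℝ] ℝ} {z : Eucl n}
    (hz : z ∈ quad n) (hG : DifferentiableWithinAt ℝ G (quad n) z) (x u v : Eucl n) :
    fderivWithin ℝ (fun w => G w u v) (quad n) z x = fderivWithin ℝ G (quad n) z x u v := by
  have h := (hG.hasFDerivWithinAt.clm_apply (hasFDerivWithinAt_const u z (quad n))).clm_apply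
    (hasFDerivWithinAt_const v z (quad n))
  rw [h.fderivWithin (uniqueDiffOn_quad z hz)]
  simp

lemma fderivWithin_symm {G : Eucl n → Eucl n →L[ℝ] Eucl n →L[ℝ] ℝ} {z : Eucl n}
    (hz : z ∈ quad n) (hG : DifferentiableWithinAt ℝ G (quad n) z)
    (hsymm : ∀ᶠ w in 𝓝[quad n] z, ∀ u v, G w u v = G w v u) (x u v : Eucl n) :
    fderivWithin ℝ G (quad n) z x u v = fderivWithin ℝ G (quad n) z x v u := by
  rw [← fderivWithin_clm_apply_apply hz hG, ← fderivWithin_clm_apply_apply hz hG]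
  have : (fun w => G w u v) =ᶠ[𝓝[quad n] z] fun w => G w v u := hsymm.mono fun w h => h u v
  rw [this.fderivWithin_eq_of_mem hz]

lemma symGrad_add_eq_lieDer {G : Eucl n → Eucl n →L[ℝ] Eucl n →L[ℝ] ℝ} {X : Eucl n → Eucl n}
    {z : Eucl n} (hz : z ∈ quad n) (hI : IsInnerProd (G z))
    (hG : DifferentiableWithinAt ℝ G (quad n) z)
    (hsymm : ∀ᶠ w in 𝓝[quad n] z, ∀ u v, G w u v = G w v u) (u v : Eucl n) :
    G z (symGrad G X (quad n) z u) v + G z u (symGrad G X (quad n) z v) = lieDer G X z u v := by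
  have h1 := fderivWithin_symm hz hG hsymm (X z) u v
  simp only [symGrad, lieDer, add_apply, smul_apply, ContinuousLinearMap.comp_apply, map_add,
    map_smul, hI.apply_inverse, smul_eq_mul, hI.symm u ((G z).inverse _)]
  rw [← h1]
  ring

/-- The Lie derivative is invariant under coordinate changes `τ` of class `C²`. -/
lemma lieDer_pullback {Gp Gq : Eucl n → Eucl n →L[ℝ] Eucl n →L[ℝ] ℝ} {Xp Xq : Eucl n → Eucl n}
    {τ : Eucl n → Eucl n} {w : Eucl n} (hw : w ∈ quad n) (hτ : ContDiffWithinAt ℝ 2 τ (quad n) w)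
    (hmaps : ∀ᶠ y in 𝓝[quad n] w, τ y ∈ quad n)
    (hG : ∀ᶠ y in 𝓝[quad n] w, ∀ u v, Gq y u v =
      Gp (τ y) (fderivWithin ℝ τ (quad n) y u) (fderivWithin ℝ τ (quad n) y v))
    (hX : ∀ᶠ y in 𝓝[quad n] w, Xp (τ y) = fderivWithin ℝ τ (quad n) y (Xq y))
    (hGp : DifferentiableWithinAt ℝ Gp (quad n) (τ w))
    (hGq : DifferentiableWithinAt ℝ Gq (quad n) w)
    (hXp : DifferentiableWithinAt ℝ Xp (quad n) (τ w))
    (hXq : DifferentiableWithinAt ℝ Xq (quad n) w) (u v : Eucl n) :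
    lieDer Gq Xq w u v = lieDer Gp Xp (τ w) (fderivWithin ℝ τ (quad n) w u)
      (fderivWithin ℝ τ (quad n) w v) := by
  have huniq := uniqueDiffOn_quad w hw
  have hτ1 : HasFDerivWithinAt τ (fderivWithin ℝ τ (quad n) w) (quad n) w :=
    (hτ.differentiableWithinAt two_ne_zero).hasFDerivWithinAt
  have hJ : HasFDerivWithinAt (fderivWithin ℝ τ (quad n))
      (fderivWithin ℝ (fderivWithin ℝ τ (quad n)) (quad n) w) (quad n) w :=
    ((hτ.fderivWithin_right (m := 1) uniqueDiffOn_quad (by norm_num) hw).differentiableWithinAt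
      one_ne_zero).hasFDerivWithinAt
  have hsym : IsSymmSndFDerivWithinAt ℝ τ (quad n) w :=
    hτ.isSymmSndFDerivWithinAt (by simp) uniqueDiffOn_quad
      (by
        rw [convex_quad.closure_interior_eq_closure_of_nonempty_interior]
        · exact subset_closure hw
        · exact (cornerModel n).nonempty_interior) hw
  have htend : Tendsto τ (𝓝[quad n] w) (𝓝[quad n] (τ w)) :=
    tendsto_nhdsWithin_iff.2 ⟨hτ.continuousWithinAt, hmaps⟩
  have hGτ := hGp.hasFDerivWithinAt.comp_of_tendsto w hτ1 htend
  have hXτ := hXp.hasFDerivWithinAt.comp_of_tendsto w hτ1 htend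
  -- the derivative of `G_q`
  have h1 : ∀ x, fderivWithin ℝ Gq (quad n) w x u v =
      fderivWithin ℝ Gp (quad n) (τ w) (fderivWithin ℝ τ (quad n) w x)
        (fderivWithin ℝ τ (quad n) w u) (fderivWithin ℝ τ (quad n) w v) +
      Gp (τ w) (fderivWithin ℝ (fderivWithin ℝ τ (quad n)) (quad n) w x u)
        (fderivWithin ℝ τ (quad n) w v) +
      Gp (τ w) (fderivWithin ℝ τ (quad n) w u)
        (fderivWithin ℝ (fderivWithin ℝ τ (quad n)) (quad n) w x v) := fun x => by
    have he : (fun y => Gq y u v) =ᶠ[𝓝[quad n] w] fun y => (Gp ∘ τ) y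
        (fderivWithin ℝ τ (quad n) y u) (fderivWithin ℝ τ (quad n) y v) :=
      hG.mono fun y h => h u v
    have hd := (hGτ.clm_apply (hJ.clm_apply (hasFDerivWithinAt_const u w (quad n)))).clm_apply
      (hJ.clm_apply (hasFDerivWithinAt_const v w (quad n)))
    rw [← fderivWithin_clm_apply_apply hw hGq, he.fderivWithin_eq_of_mem hw, hd.fderivWithin huniq]
    simp
    ring
  -- the derivative of `X_q`
  have h2 : ∀ u, fderivWithin ℝ Xp (quad n) (τ w) (fderivWithin ℝ τ (quad n) w u) =
      fderivWithin ℝ τ (quad n) w (fderivWithin ℝ Xq (quad n) w u) +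
        fderivWithin ℝ (fderivWithin ℝ τ (quad n)) (quad n) w u (Xq w) := fun u => by
    have he : Xp ∘ τ =ᶠ[𝓝[quad n] w] fun y => fderivWithin ℝ τ (quad n) y (Xq y) := hX
    have hd := hJ.clm_apply hXq.hasFDerivWithinAt
    have h := he.fderivWithin_eq_of_mem (𝕜 := ℝ) hw
    rw [hXτ.fderivWithin huniq, hd.fderivWithin huniq] at h
    simpa using DFunLike.congr_fun h u
  have h3 := hG.self_of_nhdsWithin hw
  have h4 := hX.self_of_nhdsWithin hw
  rw [lieDer, lieDer, h1, h2, h2, h3, h3, h4, hsym (Xq w) u, hsym (Xq w) v]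
  simp only [map_add, add_apply]
  ring

end LieDerivative

section Conjugation

variable {E : Type*} [NormedAddCommGroup E] [NormedSpace ℝ E]

lemma IsInnerProd.conj {Gp Gq : E →L[ℝ] E →L[ℝ] ℝ} {J : E ≃L[ℝ] E}
    (hG : ∀ u v, Gq u v = Gp (J u) (J v)) (h : IsInnerProd Gp) : IsInnerProd Gq where
  symm u v := by rw [hG, hG, h.symm]
  pos u hu := by rw [hG]; exact h.pos _ (by simpa using hu)

lemma IsProj.conj {Gp Gq : E →L[ℝ] E →L[ℝ] ℝ} {J : E ≃L[ℝ] E}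
    (hG : ∀ u v, Gq u v = Gp (J u) (J v)) {m : ℕ} {P : E →L[ℝ] E} (hP : IsProj Gq m P) :
    IsProj Gp m ((J : E →L[ℝ] E) ∘L P ∘L (J.symm : E →L[ℝ] E)) := by
  obtain ⟨h1, h2, h3⟩ := hP
  refine ⟨fun u => by simp [h1], fun u v => ?_, ?_⟩
  · have := h2 (J.symm u) (J.symm v)
    rw [hG, hG] at this
    simpa using this
  · have : LinearMap.range ((J : E →L[ℝ] E) ∘L P ∘L (J.symm : E →L[ℝ] E)).toLinearMap =
        (LinearMap.range P.toLinearMap).map (J.toLinearEquiv : E →ₗ[ℝ] E) := by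
      ext y
      simp only [LinearMap.mem_range, Submodule.mem_map]
      constructor
      · rintro ⟨x, rfl⟩
        exact ⟨P (J.symm x), ⟨J.symm x, rfl⟩, rfl⟩
      · rintro ⟨_, ⟨x, rfl⟩, rfl⟩
        exact ⟨J x, by simp⟩
    rw [this, LinearEquiv.finrank_map_eq, h3]

variable [FiniteDimensional ℝ E]

lemma traceL_conj (J : E ≃L[ℝ] E) (A B : E →L[ℝ] E) :
    traceL E (A ∘L B) = traceL E (((J : E →L[ℝ] E) ∘L A ∘L (J.symm : E →L[ℝ] E)) ∘L
      ((J : E →L[ℝ] E) ∘L B ∘L (J.symm : E →L[ℝ] E))) := by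
  have : ((J : E →L[ℝ] E) ∘L A ∘L (J.symm : E →L[ℝ] E)) ∘L
      ((J : E →L[ℝ] E) ∘L B ∘L (J.symm : E →L[ℝ] E)) =
      (J : E →L[ℝ] E) ∘L ((A ∘L B) ∘L (J.symm : E →L[ℝ] E)) := by
    ext; simp
  rw [this, traceL_comp_comm (J : E →L[ℝ] E)]
  congr 1
  ext; simp

/-- The trace on a hyperplane in two coordinate systems, for endomorphisms with corresponding
symmetric parts. -/
lemma traceL_proj_conj {Gp Gq : E →L[ℝ] E →L[ℝ] ℝ} {J : E ≃L[ℝ] E}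
    (hG : ∀ u v, Gq u v = Gp (J u) (J v)) (hI : IsInnerProd Gp) {m : ℕ}
    (hm : m + 1 = Module.finrank ℝ E) {P A B : E →L[ℝ] E} (hP : IsProj Gq m P)
    (h : ∀ u v, Gq (A u) v + Gq u (A v) = Gp (B (J u)) (J v) + Gp (J u) (B (J v))) :
    traceL E (P ∘L A) =
      traceL E (((J : E →L[ℝ] E) ∘L P ∘L (J.symm : E →L[ℝ] E)) ∘L B) := by
  rw [traceL_conj J P A]
  refine hI.traceL_proj_congr hm (hP.conj hG) fun u v => ?_
  have := h (J.symm u) (J.symm v)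
  rw [hG, hG] at this
  simpa using this

end Conjugation

/-! ### Metrics and fields in the charts of a manifold -/

section Charts

variable {n : ℕ} {M : Type*} [TopologicalSpace M] [ChartedSpace (EuclideanQuadrant n) M]

lemma mem_quad_of_mem_target {p : M} {z : Eucl n} (hz : z ∈ (extChartAt (cornerModel n) p).target) :
    z ∈ quad n := extChartAt_target_subset_range p hz

lemma pointAt_mem_source {p : M} {z : Eucl n} (hz : z ∈ (extChartAt (cornerModel n) p).target) :
    pointAt p z ∈ (chartAt (EuclideanQuadrant n) p).source := by
  rw [← extChartAt_source (cornerModel n)]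
  exact (extChartAt (cornerModel n) p).map_target hz

lemma coords_pointAt {p : M} {z : Eucl n} (hz : z ∈ (extChartAt (cornerModel n) p).target) :
    coords p (pointAt p z) = z := (extChartAt (cornerModel n) p).right_inv hz

lemma pointAt_coords {p q : M} (hq : q ∈ (chartAt (EuclideanQuadrant n) p).source) :
    pointAt p (coords (n := n) p q) = q :=
  (extChartAt (cornerModel n) p).left_inv (by rwa [extChartAt_source])

lemma coords_mem_target {p q : M} (hq : q ∈ (chartAt (EuclideanQuadrant n) p).source) :
    coords p q ∈ (extChartAt (cornerModel n) p).target :=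
  (extChartAt (cornerModel n) p).map_source (by rwa [extChartAt_source])

variable [IsManifold (cornerModel n) 2 M] (g : Metric n M)

/-- The metric in the preferred chart at `p`, as a field of bilinear forms on `ℝⁿ`. -/
def metricIn (p : M) (z : Eucl n) : Eucl n →L[ℝ] Eucl n →L[ℝ] ℝ :=
  (trivializationAt (Eucl n →L[ℝ] Eucl n →L[ℝ] ℝ)
    (fun x : M => TangentSpace (cornerModel n) x →L[ℝ] TangentSpace (cornerModel n) x →L[ℝ] ℝ) p
    ⟨pointAt p z, g.inner (pointAt p z)⟩).2

/-- The vector field `X` in the preferred chart at `p`, as a map to `ℝⁿ`. -/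
def fieldIn (X : ∀ x : M, TangentSpace (cornerModel n) x) (p : M) (z : Eucl n) : Eucl n :=
  (trivializationAt (Eucl n) (TangentSpace (cornerModel n)) p ⟨pointAt p z, X (pointAt p z)⟩).2

/-- The transition map from the chart at `q` to the chart at `p`. -/
def transition (q p : M) : Eucl n → Eucl n :=
  extChartAt (cornerModel n) p ∘ (extChartAt (cornerModel n) q).symm

variable {g} {p q : M} {z : Eucl n}

lemma metricIn_apply (hz : z ∈ (extChartAt (cornerModel n) p).target) (u v : Eucl n) :
    metricIn g p z u v = g.inner (pointAt p z)
      ((trivializationAt (Eucl n) (TangentSpace (cornerModel n)) p).symmL ℝ (pointAt p z) u)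
      ((trivializationAt (Eucl n) (TangentSpace (cornerModel n)) p).symmL ℝ (pointAt p z) v) := by
  have h := pointAt_mem_source hz
  have := inCoordinates_apply_eq₂ (E₃ := fun _ : M => ℝ) (F₃ := ℝ) (ϕ := g.inner (pointAt p z))
    (v := u) (w := v) (x₀ := p) (x := pointAt p z) (F₁ := Eucl n) (F₂ := Eucl n)
    (E₁ := TangentSpace (cornerModel n)) (E₂ := TangentSpace (cornerModel n)) h h (mem_univ _)
  refine Eq.trans this ?_
  simp
  exact congrArg₂ (fun u v => g.inner (pointAt p z) u v) (Trivialization.symmL_apply (R := ℝ) _ h u).symm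
    (Trivialization.symmL_apply (R := ℝ) _ h v).symm

lemma contDiffWithinAt_metricIn (hz : z ∈ (extChartAt (cornerModel n) p).target) :
    ContDiffWithinAt ℝ 1 (metricIn g p) (quad n) z := by
  have h := pointAt_mem_source hz
  have h1 := g.contMDiff (pointAt p z)
  rw [Trivialization.contMDiffAt_section_iff (e := trivializationAt (Eucl n →L[ℝ] Eucl n →L[ℝ] ℝ)
    (fun x : M => TangentSpace (cornerModel n) x →L[ℝ] TangentSpace (cornerModel n) x →L[ℝ] ℝ) p)
    (hx₀ := by simpa using h)] at h1
  have h2 : ContMDiffWithinAt 𝓘(ℝ, Eucl n) (cornerModel n) 1 (extChartAt (cornerModel n) p).symm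
      (quad n) z :=
    (((contMDiffOn_extChartAt_symm (n := 2) p) z hz).of_le (by norm_num)).mono_of_mem_nhdsWithin
      (extChartAt_target_mem_nhdsWithin_of_mem hz)
  exact (h1.comp_contMDiffWithinAt z h2).contDiffWithinAt

lemma contDiffWithinAt_fieldIn {X : ∀ x : M, TangentSpace (cornerModel n) x}
    (hz : z ∈ (extChartAt (cornerModel n) p).target)
    (hX : ContMDiff (cornerModel n) (cornerModel n).tangent 1
      (fun x => (⟨x, X x⟩ : TangentBundle (cornerModel n) M))) :
    ContDiffWithinAt ℝ 1 (fieldIn X p) (quad n) z := by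
  have h := pointAt_mem_source hz
  have h1 := hX (pointAt p z)
  rw [Trivialization.contMDiffAt_section_iff (e := trivializationAt (Eucl n)
    (TangentSpace (cornerModel n)) p) (hx₀ := by simpa using h)] at h1
  have h2 : ContMDiffWithinAt 𝓘(ℝ, Eucl n) (cornerModel n) 1 (extChartAt (cornerModel n) p).symm
      (quad n) z :=
    (((contMDiffOn_extChartAt_symm (n := 2) p) z hz).of_le (by norm_num)).mono_of_mem_nhdsWithin
      (extChartAt_target_mem_nhdsWithin_of_mem hz)
  exact (h1.comp_contMDiffWithinAt z h2).contDiffWithinAt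

lemma isInnerProd_metricIn (hz : z ∈ (extChartAt (cornerModel n) p).target) :
    IsInnerProd (metricIn g p z) where
  symm u v := by rw [metricIn_apply hz, metricIn_apply hz, g.symm]
  pos u hu := by
    rw [metricIn_apply hz]
    refine g.pos _ _ fun h => hu ?_
    have h0 := pointAt_mem_source hz
    have h1 := (trivializationAt (Eucl n) (TangentSpace (cornerModel n)) p).continuousLinearMapAt_symmL
      (R := ℝ) (b := pointAt p z) h0 u
    rw [h, map_zero] at h1
    exact h1.symm

lemma gram_eq (hz : z ∈ (extChartAt (cornerModel n) p).target) (i j : Fin n) :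
    gram g p z i j = metricIn g p z (basisVec i) (basisVec j) := by
  rw [metricIn_apply hz, gram, Matrix.of_apply, coordVec, coordVec,
    TangentBundle.symmL_trivializationAt (pointAt_mem_source hz)]
  have : extChartAt (cornerModel n) p (pointAt p z) = z := coords_pointAt hz
  rw [this]
  rfl

lemma fieldCoord_eq {X : ∀ x : M, TangentSpace (cornerModel n) x}
    (hz : z ∈ (extChartAt (cornerModel n) p).target) (k : Fin n) :
    fieldCoord X p k z = fieldIn X p z k := by
  rw [fieldCoord, ← TangentBundle.continuousLinearMapAt_trivializationAt (pointAt_mem_source hz),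
    fieldIn]
  have h := (trivializationAt (Eucl n) (TangentSpace (cornerModel n)) p).coe_linearMapAt_of_mem
    (R := ℝ) (b := pointAt p z) (pointAt_mem_source hz)
  exact congrArg (fun v : Eucl n => v k) (congrFun h (X (pointAt p z)))

lemma contDiffWithinAt_transition (hz : z ∈ (extChartAt (cornerModel n) q).target)
    (h : pointAt q z ∈ (chartAt (EuclideanQuadrant n) p).source) :
    ContDiffWithinAt ℝ 2 (transition q p) (quad n) z := by
  refine contDiffWithinAt_ext_coord_change p q ?_
  rw [PartialEquiv.trans_source, PartialEquiv.symm_source]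
  refine ⟨hz, ?_⟩
  rw [mem_preimage, extChartAt_source]
  exact h

lemma fderivWithin_transition (hz : z ∈ (extChartAt (cornerModel n) q).target) :
    fderivWithin ℝ (transition q p) (quad n) z =
      tangentCoordChange (cornerModel n) q p (pointAt q z) := by
  rw [tangentCoordChange_def]
  have : extChartAt (cornerModel n) q (pointAt q z) = z := coords_pointAt hz
  rw [this]
  rfl

lemma fieldIn_transition {X : ∀ x : M, TangentSpace (cornerModel n) x}
    (hz : z ∈ (extChartAt (cornerModel n) q).target)
    (h : pointAt q z ∈ (chartAt (EuclideanQuadrant n) p).source) :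
    fieldIn X p (transition q p z) =
      fderivWithin ℝ (transition q p) (quad n) z (fieldIn X q z) := by
  have h1 : pointAt p (transition q p z) = pointAt q z := pointAt_coords h
  have h2 := pointAt_mem_source hz
  rw [fderivWithin_transition hz, fieldIn, h1, fieldIn]
  refine (tangentCoordChange_comp (I := cornerModel n) (w := pointAt q z) (x := q) (y := p)
    ⟨⟨?_, ?_⟩, ?_⟩).symm <;> rw [extChartAt_source]
  · exact mem_chart_source _ _
  · exact h2
  · exact h

lemma metricIn_transition (hz : z ∈ (extChartAt (cornerModel n) q).target)
    (h : pointAt q z ∈ (chartAt (EuclideanQuadrant n) p).source) (u v : Eucl n) :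
    metricIn g q z u v = metricIn g p (transition q p z)
      (fderivWithin ℝ (transition q p) (quad n) z u)
      (fderivWithin ℝ (transition q p) (quad n) z v) := by
  have h1 : pointAt p (transition q p z) = pointAt q z := pointAt_coords h
  have h2 := pointAt_mem_source hz
  have key : ∀ u, (trivializationAt (Eucl n) (TangentSpace (cornerModel n)) p).symmL ℝ (pointAt q z)
      (tangentCoordChange (cornerModel n) q p (pointAt q z) u) =
      (trivializationAt (Eucl n) (TangentSpace (cornerModel n)) q).symmL ℝ (pointAt q z) u :=
    fun u => by
      rw [TangentBundle.symmL_trivializationAt_eq_core h,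
        TangentBundle.symmL_trivializationAt_eq_core h2]
      refine tangentCoordChange_comp (I := cornerModel n) (w := q) (x := p) (y := pointAt q z)
        ⟨⟨?_, ?_⟩, ?_⟩ <;> rw [extChartAt_source]
      · exact h2
      · exact h
      · exact mem_chart_source _ _
  have h3 := metricIn_apply (g := g) (coords_mem_target h)
    (tangentCoordChange (cornerModel n) q p (pointAt q z) u)
    (tangentCoordChange (cornerModel n) q p (pointAt q z) v)
  rw [pointAt_coords h, key, key] at h3
  rw [fderivWithin_transition hz, metricIn_apply hz]
  exact h3.symm

lemma metricIn_coords_self (p : M) : metricIn g p (coords p p) = g.inner p := by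
  have h := mem_chart_source (EuclideanQuadrant n) p
  ext u v
  rw [metricIn_apply (coords_mem_target h), pointAt_coords h,
    TangentBundle.symmL_trivializationAt_eq_core h]
  have : ∀ u : Eucl n, tangentCoordChange (cornerModel n) p p p u = u := fun u =>
    tangentCoordChange_self (mem_extChartAt_source p)
  exact congrArg₂ (fun u v => g.inner p u v) (this u) (this v)

/-- The derivative at `q` of the transition map from the chart at `q` to the chart at `p`. -/
def transitionEquiv (h : q ∈ (chartAt (EuclideanQuadrant n) p).source) : Eucl n ≃L[ℝ] Eucl n :=
  ContinuousLinearEquiv.equivOfInverse (tangentCoordChange (cornerModel n) q p q)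
    (tangentCoordChange (cornerModel n) p q q)
    (fun u => by
      have h1 := mem_chart_source (EuclideanQuadrant n) q
      rw [tangentCoordChange_comp, tangentCoordChange_self] <;> simp [h, h1])
    (fun u => by
      have h1 := mem_chart_source (EuclideanQuadrant n) q
      rw [tangentCoordChange_comp, tangentCoordChange_self] <;> simp [h, h1])

lemma transitionEquiv_eq (h : q ∈ (chartAt (EuclideanQuadrant n) p).source) :
    (transitionEquiv h : Eucl n →L[ℝ] Eucl n) =
      fderivWithin ℝ (transition q p) (quad n) (coords q q) := by
  have h1 := mem_chart_source (EuclideanQuadrant n) q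
  rw [fderivWithin_transition (coords_mem_target h1), pointAt_coords h1]
  rfl

end Charts

/-! ### Covariant derivative, divergence and mean curvature in coordinates -/

section Coordinates

variable {n : ℕ}

lemma sum_apply_smul_basisVec (u : Eucl n) : ∑ k, u k • basisVec k = u := by
  ext i
  rw [sum_smul_basisVec_apply]
  simp

lemma sum_apply_smul_coordL (ψ : Eucl n →L[ℝ] ℝ) : ∑ l, ψ (basisVec l) • coordL l = ψ := by
  ext u
  conv_rhs => rw [← sum_apply_smul_basisVec u, map_sum]
  rw [_root_.sum_apply]
  refine Finset.sum_congr rfl fun l _ => ?_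
  rw [map_smul, smul_apply, coordL_apply, smul_eq_mul, smul_eq_mul, mul_comm]

lemma traceL_eq_sum (A : Eucl n →L[ℝ] Eucl n) : traceL _ A = ∑ k, A (basisVec k) k := by
  have : A = ∑ k, (coordL k).smulRight (A (basisVec k)) := by
    ext1 u
    conv_lhs => rw [← sum_apply_smul_basisVec u, map_sum]
    rw [_root_.sum_apply]
    refine Finset.sum_congr rfl fun l _ => ?_
    rw [map_smul]
    rfl
  conv_lhs => rw [this, map_sum]
  refine Finset.sum_congr rfl fun l _ => ?_
  rw [traceL_smulRight]
  rfl

/-- `u, v ↦ 2 g(∇_u x, v)` for a constant field `x`, where `D` is the derivative of the metric: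
the Christoffel symbols of the first kind. -/
def lowerChristoffel (D : Eucl n →L[ℝ] Eucl n →L[ℝ] Eucl n →L[ℝ] ℝ) (x : Eucl n) :
    Eucl n →L[ℝ] Eucl n →L[ℝ] ℝ :=
  D.flip x + D x - (D.flip x).flip

lemma lowerChristoffel_apply (D : Eucl n →L[ℝ] Eucl n →L[ℝ] Eucl n →L[ℝ] ℝ) (x u v : Eucl n) :
    lowerChristoffel D x u v = D u x v + D x u v - D v x u := rfl

/-- The covariant derivative `∇X = DX + Γ(·, X)` on the quadrant, as an endomorphism. -/
def covEnd (G : Eucl n → Eucl n →L[ℝ] Eucl n →L[ℝ] ℝ) (X : Eucl n → Eucl n) (z : Eucl n) :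
    Eucl n →L[ℝ] Eucl n :=
  fderivWithin ℝ X (quad n) z +
    (1 / 2 : ℝ) • ((G z).inverse ∘L lowerChristoffel (fderivWithin ℝ G (quad n) z) (X z))

variable {G : Eucl n → Eucl n →L[ℝ] Eucl n →L[ℝ] ℝ} {z : Eucl n}

lemma covEnd_add_eq_lieDer {X : Eucl n → Eucl n} (hz : z ∈ quad n) (hI : IsInnerProd (G z))
    (hG : DifferentiableWithinAt ℝ G (quad n) z)
    (hsymm : ∀ᶠ w in 𝓝[quad n] z, ∀ u v, G w u v = G w v u) (u v : Eucl n) :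
    G z (covEnd G X z u) v + G z u (covEnd G X z v) = lieDer G X z u v := by
  have h1 := fderivWithin_symm hz hG hsymm (X z) u v
  simp only [covEnd, lieDer, add_apply, smul_apply, ContinuousLinearMap.comp_apply, map_add,
    map_smul, hI.apply_inverse, smul_eq_mul, hI.symm u ((G z).inverse _), lowerChristoffel_apply]
  rw [← h1]
  ring

/-- Minus half of this form is the Hessian of the function with differential `φ`, for constant `φ`
and `x` the metric dual of `φ`. -/
def hessForm (D : Eucl n →L[ℝ] Eucl n →L[ℝ] Eucl n →L[ℝ] ℝ) (x : Eucl n) :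
    Eucl n →L[ℝ] Eucl n →L[ℝ] ℝ :=
  D.flip x + (D.flip x).flip - D x

lemma hessForm_apply (D : Eucl n →L[ℝ] Eucl n →L[ℝ] Eucl n →L[ℝ] ℝ) (x u v : Eucl n) :
    hessForm D x u v = D u x v + D v x u - D x u v := rfl

/-- The trace of `frozenGrad` on the kernel of `φ`, by means of the Hessian. -/
lemma traceKer_frozenGrad (hz : z ∈ quad n) (hI : ∀ᶠ w in 𝓝[quad n] z, IsInnerProd (G w))
    (hG : ContDiffWithinAt ℝ 1 G (quad n) z) (φ : Eucl n →L[ℝ] ℝ) :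
    traceKer (G z).inverse φ (frozenGrad G z φ) =
      traceKer (G z).inverse φ (-(1 / 2 : ℝ) • ((G z).inverse ∘L
        hessForm (fderivWithin ℝ G (quad n) z) ((G z).inverse φ))) := by
  have hIz := hI.self_of_nhdsWithin hz
  have hGd := hG.differentiableWithinAt one_ne_zero
  have hS := (contDiffWithinAt_inverse hG hIz).differentiableWithinAt one_ne_zero
  have hsymm : ∀ᶠ w in 𝓝[quad n] z, ∀ u v, G w u v = G w v u := hI.mono fun w h => h.symm
  have hD : ∀ u, G z (fderivWithin ℝ (fun z => (G z).inverse) (quad n) z u φ) =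
      -fderivWithin ℝ G (quad n) z u ((G z).inverse φ) := fun u => by
    have h1 := hGd.hasFDerivWithinAt.clm_apply
      (hS.hasFDerivWithinAt.clm_apply (hasFDerivWithinAt_const φ z (quad n)))
    have h2 : (fun w => G w ((G w).inverse φ)) =ᶠ[𝓝[quad n] z] fun _ => φ :=
      hI.mono fun w h => h.apply_inverse φ
    have h3 := h2.fderivWithin_eq_of_mem (𝕜 := ℝ) hz
    rw [h1.fderivWithin (uniqueDiffOn_quad z hz), fderivWithin_const_apply] at h3
    have h4 := DFunLike.congr_fun h3 u
    simp only [add_apply, ContinuousLinearMap.comp_apply, ContinuousLinearMap.flip_apply,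
      ContinuousLinearMap.comp_zero, zero_add, zero_apply] at h4
    exact eq_neg_of_add_eq_zero_left h4
  obtain ⟨x, hx⟩ : ∃ x, x = (G z).inverse φ := ⟨_, rfl⟩
  obtain ⟨B, hB⟩ : ∃ B, B = frozenGrad G z φ := ⟨_, rfl⟩
  obtain ⟨D, hDd⟩ : ∃ D, D = -(1 / 2 : ℝ) • ((G z).inverse ∘L
        hessForm (fderivWithin ℝ G (quad n) z) ((G z).inverse φ)) := ⟨_, rfl⟩
  have hskew : ∀ u v, G z ((B - D) u) v + G z u ((B - D) v) = 0 := fun u v => by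
    rw [hIz.symm u]
    rw [hB, hDd, frozenGrad]
    simp only [_root_.sub_apply, add_apply, smul_apply, ContinuousLinearMap.comp_apply, map_add,
      map_sub, map_smul, hIz.apply_inverse, smul_eq_mul, ContinuousLinearMap.flip_apply, hD,
      neg_apply, hessForm_apply]
    rw [fderivWithin_symm hz hGd hsymm _ v u]
    ring
  have htr := hIz.traceL_eq_zero_of_skew hskew
  have hφ : ∀ A : Eucl n →L[ℝ] Eucl n, φ (A x) = G z x (A x) := fun A => by
    rw [hx, hIz.apply_inverse]
  have hxx := hskew x x
  rw [hIz.symm _ x] at hxx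
  rw [← hB, ← hDd, traceKer, traceKer, ← hx, hφ, hφ]
  rw [map_sub] at htr
  rw [_root_.sub_apply, map_sub] at hxx
  rw [show traceL (Eucl n) B = traceL (Eucl n) D by linarith,
    show G z x (B x) = G z x (D x) by linarith]

end Coordinates

section Charts

variable {n : ℕ} {M : Type*} [TopologicalSpace M] [ChartedSpace (EuclideanQuadrant n) M]
  [IsManifold (cornerModel n) 2 M] {g : Metric n M} {p : M} {z : Eucl n}

lemma cogram_eq (hz : z ∈ (extChartAt (cornerModel n) p).target) (k l : Fin n) :
    cogram g p z k l = (metricIn g p z).inverse (coordL l) k := by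
  have hI := isInnerProd_metricIn (g := g) hz
  have : gram g p z * Matrix.of (fun k l => (metricIn g p z).inverse (coordL l) k) = 1 := by
    ext i l
    have h1 : ∀ k, gram g p z i k * (metricIn g p z).inverse (coordL l) k =
        metricIn g p z (basisVec i) ((metricIn g p z).inverse (coordL l) k • basisVec k) :=
      fun k => by rw [gram_eq hz, map_smul, smul_eq_mul, mul_comm]
    simp only [Matrix.mul_apply, Matrix.of_apply, h1]
    rw [← map_sum, sum_apply_smul_basisVec, hI.symm, hI.apply_inverse, coordL_apply,
      basisVec_apply, Matrix.one_apply]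
    simp [eq_comm]
  rw [cogram, Matrix.inv_eq_right_inv this, Matrix.of_apply]

lemma partialDeriv_gram (p : M) (i j l : Fin n) :
    partialDeriv (fun z => gram g p z j l) i (coords p p) =
      fderivWithin ℝ (metricIn g p) (quad n) (coords p p) (basisVec i) (basisVec j)
        (basisVec l) := by
  have hz : coords p p ∈ (extChartAt (cornerModel n) p).target :=
    coords_mem_target (mem_chart_source _ p)
  have he : (fun z => gram g p z j l) =ᶠ[𝓝[quad n] coords p p]
      fun z => metricIn g p z (basisVec j) (basisVec l) := by
    filter_upwards [extChartAt_target_mem_nhdsWithin_of_mem hz] with w hw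
    exact gram_eq hw j l
  rw [partialDeriv, he.fderivWithin_eq_of_mem (mem_quad_of_mem_target hz),
    fderivWithin_clm_apply_apply (mem_quad_of_mem_target hz)
      ((contDiffWithinAt_metricIn hz).differentiableWithinAt one_ne_zero)]

lemma eventually_isInnerProd_metricIn (hz : z ∈ (extChartAt (cornerModel n) p).target) :
    ∀ᶠ w in 𝓝[quad n] z, IsInnerProd (metricIn g p w) := by
  filter_upwards [extChartAt_target_mem_nhdsWithin_of_mem hz] with w hw
  exact isInnerProd_metricIn hw

/-- Raising the index of a covector with components `ψ_l`. -/
lemma sum_cogram_mul (hz : z ∈ (extChartAt (cornerModel n) p).target) (ψ : Eucl n →L[ℝ] ℝ)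
    (k : Fin n) :
    ∑ l, cogram g p z k l * ψ (basisVec l) = (metricIn g p z).inverse ψ k := by
  conv_rhs => rw [← sum_apply_smul_coordL ψ, map_sum]
  rw [← coordL_apply, map_sum]
  refine Finset.sum_congr rfl fun l _ => ?_
  rw [cogram_eq hz, map_smul, map_smul, coordL_apply, smul_eq_mul, mul_comm]

lemma christoffel_eq (p : M) (k i j : Fin n) :
    christoffel g p k i j = 1 / 2 * (metricIn g p (coords p p)).inverse
      (lowerChristoffel (fderivWithin ℝ (metricIn g p) (quad n) (coords p p)) (basisVec j)
        (basisVec i)) k := by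
  have hz : coords p p ∈ (extChartAt (cornerModel n) p).target :=
    coords_mem_target (mem_chart_source _ p)
  rw [christoffel, ← sum_cogram_mul hz]
  congr 1
  refine Finset.sum_congr rfl fun l _ => ?_
  rw [partialDeriv_gram, partialDeriv_gram, partialDeriv_gram, lowerChristoffel_apply,
    fderivWithin_symm (mem_quad_of_mem_target hz)
      ((contDiffWithinAt_metricIn hz).differentiableWithinAt one_ne_zero)
      ((eventually_isInnerProd_metricIn hz).mono fun w h => h.symm) (basisVec l)]

lemma divAlong_eq {X : ∀ x : M, TangentSpace (cornerModel n) x}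
    (hX : ContMDiff (cornerModel n) (cornerModel n).tangent 1
      (fun x => (⟨x, X x⟩ : TangentBundle (cornerModel n) M))) (q : M)
    (P : Eucl n →L[ℝ] Eucl n) :
    divAlong g X q P = traceL _ (P ∘L covEnd (metricIn g q) (fieldIn X q) (coords q q)) := by
  have hz : coords q q ∈ (extChartAt (cornerModel n) q).target :=
    coords_mem_target (mem_chart_source _ q)
  have hzq := mem_quad_of_mem_target hz
  have key : ∀ i k, covDeriv g X q i k =
      covEnd (metricIn g q) (fieldIn X q) (coords q q) (basisVec i) k := fun i k => by
    have he : fieldCoord X q k =ᶠ[𝓝[quad n] coords q q] fun z => coordL k (fieldIn X q z) := by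
      filter_upwards [extChartAt_target_mem_nhdsWithin_of_mem hz] with w hw
      exact fieldCoord_eq hw k
    have hd := (coordL k).hasFDerivAt.comp_hasFDerivWithinAt (coords q q)
      ((contDiffWithinAt_fieldIn hz hX).differentiableWithinAt one_ne_zero).hasFDerivWithinAt
    rw [covDeriv, partialDeriv, he.fderivWithin_eq_of_mem hzq]
    have h1 : fderivWithin ℝ (fun z => coordL k (fieldIn X q z)) (quad n) (coords q q) =
        coordL k ∘L fderivWithin ℝ (fieldIn X q) (quad n) (coords q q) :=
      hd.fderivWithin (uniqueDiffOn_quad _ hzq)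
    rw [h1, covEnd, add_apply, PiLp.add_apply]
    congr 1
    obtain ⟨D, hD⟩ : ∃ D, D = fderivWithin ℝ (metricIn g q) (quad n) (coords q q) := ⟨_, rfl⟩
    have h2 : ∀ j, christoffel g q k i j * fieldCoord X q j (coords q q) =
        1 / 2 * coordL k ((metricIn g q (coords q q)).inverse
          (fieldIn X q (coords q q) j • lowerChristoffel D (basisVec j) (basisVec i))) :=
      fun j => by
        rw [christoffel_eq, fieldCoord_eq hz, map_smul, map_smul, smul_eq_mul, coordL_apply, hD]
        ring
    rw [Finset.sum_congr rfl fun j _ => h2 j, ← Finset.mul_sum, ← map_sum, ← map_sum, ← hD,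
      smul_apply, PiLp.smul_apply, smul_eq_mul, ContinuousLinearMap.comp_apply, coordL_apply]
    have h3 : ∑ j, fieldIn X q (coords q q) j • lowerChristoffel D (basisVec j) (basisVec i) =
        lowerChristoffel D (fieldIn X q (coords q q)) (basisVec i) := by
      ext v
      conv_rhs => rw [← sum_apply_smul_basisVec (fieldIn X q (coords q q))]
      simp only [_root_.sum_apply, lowerChristoffel_apply, smul_apply, map_sum, map_smul,
        smul_eq_mul, ← Finset.sum_add_distrib, ← Finset.sum_sub_distrib]
      refine Finset.sum_congr rfl fun j _ => ?_
      ring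
    rw [h3]
  change ∑ i, ∑ k, P (basisVec k) i * covDeriv g X q i k = _
  rw [traceL_comp_comm, traceL_eq_sum, Finset.sum_comm]
  refine Finset.sum_congr rfl fun k _ => ?_
  rw [ContinuousLinearMap.comp_apply]
  obtain ⟨A, hA⟩ : ∃ A, A = covEnd (metricIn g q) (fieldIn X q) (coords q q) := ⟨_, rfl⟩
  rw [← hA] at key ⊢
  conv_rhs => rw [← sum_apply_smul_basisVec (P (basisVec k)), map_sum, ← coordL_apply, map_sum]
  refine Finset.sum_congr rfl fun i _ => ?_
  rw [key, map_smul, map_smul, coordL_apply, smul_eq_mul]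

lemma cogram_symm (hz : z ∈ (extChartAt (cornerModel n) p).target) (k l : Fin n) :
    cogram g p z k l = cogram g p z l k := by
  rw [cogram_eq hz, cogram_eq hz]
  exact (isInnerProd_metricIn hz).inverse_symm (coordL k) (coordL l)

lemma cogram_self_pos (hz : z ∈ (extChartAt (cornerModel n) p).target) (c : Fin n) :
    0 < cogram g p z c c := by
  have hI := isInnerProd_metricIn (g := g) hz
  have h1 : cogram g p z c c = metricIn g p z ((metricIn g p z).inverse (coordL c))
      ((metricIn g p z).inverse (coordL c)) := by
    rw [cogram_eq hz, hI.apply_inverse, coordL_apply]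
  rw [h1]
  refine hI.pos _ fun h => ?_
  have h2 : coordL c (basisVec c) = 0 := by
    rw [← hI.apply_inverse (coordL c), h]; simp
  rw [coordL_apply, basisVec_apply] at h2
  simp at h2

lemma traceKer_eq_meanCurvature (p : M) (c : Fin n) :
    traceKer (metricIn g p (coords p p)).inverse (coordL c)
      (frozenGrad (metricIn g p) (coords p p) (coordL c)) =
      -(√(cogram g p (coords p p) c c) * meanCurvature g p c) := by
  have hz : coords p p ∈ (extChartAt (cornerModel n) p).target :=
    coords_mem_target (mem_chart_source _ p)
  have hzq := mem_quad_of_mem_target hz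
  have hI := isInnerProd_metricIn (g := g) hz
  have hpos := cogram_self_pos (g := g) hz c
  have hsq : √(cogram g p (coords p p) c c) ≠ 0 := (Real.sqrt_pos.2 hpos).ne'
  have hsymm := (eventually_isInnerProd_metricIn (g := g) hz).mono fun w h => h.symm
  have hdiff := (contDiffWithinAt_metricIn (g := g) hz).differentiableWithinAt one_ne_zero
  rw [traceKer_frozenGrad hzq (eventually_isInnerProd_metricIn hz) (contDiffWithinAt_metricIn hz)]
  obtain ⟨D, hD⟩ : ∃ D, D = fderivWithin ℝ (metricIn g p) (quad n) (coords p p) := ⟨_, rfl⟩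
  have hDs : ∀ x u v, D x u v = D x v u := fun x u v => by
    rw [hD]; exact fderivWithin_symm hzq hdiff hsymm x u v
  obtain ⟨S, hS⟩ : ∃ S, S = (metricIn g p (coords p p)).inverse := ⟨_, rfl⟩
  obtain ⟨H, hH⟩ : ∃ H, H = hessForm D (S (coordL c)) := ⟨_, rfl⟩
  have hHΓ : ∀ i j, christoffel g p c i j = 1 / 2 * H (basisVec i) (basisVec j) := fun i j => by
    rw [christoffel_eq, ← coordL_apply, hI.inverse_symm, ← hS, ← hD, lowerChristoffel_apply, hH,
      hessForm_apply, hDs _ _ (S _), hDs _ _ (S _), hDs (S _)]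
  have hcog : ∀ i j, cogram g p (coords p p) i j = S (coordL j) i := fun i j => by
    rw [cogram_eq hz, hS]
  have hraise : ∀ ψ k, ∑ l, cogram g p (coords p p) k l * ψ (basisVec l) = S ψ k := fun ψ k => by
    rw [sum_cogram_mul hz, hS]
  rw [← hD, ← hS, ← hH]
  -- the full trace
  have h1 : traceL (Eucl n) (S ∘L H) = ∑ i, ∑ j, cogram g p (coords p p) i j *
      H (basisVec i) (basisVec j) := by
    rw [traceL_eq_sum]
    refine Finset.sum_congr rfl fun k _ => ?_
    rw [ContinuousLinearMap.comp_apply, hraise]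
  -- the normal direction
  have h2 : coordL c (S (H (S (coordL c)))) = ∑ i, ∑ j, cogram g p (coords p p) i c *
      cogram g p (coords p p) j c * H (basisVec i) (basisVec j) := by
    have h3 : coordL c (S (H (S (coordL c)))) = H (S (coordL c)) (S (coordL c)) := by
      rw [hS, hI.inverse_symm]
    rw [h3]
    conv_lhs => rw [← sum_apply_smul_basisVec (S (coordL c))]
    simp only [map_sum, map_smul, _root_.sum_apply, smul_apply, smul_eq_mul,
      Finset.mul_sum, hcog]
    rw [Finset.sum_comm]
    refine Finset.sum_congr rfl fun i _ => Finset.sum_congr rfl fun j _ => ?_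
    ring
  rw [traceKer, map_smul, h1, smul_apply, ContinuousLinearMap.comp_apply, map_smul, h2,
    show coordL c (S (coordL c)) = cogram g p (coords p p) c c by rw [hcog, coordL_apply],
    meanCurvature, smul_eq_mul, smul_eq_mul]
  simp only [hHΓ, Finset.mul_sum, Finset.sum_div, ← Finset.sum_sub_distrib,
    ← Finset.sum_neg_distrib]
  refine Finset.sum_congr rfl fun i _ => Finset.sum_congr rfl fun j _ => ?_
  field_simp
  ring

lemma cogram_eq_zero_of_dihedralAngle {c d : Fin n} (h : dihedralAngle g p c d = Real.pi / 2) :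
    cogram g p (coords p p) c d = 0 := by
  have hz : coords p p ∈ (extChartAt (cornerModel n) p).target :=
    coords_mem_target (mem_chart_source _ p)
  rw [dihedralAngle, Real.arccos_eq_pi_div_two, neg_eq_zero, div_eq_zero_iff] at h
  rcases h with h | h
  · exact h
  · have h1 := Real.sqrt_pos.2 (cogram_self_pos (g := g) hz c)
    have h2 := Real.sqrt_pos.2 (cogram_self_pos (g := g) hz d)
    exact absurd h (mul_pos h1 h2).ne'

end Charts

/-! ### Points and faces in charts -/

section FaceCoordinates

variable {n : ℕ} {M : Type*} [TopologicalSpace M] [ChartedSpace (EuclideanQuadrant n) M]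
  {ι : Type*} {p : M}

lemma transition_coords {q : M} (h : q ∈ (chartAt (EuclideanQuadrant n) q).source) :
    transition q p (coords (n := n) q q) = coords p q := by
  have := pointAt_coords h
  rw [transition, Function.comp_apply]
  exact congrArg (coords p) this

lemma eventually_pointAt_mem {W : Set M} {z : Eucl n}
    (hz : z ∈ (extChartAt (cornerModel n) p).target) (hW : W ∈ 𝓝 (pointAt p z)) :
    ∀ᶠ w in 𝓝[quad n] z, w ∈ (extChartAt (cornerModel n) p).target ∧ pointAt p w ∈ W := by
  have h1 := extChartAt_target_mem_nhdsWithin_of_mem hz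
  have h2 : ContinuousWithinAt (extChartAt (cornerModel n) p).symm (quad n) z :=
    ((continuousOn_extChartAt_symm p) z hz).mono_of_mem_nhdsWithin h1
  filter_upwards [h1, h2 hW] with w hw1 hw2
  exact ⟨hw1, hw2⟩

lemma IsFaceCoord.coords_eq_zero {F : Set M} {c : Fin n} (h : IsFaceCoord F p c) :
    coords p p c = 0 := h.2.self_of_nhds.1 h.1

/-- Near `p`, only the faces through `p` matter, and these are the coordinate hyperplanes of the
chart at `p`. -/
lemma FaceSystem.exists_nhds [Finite ι] (F : FaceSystem n M ι) (p : M) :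
    ∃ W : Set M, IsOpen W ∧ p ∈ W ∧ W ⊆ (chartAt (EuclideanQuadrant n) p).source ∧
      (∀ i, ∀ q ∈ W, q ∈ F.face i → p ∈ F.face i) ∧
      ∀ i k, IsFaceCoord (F.face i) p k → ∀ q ∈ W, (q ∈ F.face i ↔ coords (n := n) p q k = 0) := by
  have h1 : ∀ᶠ q in 𝓝 p, ∀ i, q ∈ F.face i → p ∈ F.face i := by
    rw [eventually_all]
    intro i
    by_cases hp : p ∈ F.face i
    · exact Eventually.of_forall fun q _ => hp
    · filter_upwards [(F.isClosed_face i).isOpen_compl.mem_nhds hp] with q hq h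
      exact absurd h hq
  have h2 : ∀ᶠ q in 𝓝 p, ∀ i k, IsFaceCoord (F.face i) p k →
      (q ∈ F.face i ↔ coords (n := n) p q k = 0) := by
    rw [eventually_all]
    intro i
    rw [eventually_all]
    intro k
    by_cases hk : IsFaceCoord (F.face i) p k
    · exact hk.2.mono fun q hq _ => hq
    · exact Eventually.of_forall fun q h => absurd h hk
  have h3 : ∀ᶠ q in 𝓝 p, q ∈ (chartAt (EuclideanQuadrant n) p).source :=
    (chartAt _ p).open_source.mem_nhds (mem_chart_source _ p)
  obtain ⟨W, hW, hWo, hpW⟩ := eventually_nhds_iff.1 ((h1.and h2).and h3)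
  exact ⟨W, hWo, hpW, fun q hq => (hW q hq).2, fun i q hq => (hW q hq).1.1 i,
    fun i k hk q hq => (hW q hq).1.2 i k hk⟩

/-- Every coordinate hyperplane through `p` other than that of the face `T` belongs to a lateral
face. -/
lemma FaceSystem.exists_lateral (F : FaceSystem n M ι) {T B : ι}
    (hTB : Disjoint (F.face T) (F.face B)) {c k : Fin n} (hc : IsFaceCoord (F.face T) p c)
    (hk : k ∈ lateral (coords p p) c) :
    ∃ i, i ≠ T ∧ i ≠ B ∧ IsFaceCoord (F.face i) p k := by
  obtain ⟨hkc, hk0⟩ := mem_lateral.1 hk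
  obtain ⟨i, hi, -⟩ := F.existsUnique_face p k hk0
  refine ⟨i, ?_, ?_, hi⟩
  · rintro rfl
    have hps := mem_chart_source (EuclideanQuadrant n) p
    have hz := coords_mem_target hps
    have hzq := mem_quad_of_mem_target hz
    have hev := eventually_pointAt_mem hz
      (W := {x | x ∈ F.face i ↔ coords p x c = 0} ∩ {x | x ∈ F.face i ↔ coords p x k = 0})
      (by rw [pointAt_coords hps]; exact inter_mem hc.2 hi.2)
    -- move away from one of the hyperplanes inside of the other
    have htend : Tendsto (fun s : ℝ => coords p p + s • basisVec k) (𝓝[>] 0)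
        (𝓝[quad n] (coords p p)) := by
      refine tendsto_nhdsWithin_iff.2 ⟨?_, ?_⟩
      · have : Continuous fun s : ℝ => coords p p + s • (basisVec k : Eucl n) := by fun_prop
        have h := this.tendsto 0
        rw [zero_smul, add_zero] at h
        exact h.mono_left nhdsWithin_le_nhds
      · filter_upwards [self_mem_nhdsWithin] with s hs
        have hs' : 0 < s := hs
        refine mem_quad.2 fun i => ?_
        have h1 := mem_quad.1 hzq i
        rw [PiLp.add_apply, PiLp.smul_apply, basisVec_apply, smul_eq_mul]
        split_ifs <;> linarith
    obtain ⟨s, ⟨hs1, hs2⟩, hs3⟩ := ((htend.eventually hev).and self_mem_nhdsWithin).exists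
    have hs : 0 < s := hs3
    rw [mem_inter_iff, mem_ofPred_eq, mem_ofPred_eq, coords_pointAt hs1, PiLp.add_apply,
      PiLp.add_apply, PiLp.smul_apply, PiLp.smul_apply, basisVec_apply, basisVec_apply,
      hc.coords_eq_zero, hk0, if_neg (Ne.symm hkc), if_pos rfl] at hs2
    have := hs2.2.1 (hs2.1.2 (by simp))
    simp at this
    exact hs.ne' this
  · rintro rfl
    exact Set.disjoint_left.1 hTB hc.1 hi.1

end FaceCoordinates

/-! ### The divergence in an arbitrary chart -/

section DivergenceInChart

variable {n : ℕ} {M : Type*} [TopologicalSpace M] [ChartedSpace (EuclideanQuadrant n) M]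
  [IsManifold (cornerModel n) 2 M] {g : Metric n M} {p q : M}

lemma metricIn_eq_conj (h : q ∈ (chartAt (EuclideanQuadrant n) p).source) (u v : Eucl n) :
    metricIn g q (coords q q) u v =
      metricIn g p (coords p q) (transitionEquiv h u) (transitionEquiv h v) := by
  have hq := mem_chart_source (EuclideanQuadrant n) q
  have h1 := metricIn_transition (g := g) (p := p) (coords_mem_target hq)
    (by rwa [pointAt_coords hq]) u v
  rw [transition_coords hq, ← transitionEquiv_eq h] at h1
  exact h1

/-- The divergence in the chart at `p`, at any point of its domain: the covariant derivative may be
replaced by `symGrad`. -/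
lemma divAlong_eq_symGrad {m : ℕ} (hm : m + 1 = n) {X : ∀ x : M, TangentSpace (cornerModel n) x}
    (hX : ContMDiff (cornerModel n) (cornerModel n).tangent 1
      (fun x => (⟨x, X x⟩ : TangentBundle (cornerModel n) M)))
    (h : q ∈ (chartAt (EuclideanQuadrant n) p).source) {P : Eucl n →L[ℝ] Eucl n}
    (hP : IsOrthProj g m q P) :
    IsProj (metricIn g p (coords p q)) m ((transitionEquiv h : Eucl n →L[ℝ] Eucl n) ∘L P ∘L
      ((transitionEquiv h).symm : Eucl n →L[ℝ] Eucl n)) ∧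
    divAlong g X q P = traceL _ (((transitionEquiv h : Eucl n →L[ℝ] Eucl n) ∘L P ∘L
      ((transitionEquiv h).symm : Eucl n →L[ℝ] Eucl n)) ∘L
        symGrad (metricIn g p) (fieldIn X p) (quad n) (coords p q)) := by
  have hq := mem_chart_source (EuclideanQuadrant n) q
  have hzq := coords_mem_target hq
  have hzp := coords_mem_target h
  have hP' : IsProj (metricIn g q (coords q q)) m P := by
    rw [metricIn_coords_self]
    exact hP
  have hIp := isInnerProd_metricIn (g := g) hzp
  have hIq := isInnerProd_metricIn (g := g) hzq
  have hdp := (contDiffWithinAt_metricIn (g := g) hzp).differentiableWithinAt one_ne_zero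
  have hdq := (contDiffWithinAt_metricIn (g := g) hzq).differentiableWithinAt one_ne_zero
  have hsp := (eventually_isInnerProd_metricIn (g := g) hzp).mono fun w h => h.symm
  have hsq := (eventually_isInnerProd_metricIn (g := g) hzq).mono fun w h => h.symm
  refine ⟨hP'.conj (metricIn_eq_conj h), ?_⟩
  rw [divAlong_eq hX]
  refine traceL_proj_conj (metricIn_eq_conj h) hIp (by simpa using hm) hP' fun u v => ?_
  rw [covEnd_add_eq_lieDer (mem_quad_of_mem_target hzq) hIq hdq hsq,
    symGrad_add_eq_lieDer (mem_quad_of_mem_target hzp) hIp hdp hsp]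
  have hev := eventually_pointAt_mem hzq (W := (chartAt (EuclideanQuadrant n) p).source)
    (by rw [pointAt_coords hq]; exact (chartAt (EuclideanQuadrant n) p).open_source.mem_nhds h)
  have hpq : pointAt q (coords (n := n) q q) ∈ (chartAt (EuclideanQuadrant n) p).source := by
    rwa [pointAt_coords hq]
  have key := lieDer_pullback (Gp := metricIn g p) (Gq := metricIn g q) (Xp := fieldIn X p)
    (Xq := fieldIn X q) (τ := transition q p) (mem_quad_of_mem_target hzq)
    (contDiffWithinAt_transition hzq hpq)
    (hev.mono fun w hw => mem_quad_of_mem_target (coords_mem_target hw.2))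
    (hev.mono fun w hw => metricIn_transition hw.1 hw.2)
    (hev.mono fun w hw => fieldIn_transition hw.1 hw.2)
    (by rw [transition_coords hq]; exact hdp) hdq
    (by rw [transition_coords hq]
        exact (contDiffWithinAt_fieldIn hzp hX).differentiableWithinAt one_ne_zero)
    ((contDiffWithinAt_fieldIn hzq hX).differentiableWithinAt one_ne_zero) u v
  rw [key, transition_coords hq, ← transitionEquiv_eq h]
  rfl

end DivergenceInChart

/-! ### Faces in nearby charts -/

section Faces

variable {n : ℕ} {M : Type*} [TopologicalSpace M] [ChartedSpace (EuclideanQuadrant n) M]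
  [IsManifold (cornerModel n) 2 M] {g : Metric n M} {p q : M}

/-- The differentials of the functions that define the same face in two charts are positive
multiples of each other. -/
lemma IsFaceCoord.exists_pos_smul {F W : Set M} {k d : Fin n} (hW : IsOpen W)
    (hWp : W ⊆ (chartAt (EuclideanQuadrant n) p).source)
    (hFW : ∀ x ∈ W, x ∈ F → coords (n := n) p x k = 0) (hq : q ∈ W) (hd : IsFaceCoord F q d) :
    ∃ α : ℝ, 0 < α ∧
      coordL k ∘L (transitionEquiv (hWp hq) : Eucl n →L[ℝ] Eucl n) = α • coordL d := by
  have hqs := mem_chart_source (EuclideanQuadrant n) q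
  have hz := coords_mem_target hqs
  have hzq := mem_quad_of_mem_target hz
  have hqd : coords q q d = 0 := hd.coords_eq_zero
  have hpq : pointAt q (coords (n := n) q q) ∈ (chartAt (EuclideanQuadrant n) p).source := by
    rw [pointAt_coords hqs]; exact hWp hq
  have hτ := ((contDiffWithinAt_transition hz hpq).differentiableWithinAt
    two_ne_zero).hasFDerivWithinAt
  rw [← transitionEquiv_eq (hWp hq)] at hτ
  have hf := (coordL k).hasFDerivAt.comp_hasFDerivWithinAt _ hτ
  have hev := eventually_pointAt_mem hz (W := W ∩ {x | x ∈ F ↔ coords q x d = 0})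
    (by rw [pointAt_coords hqs]; exact inter_mem (hW.mem_nhds hq) hd.2)
  have hfz : ∀ w ∈ (extChartAt (cornerModel n) q).target,
      pointAt q w ∈ W ∩ {x | x ∈ F ↔ coords q x d = 0} → w d = 0 →
        (coordL k ∘ transition q p) w = 0 := fun w hw h h0 =>
    hFW _ h.1 (h.2.2 (by rw [coords_pointAt hw]; exact h0))
  have hf0 : (coordL k ∘ transition q p) (coords q q) = 0 :=
    hfz _ hz (hev.self_of_nhdsWithin hzq).2 hqd
  have hmem : ∀ (j : Fin n), coords q q + basisVec j ∈ quad n := fun j => by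
    refine mem_quad.2 fun i => ?_
    have h1 := mem_quad.1 hzq i
    rw [PiLp.add_apply, basisVec_apply]
    split_ifs <;> linarith
  have hnonneg : ∀ j, 0 ≤ (coordL k ∘L (transitionEquiv (hWp hq) : Eucl n →L[ℝ] Eucl n))
      (basisVec j) := fun j => by
    have hmin : IsLocalMinOn (coordL k ∘ transition q p) (quad n) (coords q q) := by
      filter_upwards [hev] with w hw
      rw [hf0]
      exact mem_quad.1 (mem_quad_of_mem_target (coords_mem_target (hWp hw.2.1))) k
    refine hmin.hasFDerivWithinAt_nonneg hf (mem_posTangentConeAt_of_segment_subset ?_)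
    exact convex_quad.segment_subset hzq (hmem j)
  have hnonpos : ∀ j, j ≠ d → (coordL k ∘L (transitionEquiv (hWp hq) : Eucl n →L[ℝ] Eucl n))
      (basisVec j) ≤ 0 := fun j hj => by
    have hmax : IsLocalMaxOn (coordL k ∘ transition q p) (quad n ∩ {w | w d = 0})
        (coords q q) := by
      filter_upwards [nhdsWithin_mono _ inter_subset_left hev, self_mem_nhdsWithin] with w hw h0
      rw [hf0, hfz w hw.1 hw.2 h0.2]
    refine hmax.hasFDerivWithinAt_nonpos (hf.mono inter_subset_left)
      (mem_posTangentConeAt_of_segment_subset ?_)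
    have hconv : Convex ℝ (quad n ∩ {w : Eucl n | w d = 0}) :=
      convex_quad.inter (convex_hyperplane (coordL d).toLinearMap.isLinear 0)
    refine hconv.segment_subset ⟨hzq, hqd⟩ ⟨hmem j, ?_⟩
    have : (coords q q + basisVec j : Eucl n) d = 0 := by
      rw [PiLp.add_apply, hqd, basisVec_apply, if_neg hj.symm, add_zero]
    exact this
  have hsmul : coordL k ∘L (transitionEquiv (hWp hq) : Eucl n →L[ℝ] Eucl n) =
      ((coordL k ∘L (transitionEquiv (hWp hq) : Eucl n →L[ℝ] Eucl n)) (basisVec d)) •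
        coordL d := by
    obtain ⟨ℓ, hℓ⟩ : ∃ ℓ, ℓ = coordL k ∘L (transitionEquiv (hWp hq) : Eucl n →L[ℝ] Eucl n) :=
      ⟨_, rfl⟩
    rw [← hℓ] at hnonneg hnonpos ⊢
    conv_lhs => rw [← sum_apply_smul_coordL ℓ]
    refine Finset.sum_eq_single d (fun j _ hj => ?_) (by simp)
    rw [le_antisymm (hnonpos j hj) (hnonneg j), zero_smul]
  refine ⟨_, lt_of_le_of_ne (hnonneg d) fun h0 => ?_, hsmul⟩
  rw [← h0, zero_smul] at hsmul
  have h1 := DFunLike.congr_fun hsmul ((transitionEquiv (hWp hq)).symm (basisVec k))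
  simp [basisVec_apply] at h1

variable {ι : Type*}

/-- In the chart at a point of a strictly mean convex face that is orthogonal to its neighbours, the
metric satisfies the assumptions of the local construction of barriers. -/
lemma isBarrierMetric_metricIn (F : FaceSystem n M ι) {T B : ι}
    (hTB : Disjoint (F.face T) (F.face B))
    (angle : ∀ i, i ≠ T → i ≠ B → MeetAtAngle g (F.face T) (F.face i) (Real.pi / 2))
    (convex : StrictlyMeanConvex g (F.face T)) {c : Fin n} (hc : IsFaceCoord (F.face T) p c)
    {W : Set M} (hW : IsOpen W) (hWp : W ⊆ (chartAt (EuclideanQuadrant n) p).source)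
    (hFW : ∀ i k, IsFaceCoord (F.face i) p k → ∀ q ∈ W, (q ∈ F.face i ↔ coords (n := n) p q k = 0))
    {R : ℝ} (hR : 0 < R) (hball : ∀ z ∈ quad n ∩ Metric.ball (coords p p) R,
      z ∈ (extChartAt (cornerModel n) p).target ∧ pointAt p z ∈ W) :
    IsBarrierMetric (metricIn g p) (coords p p) c R where
  mem := mem_quad_of_mem_target (coords_mem_target (mem_chart_source _ p))
  face := hc.coords_eq_zero
  pos := hR
  inner z hz := isInnerProd_metricIn (hball z hz).1
  smooth z hz := contDiffWithinAt_metricIn (hball z hz).1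
  angle k hk z hz hzc hzk := by
    obtain ⟨i, hiT, hiB, hi⟩ := F.exists_lateral hTB hc hk
    obtain ⟨hzt, hzW⟩ := hball z hz
    obtain ⟨q, hq⟩ : ∃ q, q = pointAt p z := ⟨_, rfl⟩
    rw [← hq] at hzW
    have hzq : coords p q = z := by rw [hq, coords_pointAt hzt]
    have hqT : q ∈ F.face T := (hFW T c hc q hzW).2 (by rw [hzq, hzc])
    have hqi : q ∈ F.face i := (hFW i k hi q hzW).2 (by rw [hzq, hzk])
    obtain ⟨d, hd⟩ := F.exists_coord T q hqT
    obtain ⟨d', hd'⟩ := F.exists_coord i q hqi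
    obtain ⟨α, -, hα⟩ := hd.exists_pos_smul hW hWp (fun x hx => (hFW T c hc x hx).1) hzW
    obtain ⟨β, -, hβ⟩ := hd'.exists_pos_smul hW hWp (fun x hx => (hFW i k hi x hx).1) hzW
    have h0 := cogram_eq_zero_of_dihedralAngle (angle i hiT hiB q d d' hd hd')
    have hqs := coords_mem_target (mem_chart_source (EuclideanQuadrant n) q)
    have hIq := isInnerProd_metricIn (g := g) hqs
    have hIp := isInnerProd_metricIn (g := g) hzt
    rw [cogram_symm hqs, cogram_eq hqs] at h0
    -- the dual vector in the chart at `q` is mapped to the dual vector in the chart at `p`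
    have h1 : (metricIn g p z).inverse (coordL c) =
        transitionEquiv (hWp hzW) (α • (metricIn g q (coords q q)).inverse (coordL d)) := by
      refine hIp.ext_left fun u => ?_
      obtain ⟨v, rfl⟩ := (transitionEquiv (hWp hzW)).surjective u
      rw [hIp.apply_inverse]
      have h2 := metricIn_eq_conj (g := g) (hWp hzW)
        (α • (metricIn g q (coords q q)).inverse (coordL d)) v
      rw [hzq] at h2
      rw [← h2, map_smul, smul_apply, hIq.apply_inverse]
      exact DFunLike.congr_fun hα v
    rw [h1]
    have h3 := DFunLike.congr_fun hβ (α • (metricIn g q (coords q q)).inverse (coordL d))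
    have h4 : (β • coordL d') (α • (metricIn g q (coords q q)).inverse (coordL d)) = 0 := by
      rw [smul_apply, map_smul, coordL_apply, h0]; simp
    exact h3.trans h4
  convex := by
    rw [traceKer_eq_meanCurvature, neg_lt_zero]
    exact mul_pos (Real.sqrt_pos.2 (cogram_self_pos
      (coords_mem_target (mem_chart_source _ p)) c)) (convex p c hc)

end Faces

/-! ### Balls in charts -/

section ChartBall

variable {n : ℕ} {M : Type*} [TopologicalSpace M] [ChartedSpace (EuclideanQuadrant n) M] {p q : M}

/-- The part of a ball in the domain of a chart. -/
def chartBall (p : M) (r : ℝ) : Set M :=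
  pointAt p '' (quad n ∩ Metric.closedBall (coords p p) r)

lemma mem_chartBall {r : ℝ} (hq : q ∈ (chartAt (EuclideanQuadrant n) p).source)
    (h : dist (coords (n := n) p q) (coords p p) ≤ r) : q ∈ chartBall (n := n) p r :=
  ⟨coords p q, ⟨mem_quad_of_mem_target (coords_mem_target hq), h⟩, pointAt_coords hq⟩

lemma isClosed_chartBall [T2Space M] {r : ℝ} (h : ∀ z ∈ quad n ∩ Metric.closedBall (coords p p) r,
    z ∈ (extChartAt (cornerModel n) p).target) : IsClosed (chartBall (n := n) p r) := by
  refine IsCompact.isClosed (IsCompact.image_of_continuousOn ?_ ?_)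
  · rw [inter_comm]
    exact (isCompact_closedBall _ _).inter_right (cornerModel n).isClosed_range
  · exact (continuousOn_extChartAt_symm p).mono h

end ChartBall

/-! ### Admissible fields with support in a chart -/

section LocalField

variable {n : ℕ} {M : Type*} [TopologicalSpace M] [ChartedSpace (EuclideanQuadrant n) M]
  [IsManifold (cornerModel n) 2 M]

/-- The vector field on `M` with components `Y` in the chart at `p`, extended by zero. -/
def fieldOf (p : M) (Y : Eucl n → Eucl n) (q : M) : TangentSpace (cornerModel n) q :=
  (trivializationAt (Eucl n) (TangentSpace (cornerModel n)) p).symmL ℝ q (Y (coords p q))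

variable {p q : M} {Y : Eucl n → Eucl n} {z : Eucl n}

lemma fieldOf_eq_zero
    (h : q ∈ (chartAt (EuclideanQuadrant n) p).source → Y (coords p q) = 0) :
    fieldOf p Y q = 0 := by
  by_cases hq : q ∈ (chartAt (EuclideanQuadrant n) p).source
  · rw [fieldOf, h hq, map_zero]
  · exact Trivialization.symmL_apply_of_notMem _ hq _

lemma trivializationAt_fieldOf (hq : q ∈ (chartAt (EuclideanQuadrant n) p).source) :
    (trivializationAt (Eucl n) (TangentSpace (cornerModel n)) p ⟨q, fieldOf p Y q⟩).2 =
      Y (coords p q) := by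
  have h1 := (trivializationAt (Eucl n) (TangentSpace (cornerModel n)) p).continuousLinearMapAt_symmL
    (R := ℝ) (b := q) hq (Y (coords p q))
  have h2 := (trivializationAt (Eucl n) (TangentSpace (cornerModel n)) p).coe_linearMapAt_of_mem
    (R := ℝ) (b := q) hq
  exact (congrFun h2 (fieldOf p Y q)).symm.trans h1

lemma fieldIn_fieldOf (hz : z ∈ (extChartAt (cornerModel n) p).target) :
    fieldIn (fieldOf p Y) p z = Y z := by
  rw [fieldIn, trivializationAt_fieldOf (pointAt_mem_source hz), coords_pointAt hz]

lemma contMDiff_fieldOf [T2Space M] {r R : ℝ} (hrR : r < R)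
    (hball : ∀ z ∈ quad n ∩ Metric.ball (coords p p) R, z ∈ (extChartAt (cornerModel n) p).target)
    (hY : ∀ z ∈ quad n ∩ Metric.ball (coords p p) R, ContDiffWithinAt ℝ 1 Y (quad n) z)
    (hY0 : ∀ z ∈ quad n, r ≤ dist z (coords p p) → Y z = 0) :
    ContMDiff (cornerModel n) (cornerModel n).tangent 1
      (fun x => (⟨x, fieldOf p Y x⟩ : TangentBundle (cornerModel n) M)) := by
  intro q
  by_cases hq : q ∈ chartBall (n := n) p r
  · obtain ⟨z, hz, rfl⟩ := hq
    have hzR : z ∈ quad n ∩ Metric.ball (coords p p) R :=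
      ⟨hz.1, Metric.closedBall_subset_ball hrR hz.2⟩
    have hzt := hball z hzR
    have hs := pointAt_mem_source hzt
    rw [Trivialization.contMDiffAt_section_iff (e := trivializationAt (Eucl n)
      (TangentSpace (cornerModel n)) p) (hx₀ := by simpa using hs)]
    have h1 : ContMDiffAt (cornerModel n) 𝓘(ℝ, Eucl n) 1 (Y ∘ extChartAt (cornerModel n) p)
        (pointAt p z) := by
      have h2 : ContMDiffAt (cornerModel n) 𝓘(ℝ, Eucl n) 1 (extChartAt (cornerModel n) p)
          (pointAt p z) := (contMDiffAt_extChartAt' (n := 2) hs).of_le (by norm_num)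
      have h3 : ContMDiffWithinAt 𝓘(ℝ, Eucl n) 𝓘(ℝ, Eucl n) 1 Y (quad n)
          (extChartAt (cornerModel n) p (pointAt p z)) := by
        have : extChartAt (cornerModel n) p (pointAt p z) = z := coords_pointAt hzt
        rw [this]
        exact (hY z hzR).contMDiffWithinAt
      rw [← contMDiffWithinAt_univ] at h2 ⊢
      exact h3.comp (t := quad n) _ h2 fun x _ => mem_range_self _
    refine h1.congr_of_eventuallyEq ?_
    filter_upwards [(chartAt (EuclideanQuadrant n) p).open_source.mem_nhds hs] with x hx
    exact trivializationAt_fieldOf hx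
  · have hcl : IsClosed (chartBall (n := n) p r) := isClosed_chartBall fun z hz =>
      hball z ⟨hz.1, Metric.closedBall_subset_ball hrR hz.2⟩
    refine ((contMDiff_zeroSection ℝ (TangentSpace (cornerModel n) : M → Type _)) q
      |>.congr_of_eventuallyEq ?_)
    filter_upwards [hcl.isOpen_compl.mem_nhds hq] with x hx
    have : fieldOf p Y x = 0 := fieldOf_eq_zero fun hxs =>
      hY0 _ (mem_quad_of_mem_target (coords_mem_target hxs))
        (le_of_lt (not_le.1 fun h => hx (mem_chartBall hxs h)))
    rw [this]
    rfl

/-- Outside of the support of the field there is no divergence. -/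
lemma divAlong_eq_zero_of_eventually {g : Metric n M} {X : ∀ x : M, TangentSpace (cornerModel n) x}
    (hX : ContMDiff (cornerModel n) (cornerModel n).tangent 1
      (fun x => (⟨x, X x⟩ : TangentBundle (cornerModel n) M)))
    (h : ∀ᶠ x in 𝓝 q, X x = 0) (P : Eucl n →L[ℝ] Eucl n) : divAlong g X q P = 0 := by
  have hqs := mem_chart_source (EuclideanQuadrant n) q
  have hz := coords_mem_target hqs
  have hzq := mem_quad_of_mem_target hz
  have he : fieldIn X q =ᶠ[𝓝[quad n] coords q q] fun _ => 0 := by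
    filter_upwards [eventually_pointAt_mem hz (W := {x | X x = 0})
      (by rw [pointAt_coords hqs]; exact h)] with w hw
    have h0 : X (pointAt q w) = 0 := hw.2
    rw [fieldIn, h0]
    exact congrArg Prod.snd ((trivializationAt (Eucl n) (TangentSpace (cornerModel n)) q).zeroSection
      ℝ (pointAt_mem_source hw.1))
  have h1 : fieldIn X q (coords q q) = 0 := he.self_of_nhdsWithin hzq
  rw [divAlong_eq hX, covEnd, he.fderivWithin_eq_of_mem hzq, fderivWithin_const_apply, h1]
  have : lowerChristoffel (fderivWithin ℝ (metricIn g q) (quad n) (coords q q)) 0 = 0 := by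
    ext u v
    simp [lowerChristoffel_apply]
  rw [this]
  simp

variable {ι : Type*}

/-- The components of a field normal to a face, in two charts, have the same sign. -/
lemma IsFaceCoord.exists_pos_mul {F W : Set M} {k d : Fin n} (hW : IsOpen W)
    (hWp : W ⊆ (chartAt (EuclideanQuadrant n) p).source)
    (hFW : ∀ x ∈ W, x ∈ F → coords (n := n) p x k = 0) (hq : q ∈ W) (hd : IsFaceCoord F q d) :
    ∃ α : ℝ, 0 < α ∧ Y (coords p q) k = α * fieldCoord (fieldOf p Y) q d (coords q q) := by
  obtain ⟨α, hα, h⟩ := hd.exists_pos_smul hW hWp hFW hq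
  refine ⟨α, hα, ?_⟩
  have hqs := mem_chart_source (EuclideanQuadrant n) q
  have hz := coords_mem_target hqs
  have h1 := fieldIn_transition (X := fieldOf p Y) (p := p) hz
    (by rw [pointAt_coords hqs]; exact hWp hq)
  rw [transition_coords hqs, fieldIn_fieldOf (coords_mem_target (hWp hq)),
    ← transitionEquiv_eq (hWp hq)] at h1
  rw [h1, fieldCoord_eq hz]
  exact DFunLike.congr_fun h (fieldIn (fieldOf p Y) q (coords q q))

lemma admissible_fieldOf [T2Space M] (F : FaceSystem n M ι) {T B : ι}
    (hTB : Disjoint (F.face T) (F.face B)) {c : Fin n} (hc : IsFaceCoord (F.face T) p c)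
    {W : Set M} (hW : IsOpen W) (hWp : W ⊆ (chartAt (EuclideanQuadrant n) p).source)
    (hpW : ∀ i, ∀ q ∈ W, q ∈ F.face i → p ∈ F.face i)
    (hFW : ∀ i k, IsFaceCoord (F.face i) p k → ∀ q ∈ W, (q ∈ F.face i ↔ coords (n := n) p q k = 0))
    {r R : ℝ} (hrR : r < R) (hball : ∀ z ∈ quad n ∩ Metric.ball (coords p p) R,
      z ∈ (extChartAt (cornerModel n) p).target ∧ pointAt p z ∈ W)
    (hY : ∀ z ∈ quad n ∩ Metric.ball (coords p p) R, ContDiffWithinAt ℝ 1 Y (quad n) z)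
    (hY0 : ∀ z ∈ quad n, r ≤ dist z (coords p p) → Y z = 0)
    (hYlat : ∀ k ∈ lateral (coords p p) c, ∀ z, z k = 0 → Y z k = 0)
    (hYc : ∀ z ∈ quad n, 0 ≤ Y z c) : Admissible F T B (fieldOf p Y) := by
  have hcont := contMDiff_fieldOf hrR (fun z hz => (hball z hz).1) hY hY0
  -- the field vanishes outside of `W`
  have hzero : ∀ q, q ∉ W → ∀ d, fieldCoord (fieldOf p Y) q d (coords q q) = 0 := fun q hq d => by
    have h0 : fieldOf p Y q = 0 := fieldOf_eq_zero fun hqs => by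
      have hz := mem_quad_of_mem_target (coords_mem_target hqs)
      refine hY0 _ hz (le_of_lt (not_le.1 fun h => hq ?_))
      have := (hball _ ⟨hz, lt_of_le_of_lt h hrR⟩).2
      rwa [pointAt_coords hqs] at this
    have h1 : fieldCoord (fieldOf p Y) q d (coords q q) =
        component (mfderiv (cornerModel n) 𝓘(ℝ, Eucl n) (extChartAt (cornerModel n) q) q
          (fieldOf p Y q)) d := by
      rw [fieldCoord, pointAt_coords (mem_chart_source (EuclideanQuadrant n) q)]
    rw [h1, h0, map_zero]
    rfl
  refine ⟨hcont, fun i hiT hiB q d hd => ?_, fun q d hd => ?_, fun q d hd => ?_⟩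
  · by_cases hq : q ∈ W
    · obtain ⟨k, hk⟩ := F.exists_coord i p (hpW i q hq hd.1)
      obtain ⟨α, hα, h⟩ := hd.exists_pos_mul (Y := Y) hW hWp (fun x hx => (hFW i k hk x hx).1) hq
      have hkL : k ∈ lateral (coords p p) c := by
        refine mem_lateral.2 ⟨?_, hk.coords_eq_zero⟩
        rintro rfl
        obtain ⟨j, -, hj⟩ := F.existsUnique_face p k hk.coords_eq_zero
        exact hiT ((hj i hk).trans (hj T hc).symm)
      rw [hYlat k hkL _ ((hFW i k hk q hq).1 hd.1)] at h
      exact (mul_eq_zero.1 h.symm).resolve_left hα.ne'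
    · exact hzero q hq d
  · by_cases hq : q ∈ W
    · obtain ⟨α, hα, h⟩ := hd.exists_pos_mul (Y := Y) hW hWp (fun x hx => (hFW T c hc x hx).1) hq
      have h1 := hYc _ (mem_quad_of_mem_target (coords_mem_target (hWp hq)))
      rw [h] at h1
      exact nonneg_of_mul_nonneg_right h1 hα
    · exact (hzero q hq d).ge
  · by_cases hq : q ∈ W
    · exact absurd (hpW B q hq hd.1) (Set.disjoint_left.1 hTB hc.1)
    · exact (hzero q hq d).ge

end LocalField

/-! ### The first variation -/

section FirstVariation

variable {n : ℕ} {M : Type*} [TopologicalSpace M] [ChartedSpace (EuclideanQuadrant n) M]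
  [IsManifold (cornerModel n) 2 M] {g : Metric n M} {m : ℕ}

/-- A varifold does not charge the set where the divergence of a field is negative on all
hyperplanes, if the first variation is nonnegative and the divergence is nonpositive. -/
lemma Varifold.measure_eq_zero (V : Varifold g m) {X : ∀ x : M, TangentSpace (cornerModel n) x}
    (hV : 0 ≤ V.firstVariation X) {h : EndBundle n M → ℝ} (hcont : Continuous h) {C : ℝ} {U : Set M}
    (hh : ∀ z : EndBundle n M, IsOrthProj g m z.proj z.snd →
      divAlong g X z.proj z.snd = h z ∧ |h z| ≤ C ∧ h z ≤ 0 ∧ (z.proj ∈ U → h z < 0)) :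
    V.measure (TotalSpace.proj ⁻¹' U) = 0 := by
  let _ : MeasurableSpace (EndBundle n M) := borel _
  have : BorelSpace (EndBundle n M) := ⟨rfl⟩
  have : IsFiniteMeasure V.measure := ⟨V.finite⟩
  have hae := V.isOrthProj
  have hint : Integrable h V.measure := by
    refine Integrable.of_bound hcont.measurable.aestronglyMeasurable C ?_
    filter_upwards [hae] with z hz
    exact (hh z hz).2.1
  have heq : V.firstVariation X = ∫ z, h z ∂V.measure := by
    refine integral_congr_ae ?_
    filter_upwards [hae] with z hz
    exact (hh z hz).1
  have hneg : 0 ≤ᵐ[V.measure] fun z => -h z := by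
    filter_upwards [hae] with z hz
    exact neg_nonneg.2 (hh z hz).2.2.1
  have hzero : ∫ z, -h z ∂V.measure = 0 := by
    refine le_antisymm ?_ (integral_nonneg_of_ae hneg)
    rw [integral_neg, ← heq]
    linarith
  rw [integral_eq_zero_iff_of_nonneg_ae hneg hint.neg] at hzero
  have hnot : ∀ᵐ z ∂V.measure, z ∉ (TotalSpace.proj ⁻¹' U : Set (EndBundle n M)) := by
    filter_upwards [hae, hzero] with z hz h0 hzU
    have h1 := (hh z hz).2.2.2 hzU
    have h2 : -h z = 0 := h0
    linarith
  exact measure_eq_zero_iff_ae_notMem.2 hnot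

end FirstVariation

section ChartDivergence

variable {n : ℕ}

lemma continuousWithinAt_symGrad {G : Eucl n → Eucl n →L[ℝ] Eucl n →L[ℝ] ℝ} {Y : Eucl n → Eucl n}
    {z₀ : Eucl n} {R : ℝ} (hI : ∀ z ∈ quad n ∩ Metric.ball z₀ R, IsInnerProd (G z))
    (hG : ∀ z ∈ quad n ∩ Metric.ball z₀ R, ContDiffWithinAt ℝ 1 G (quad n) z)
    (hY : ∀ z ∈ quad n ∩ Metric.ball z₀ R, ContDiffWithinAt ℝ 1 Y (quad n) z) {z : Eucl n}
    (hz : z ∈ quad n ∩ Metric.ball z₀ R) :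
    ContinuousWithinAt (symGrad G Y (quad n)) (quad n) z := by
  have h1 := continuousWithinAt_fderivWithin_quad hY hz
  have h2 := continuousWithinAt_fderivWithin_quad hG hz
  have h3 := (contDiffWithinAt_inverse (hG z hz) (hI z hz)).continuousWithinAt
  exact h1.add ((h3.clm_comp (h2.clm_apply (hY z hz).continuousWithinAt)).const_smul (1 / 2 : ℝ))

lemma symGrad_congr {G : Eucl n → Eucl n →L[ℝ] Eucl n →L[ℝ] ℝ} {Y Y' : Eucl n → Eucl n}
    {z : Eucl n} (hz : z ∈ quad n) (h : Y =ᶠ[𝓝[quad n] z] Y') :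
    symGrad G Y (quad n) z = symGrad G Y' (quad n) z := by
  rw [symGrad, symGrad, h.fderivWithin_eq_of_mem hz, h.self_of_nhdsWithin hz]

lemma symGrad_eq_zero {G : Eucl n → Eucl n →L[ℝ] Eucl n →L[ℝ] ℝ} {Y : Eucl n → Eucl n}
    {z z₀ : Eucl n} {r : ℝ} (hz : z ∈ quad n) (hY0 : ∀ z ∈ quad n, r ≤ dist z z₀ → Y z = 0)
    (h : r < dist z z₀) : symGrad G Y (quad n) z = 0 := by
  have he : Y =ᶠ[𝓝[quad n] z] fun _ => 0 := by
    have h1 : ∀ᶠ w in 𝓝[quad n] z, r < dist w z₀ :=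
      (((continuous_id.dist continuous_const).tendsto z).eventually_const_lt h).filter_mono
        nhdsWithin_le_nhds
    filter_upwards [h1, self_mem_nhdsWithin] with w hw hwq
    exact hY0 w hwq hw.le
  rw [symGrad_congr hz he, symGrad, fderivWithin_const_apply, map_zero]
  simp

/-- Orthogonal projections have bounded norm, since the metric is comparable to the Euclidean
one. -/
lemma IsProj.norm_le {G : Eucl n →L[ℝ] Eucl n →L[ℝ] ℝ} (hI : IsInnerProd G) {m : ℕ}
    {P : Eucl n →L[ℝ] Eucl n} (hP : IsProj G m P) {K : ℝ} (hK : 1 ≤ K) (h1 : ‖G‖ ≤ K)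
    (h2 : ‖G.inverse‖ ≤ K) : ‖P‖ ≤ K ^ 2 := by
  have hK0 : 0 ≤ K := by linarith
  refine ContinuousLinearMap.opNorm_le_bound _ (by positivity) fun u => ?_
  have h3 := hI.norm_sq_le h1 h2 (P u)
  have h4 : G (P u) (P u) ≤ G u u := by
    have h5 := hI.nonneg (u - P u)
    have h6 : G (P u) u = G (P u) (P u) := by
      have := hP.2.1 (P u) u
      rw [hP.1] at this
      exact this
    rw [map_sub, map_sub, _root_.sub_apply, _root_.sub_apply, hI.symm u (P u), h6] at h5
    linarith
  have h5 : G u u ≤ K * ‖u‖ ^ 2 := by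
    calc G u u ≤ |G u u| := le_abs_self _
      _ ≤ ‖G u‖ * ‖u‖ := (G u).le_opNorm u
      _ ≤ (‖G‖ * ‖u‖) * ‖u‖ := by gcongr; exact G.le_opNorm u
      _ ≤ (K * ‖u‖) * ‖u‖ := by gcongr
      _ = _ := by ring
  refine le_of_sq_le_sq ?_ (by positivity)
  calc ‖P u‖ ^ 2 ≤ K ^ 3 * G (P u) (P u) := h3
    _ ≤ K ^ 3 * (K * ‖u‖ ^ 2) := by gcongr; exact h4.trans h5
    _ = (K ^ 2 * ‖u‖) ^ 2 := by ring

end ChartDivergence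

/-! ### The support of a stationary varifold avoids strictly mean convex barriers -/

section Barrier

variable {n : ℕ} {M : Type*} [TopologicalSpace M] [ChartedSpace (EuclideanQuadrant n) M]
  [IsManifold (cornerModel n) 2 M] {g : Metric n M} {p q : M} {m : ℕ}

/-- The components of endomorphisms of the tangent spaces in the chart at `p`. -/
def endIn (p : M) (z : EndBundle n M) : Eucl n →L[ℝ] Eucl n :=
  (trivializationAt (Eucl n →L[ℝ] Eucl n)
    (fun x : M => TangentSpace (cornerModel n) x →L[ℝ] TangentSpace (cornerModel n) x) p z).2

lemma endIn_eq (h : q ∈ (chartAt (EuclideanQuadrant n) p).source) (P : Eucl n →L[ℝ] Eucl n) :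
    endIn p (⟨q, P⟩ : EndBundle n M) = (transitionEquiv h : Eucl n →L[ℝ] Eucl n) ∘L P ∘L
      ((transitionEquiv h).symm : Eucl n →L[ℝ] Eucl n) := by
  have h1 := TangentBundle.continuousLinearMapAt_trivializationAt_eq_core (I := cornerModel n) h
  have h2 := TangentBundle.symmL_trivializationAt_eq_core (I := cornerModel n) h
  rw [endIn, hom_trivializationAt_apply]
  change (trivializationAt (Eucl n) (TangentSpace (cornerModel n)) p).continuousLinearMapAt ℝ q ∘L
    (P ∘L (trivializationAt (Eucl n) (TangentSpace (cornerModel n)) p).symmL ℝ q) = _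
  rw [h1, h2]
  rfl

lemma continuousAt_endIn {z : EndBundle n M}
    (h : z.proj ∈ (chartAt (EuclideanQuadrant n) p).source) : ContinuousAt (endIn p) z := by
  have h1 := (trivializationAt (Eucl n →L[ℝ] Eucl n)
    (fun x : M => TangentSpace (cornerModel n) x →L[ℝ] TangentSpace (cornerModel n) x)
      p).toOpenPartialHomeomorph.continuousAt (x := z)
        ((Trivialization.mem_source _).2 (by simpa using h))
  exact continuous_snd.continuousAt.comp h1

open Classical in
/-- The function `tr (Π ∘ symGrad Y)` on the domain of the chart at `p`, extended by zero. -/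
def chartDiv (g : Metric n M) (p : M) (Y : Eucl n → Eucl n) (z : EndBundle n M) : ℝ :=
  if z.proj ∈ (chartAt (EuclideanQuadrant n) p).source then
    traceL _ (endIn p z ∘L symGrad (metricIn g p) Y (quad n) (coords p z.proj)) else 0

variable {Y : Eucl n → Eucl n} {r R : ℝ}

lemma chartDiv_eq_zero (hY0 : ∀ z ∈ quad n, r ≤ dist z (coords p p) → Y z = 0) {z : EndBundle n M}
    (hz : z.proj ∉ chartBall (n := n) p r) : chartDiv g p Y z = 0 := by
  rw [chartDiv]
  split_ifs with h
  · rw [symGrad_eq_zero (mem_quad_of_mem_target (coords_mem_target h)) hY0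
      (not_le.1 fun h1 => hz (mem_chartBall h h1))]
    simp
  · rfl

lemma continuous_chartDiv [T2Space M] (hrR : r < R)
    (hball : ∀ z ∈ quad n ∩ Metric.ball (coords p p) R, z ∈ (extChartAt (cornerModel n) p).target)
    (hY : ∀ z ∈ quad n ∩ Metric.ball (coords p p) R, ContDiffWithinAt ℝ 1 Y (quad n) z)
    (hY0 : ∀ z ∈ quad n, r ≤ dist z (coords p p) → Y z = 0) : Continuous (chartDiv g p Y) := by
  rw [continuous_iff_continuousAt]
  intro z
  have hproj : Continuous (TotalSpace.proj : EndBundle n M → M) :=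
    FiberBundle.continuous_proj (Eucl n →L[ℝ] Eucl n)
      (fun x : M => TangentSpace (cornerModel n) x →L[ℝ] TangentSpace (cornerModel n) x)
  have hsub : ∀ z ∈ quad n ∩ Metric.closedBall (coords p p) r,
      z ∈ quad n ∩ Metric.ball (coords p p) R := fun z hz =>
    ⟨hz.1, Metric.closedBall_subset_ball hrR hz.2⟩
  by_cases hz : z.proj ∈ chartBall (n := n) p r
  · obtain ⟨w, hw, hwz⟩ := hz
    have hwt := hball w (hsub w hw)
    have hs : z.proj ∈ (chartAt (EuclideanQuadrant n) p).source := by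
      rw [← hwz]; exact pointAt_mem_source hwt
    have hcw : coords p z.proj = w := by rw [← hwz, coords_pointAt hwt]
    have h1 : ContinuousAt (fun x : EndBundle n M => coords (n := n) p x.proj) z :=
      (continuousAt_extChartAt' (I := cornerModel n) (by rwa [extChartAt_source])).comp
        hproj.continuousAt
    have h2 : Tendsto (fun x : EndBundle n M => coords (n := n) p x.proj) (𝓝 z)
        (𝓝[quad n] (coords p z.proj)) :=
      tendsto_nhdsWithin_iff.2 ⟨h1, Eventually.of_forall fun x => mem_range_self _⟩
    have h3 : ContinuousWithinAt (symGrad (metricIn g p) Y (quad n)) (quad n)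
        (coords p z.proj) := by
      rw [hcw]
      exact continuousWithinAt_symGrad (fun z hz => isInnerProd_metricIn (hball z hz))
        (fun z hz => contDiffWithinAt_metricIn (hball z hz)) hY (hsub w hw)
    have h4 : ContinuousAt (fun x : EndBundle n M => traceL (Eucl n)
        (endIn p x ∘L symGrad (metricIn g p) Y (quad n) (coords p x.proj))) z :=
      (traceL (Eucl n)).continuous.continuousAt.comp
        ((continuousAt_endIn hs).clm_comp (h3.tendsto.comp h2))
    refine h4.congr ?_
    filter_upwards [hproj.continuousAt.preimage_mem_nhds
      ((chartAt (EuclideanQuadrant n) p).open_source.mem_nhds hs)] with x hx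
    rw [chartDiv, if_pos (show x.proj ∈ _ from hx)]
  · have hcl : IsClosed (chartBall (n := n) p r) := isClosed_chartBall fun z hz =>
      hball z (hsub z hz)
    refine (continuousAt_const (y := (0 : ℝ))).congr ?_
    filter_upwards [hproj.continuousAt.preimage_mem_nhds (hcl.isOpen_compl.mem_nhds hz)] with x hx
    exact (chartDiv_eq_zero hY0 hx).symm

lemma exists_bound_chartDiv (hrR : r < R)
    (hball : ∀ z ∈ quad n ∩ Metric.ball (coords p p) R, z ∈ (extChartAt (cornerModel n) p).target)
    (hY : ∀ z ∈ quad n ∩ Metric.ball (coords p p) R, ContDiffWithinAt ℝ 1 Y (quad n) z) :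
    ∃ C, ∀ z ∈ quad n ∩ Metric.closedBall (coords p p) r, ∀ P,
      IsProj (metricIn g p z) m P →
        |traceL _ (P ∘L symGrad (metricIn g p) Y (quad n) z)| ≤ C := by
  have hsub : quad n ∩ Metric.closedBall (coords p p) r ⊆ quad n ∩ Metric.ball (coords p p) R :=
    fun z hz => ⟨hz.1, Metric.closedBall_subset_ball hrR hz.2⟩
  have hcpt : IsCompact (quad n ∩ Metric.closedBall (coords p p) r) := by
    rw [inter_comm]
    exact (isCompact_closedBall _ _).inter_right (cornerModel n).isClosed_range
  have hI : ∀ z ∈ quad n ∩ Metric.ball (coords p p) R, IsInnerProd (metricIn g p z) := fun z hz =>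
    isInnerProd_metricIn (hball z hz)
  have hG : ∀ z ∈ quad n ∩ Metric.ball (coords p p) R,
      ContDiffWithinAt ℝ 1 (metricIn g p) (quad n) z := fun z hz =>
    contDiffWithinAt_metricIn (hball z hz)
  obtain ⟨A, hA⟩ := hcpt.exists_bound_of_continuousOn
    (f := symGrad (metricIn g p) Y (quad n)) fun z hz =>
      (continuousWithinAt_symGrad hI hG hY (hsub hz)).mono inter_subset_left
  obtain ⟨K₁, hK₁⟩ := hcpt.exists_bound_of_continuousOn (f := metricIn g p) fun z hz =>
    (hG z (hsub hz)).continuousWithinAt.mono inter_subset_left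
  obtain ⟨K₂, hK₂⟩ := hcpt.exists_bound_of_continuousOn (f := fun z => (metricIn g p z).inverse)
    fun z hz => (contDiffWithinAt_inverse (hG z (hsub hz))
      (hI z (hsub hz))).continuousWithinAt.mono inter_subset_left
  obtain ⟨K, hK⟩ : ∃ K, K = max 1 (max K₁ K₂) := ⟨_, rfl⟩
  refine ⟨‖traceL (Eucl n)‖ * (K ^ 2 * A), fun z hz P hP => ?_⟩
  have h1 : ‖P‖ ≤ K ^ 2 := hP.norm_le (hI z (hsub hz)) (hK ▸ le_max_left _ _)
    ((hK₁ z hz).trans (hK ▸ (le_max_left _ _).trans (le_max_right _ _)))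
    ((hK₂ z hz).trans (hK ▸ (le_max_right _ _).trans (le_max_right _ _)))
  calc |traceL _ (P ∘L symGrad (metricIn g p) Y (quad n) z)|
      ≤ ‖traceL (Eucl n)‖ * ‖P ∘L symGrad (metricIn g p) Y (quad n) z‖ :=
        (traceL (Eucl n)).le_opNorm _
    _ ≤ ‖traceL (Eucl n)‖ * (‖P‖ * ‖symGrad (metricIn g p) Y (quad n) z‖) := by
        gcongr; exact ContinuousLinearMap.opNorm_comp_le _ _
    _ ≤ ‖traceL (Eucl n)‖ * (K ^ 2 * A) := by
        gcongr; exact hA z hz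

variable {ι : Type*}

lemma Admissible.swap {F : FaceSystem n M ι} {T B : ι} {X : ∀ x : M, TangentSpace (cornerModel n) x}
    (h : Admissible F T B X) : Admissible F B T X :=
  ⟨h.contMDiff, fun i hB hT => h.tangential i hT hB, h.inward_bottom, h.inward_top⟩

/-- The support of a varifold that is stationary for the problem with barriers does not meet a
strictly mean convex face that is orthogonal to the lateral faces. -/
theorem Varifold.support_inter_face_eq_empty [T2Space M] [Finite ι] (hm : m + 1 = n)
    (F : FaceSystem n M ι) {T B : ι} (hTB : Disjoint (F.face T) (F.face B))
    (angle : ∀ i, i ≠ T → i ≠ B → MeetAtAngle g (F.face T) (F.face i) (Real.pi / 2))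
    (convex : StrictlyMeanConvex g (F.face T)) (V : Varifold g m) (hV : V.IsStationary F T B) :
    V.support ∩ F.face T = ∅ := by
  rw [eq_empty_iff_forall_notMem]
  rintro p ⟨hpV, hpT⟩
  obtain ⟨c, hc⟩ := F.exists_coord T p hpT
  obtain ⟨W, hW, hpW, hWp, hWF, hFW⟩ := F.exists_nhds p
  have hps := mem_chart_source (EuclideanQuadrant n) p
  have hz := coords_mem_target hps
  obtain ⟨R, hR, hsub⟩ := Metric.mem_nhdsWithin_iff.1 (eventually_pointAt_mem hz (W := W)
    (by rw [pointAt_coords hps]; exact hW.mem_nhds hpW))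
  have hball : ∀ z ∈ quad n ∩ Metric.ball (coords p p) R,
      z ∈ (extChartAt (cornerModel n) p).target ∧ pointAt p z ∈ W := fun z hz => hsub ⟨hz.2, hz.1⟩
  have hball' := fun z hz => (hball z hz).1
  have hrR : R / 2 < R := by linarith
  obtain ⟨Y, hY, hY0, hYlat, hYc, U, hU, hdiv⟩ :=
    (isBarrierMetric_metricIn (g := g) F hTB angle convex hc hW hWp hFW hR hball).exists_barrier hm
      (half_pos hR)
  have hadm := admissible_fieldOf F hTB hc hW hWp hWF hFW hrR hball hY hY0 hYlat hYc
  obtain ⟨C, hC⟩ := exists_bound_chartDiv (g := g) (m := m) hrR hball' hY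
  refine (hpV ({q | coords p q ∈ U ∩ Metric.ball (coords p p) (R / 2)} ∩
    (chartAt (EuclideanQuadrant n) p).source) ?_).ne'
    (V.measure_eq_zero (hV _ hadm) (continuous_chartDiv (g := g) hrR hball' hY hY0) (C := max C 0)
      fun z hzP => ?_)
  · refine inter_mem ?_ ((chartAt _ p).open_source.mem_nhds hps)
    exact (continuousAt_extChartAt (I := cornerModel n) p) (inter_mem hU
      (Metric.ball_mem_nhds _ (half_pos hR)))
  obtain ⟨q, P⟩ := z
  have hcl : IsClosed (chartBall (n := n) p (R / 2)) := isClosed_chartBall fun z hz =>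
    hball' z ⟨hz.1, Metric.closedBall_subset_ball hrR hz.2⟩
  by_cases hq : q ∈ chartBall (n := n) p (R / 2)
  · obtain ⟨w, hw, hwq⟩ := hq
    have hwR : w ∈ quad n ∩ Metric.ball (coords p p) R :=
      ⟨hw.1, Metric.closedBall_subset_ball hrR hw.2⟩
    have hwt := hball' w hwR
    have hs : q ∈ (chartAt (EuclideanQuadrant n) p).source := by
      rw [← hwq]; exact pointAt_mem_source hwt
    have hcw : coords p q = w := by rw [← hwq, coords_pointAt hwt]
    obtain ⟨hproj, heq⟩ := divAlong_eq_symGrad hm hadm.contMDiff hs hzP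
    have hsymm : symGrad (metricIn g p) (fieldIn (fieldOf p Y) p) (quad n) w =
        symGrad (metricIn g p) Y (quad n) w := by
      refine symGrad_congr hw.1 ?_
      filter_upwards [extChartAt_target_mem_nhdsWithin_of_mem hwt] with x hx
      exact fieldIn_fieldOf hx
    rw [hcw] at hproj heq
    rw [hsymm] at heq
    have hch : chartDiv g p Y ⟨q, P⟩ = traceL _ (((transitionEquiv hs : Eucl n →L[ℝ] Eucl n) ∘L
        P ∘L ((transitionEquiv hs).symm : Eucl n →L[ℝ] Eucl n)) ∘L
          symGrad (metricIn g p) Y (quad n) w) := by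
      rw [chartDiv, if_pos hs, hcw]
      exact congrArg (fun A => traceL (Eucl n) (A ∘L symGrad (metricIn g p) Y (quad n) w))
        (endIn_eq hs P)
    obtain ⟨h1, h2⟩ := hdiv w hwR _ hproj
    rw [hch]
    refine ⟨heq, (hC w hw _ hproj).trans (le_max_left _ _), h1, fun hqU => h2 ?_⟩
    rw [← hcw]
    exact hqU.1.1
  · have h0 : chartDiv g p Y ⟨q, P⟩ = 0 := chartDiv_eq_zero hY0 hq
    rw [h0]
    refine ⟨divAlong_eq_zero_of_eventually hadm.contMDiff ?_ P, by simp, le_rfl,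
      fun hqU => absurd (mem_chartBall hqU.2 (le_of_lt hqU.1.2)) hq⟩
    filter_upwards [hcl.isOpen_compl.mem_nhds hq] with x hx
    exact fieldOf_eq_zero fun hxs => hY0 _ (mem_quad_of_mem_target (coords_mem_target hxs))
      (le_of_lt (not_le.1 fun h => hx (mem_chartBall hxs h)))

end Barrier

end RiemPoly

end

theorem mainTheorem10 {n m : ℕ} (hm : m + 1 = n)
    {M : Type*} [TopologicalSpace M] [T2Space M] [CompactSpace M]
    [ChartedSpace (EuclideanQuadrant n) M] [IsManifold (RiemPoly.cornerModel n) 2 M]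
    (g : RiemPoly.Metric n M)
    {ι : Type*} [Finite ι] (F : RiemPoly.FaceSystem n M ι) (T B : ι)
    (hTB : Disjoint (F.face T) (F.face B))
    (angleT : ∀ i, i ≠ T → i ≠ B → RiemPoly.MeetAtAngle g (F.face T) (F.face i) (Real.pi / 2))
    (angleB : ∀ i, i ≠ T → i ≠ B → RiemPoly.MeetAtAngle g (F.face B) (F.face i) (Real.pi / 2))
    (convexT : RiemPoly.StrictlyMeanConvex g (F.face T))
    (convexB : RiemPoly.StrictlyMeanConvex g (F.face B))
    (V : RiemPoly.Varifold g m) (hV : V.IsStationary F T B) :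
    V.support ∩ F.face T = ∅ ∧ V.support ∩ F.face B = ∅ :=
  ⟨V.support_inter_face_eq_empty hm F hTB angleT convexT hV,
    V.support_inter_face_eq_empty hm F hTB.symm (fun i hB hT => angleB i hT hB) convexB
      fun X hX => hV X hX.swap⟩
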